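/- Let $n\ge 2$, let $a,b>1$ and $k\ge 0$ be real numbers, and put $$c=n\,\frac{ab^{n-1}-1}{b^n-1},\qquad c_k=c-\frac{nk}{n+1}\,\frac{b^{n+1}-1}{b^n-1}.$$ Let $X_n$ be the blow-up of $\mathbb P^n$ at one point, $E_0$ its exceptional divisor and $E_\infty$ the pull-back of a hyperplane not containing the point, so that $X_n\smallsetminus(E_0\cup E_\infty)\cong\mathbb C^n\smallsetminus\{0\}$. Put $s=\log|x|^2$ for $x\in\mathbb C^n\smallsetminus\{0\}$, and let $\xi=kw\,\partial/\partial w$, where $w$ is the fibre coordinate of $\mathcal O_{\mathbb P^{n-1}}(-1)$. A *Calabi metric* in the class $\beta[E_\infty]-\alpha[E_0]$ ($\beta>\alpha>0$) is a Kähler metric in that class that equals $\frac{\sqrt{-1}}{2\pi}\partial\bar\partial f(s)$ on $X_n\smallsetminus(E_0\cup E_\infty)$ for some $f\in C^\infty(\mathbb R)$ with $f'>0$, $f''>0$, such that $f(\log t)-\alpha\log t$ and $f(-\log t)+\beta\log t$ extend smoothly to $t=0$ with positive derivative at $t=0$. For a Kähler metric $\chi$, the normalized Hamiltonian $\theta_\xi(\chi)$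 is the real smooth function with $i_\xi\chi=\frac{\sqrt{-1}}{2\pi}\bar\partial\theta_\xi(\chi)$ and $\int_{X_n}\theta_\xi(\chi)\chi^n=0$. Suppose that $c_k+k>n-1$. Then the function $$\psi(\tau)=\frac{k\tau^2}{n+1}+\frac{c_k}{n}\,\tau+\left(\frac{n+1-k}{n+1}-\frac{c_k}{n}\right)\frac1{\tau^{n-1}}$$ is smooth on $(0,\infty)$, satisfies $$\psi''+(n-1)\frac{\psi'}{\tau}-(n-1)\frac{\psi}{\tau^2}-k=0\ \text{ on }[1,b],\qquad \psi(1)=1,\quad \psi(b)=a,$$ and has $\psi'>0$ on $[1,b]$; in particular it is strictly increasing there. Moreover, for every Calabi metric $\omega=\frac{\sqrt{-1}}{2\pi}\partial\bar\partial g(s)$ in $a[E_\infty]-[E_0]$ there is a Calabi metric $\chi=\frac{\sqrt{-1}}{2\pi}\partial\bar\partial f(s)$ in $b[E_\infty]-[E_0]$ with $1<f'<b$ and $\psi(f'(s))=g'(s)$ for all $s\in\mathbb R$ that solves the modified $J$-equation $$n\,\frac{\omega\wedge\chi^{n-1}}{\chi^n}=c+\theta_\xi(\chi)\quad\text{on }X_n,\qquad\text{where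 } c=n\,\frac{\int_{X_n}\omega\wedge\chi^{n-1}}{\int_{X_n}\chi^n}.$$ For every Kähler metric $\chi_0$ in the class $b[E_\infty]-[E_0]$, this $\chi$ is $\chi_0+\frac{\sqrt{-1}}{2\pi}\partial\bar\partial\varphi$ for some $\varphi\in C^\infty(X_n,\mathbb R)$. -/

import Mathlib

open scoped ComplexOrder

noncomputable section

namespace CalabiJ

/-! ### The blow-up of projective space at one point -/

/-- The blow-up `X_n` of `ℙⁿ = ℙ(ℂⁿ ⊕ ℂ)` at the point `[0 : 1]`: pairs `(m, ℓ)` in `ℙⁿ × ℙⁿ⁻¹`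
with `m = [x : t]`, `ℓ = [z]` and `x i * z j = x j * z i` for all `i, j`. -/
def X (n : ℕ) : Type :=
  {p : Projectivization ℂ ((Fin n → ℂ) × ℂ) × Projectivization ℂ (Fin n → ℂ) //
    ∀ i j, p.1.rep.1 i * p.2.rep j = p.1.rep.1 j * p.2.rep i}

/-- The exceptional divisor `E₀`, the preimage of the blown-up point. -/
def E0 (n : ℕ) : Set (X n) := {p | p.1.1.rep.1 = 0}

/-- The divisor `E_∞`, the pull-back of the hyperplane at infinity of `ℙⁿ`. -/
def Einf (n : ℕ) : Set (X n) := {p | p.1.1.rep.2 = 0}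

/-- Which of the two divisors a chart meets. -/
inductive Side
  | zero
  | infinity

/-- `X_n` is covered by `2n` charts, each of them a copy of `ℂⁿ`. -/
abbrev Chart (n : ℕ) : Type := Fin n × Side

/-- The homogeneous vector `(y_1, …, 1, …, y_n)` with `1` in place `i`. -/
def dir {n : ℕ} (i : Fin n) (y : Fin n → ℂ) : Fin n → ℂ := Function.update y i 1

theorem dir_ne_zero {n : ℕ} (i : Fin n) (y : Fin n → ℂ) : dir i y ≠ 0 := by
  intro h
  have := congrFun h i
  simp [dir] at this

/-- Homogeneous coordinates of the image in `ℙⁿ`: with `Z = dir i y`, they are `[y_i Z : 1]` in the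
charts along `E₀` and `[Z : y_i]` in the charts along `E_∞`. -/
def baseVec {n : ℕ} : Chart n → (Fin n → ℂ) → (Fin n → ℂ) × ℂ
  | (i, Side.zero), y => (y i • dir i y, 1)
  | (i, Side.infinity), y => (dir i y, y i)

theorem baseVec_ne_zero {n : ℕ} (c : Chart n) (y : Fin n → ℂ) : baseVec c y ≠ 0 := by
  obtain ⟨i, s⟩ := c
  cases s
  · simp [baseVec]
  · intro h
    exact dir_ne_zero i y (congrArg Prod.fst h)

theorem baseVec_fst {n : ℕ} (c : Chart n) (y : Fin n → ℂ) :
    ∃ r : ℂ, (baseVec c y).1 = r • dir c.1 y := by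
  obtain ⟨i, s⟩ := c
  cases s
  · exact ⟨y i, rfl⟩
  · exact ⟨1, by simp [baseVec]⟩

/-- The chart parametrizations `ℂⁿ → X_n`.  In the chart `(i, ·)` the coordinates `y_j`, `j ≠ i`, are
the affine coordinates `z_j / z_i` of `ℙⁿ⁻¹`, and `y_i` is the fibre coordinate: `w` (vanishing on
`E₀`) in the chart `(i, zero)` and `v = 1 / w` (vanishing on `E_∞`) in the chart `(i, infinity)`. -/
def param {n : ℕ} (c : Chart n) (y : Fin n → ℂ) : X n :=
  ⟨(Projectivization.mk ℂ (baseVec c y) (baseVec_ne_zero c y),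
    Projectivization.mk ℂ (dir c.1 y) (dir_ne_zero c.1 y)), by
    intro i j
    obtain ⟨u, hu⟩ := Projectivization.exists_smul_eq_mk_rep ℂ (baseVec c y) (baseVec_ne_zero c y)
    obtain ⟨v, hv⟩ := Projectivization.exists_smul_eq_mk_rep ℂ (dir c.1 y) (dir_ne_zero c.1 y)
    obtain ⟨r, hr⟩ := baseVec_fst c y
    simp only [← hu, ← hv, Prod.smul_fst, hr, Pi.smul_apply, Units.smul_def, smul_eq_mul]
    ring⟩

/-- The chart coordinates, inverse to `param c` on its range. -/
def coord {n : ℕ} : Chart n → X n → (Fin n → ℂ)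
  | (i, Side.zero), p =>
      Function.update (fun j => p.1.2.rep j / p.1.2.rep i) i (p.1.1.rep.1 i / p.1.1.rep.2)
  | (i, Side.infinity), p =>
      Function.update (fun j => p.1.2.rep j / p.1.2.rep i) i (p.1.1.rep.2 / p.1.1.rep.1 i)

theorem param_fst_rep {n : ℕ} (c : Chart n) (y : Fin n → ℂ) :
    ∃ u : ℂ, u ≠ 0 ∧ (param c y).1.1.rep = u • baseVec c y := by
  obtain ⟨u, hu⟩ := Projectivization.exists_smul_eq_mk_rep ℂ (baseVec c y) (baseVec_ne_zero c y)
  exact ⟨u, u.ne_zero, hu.symm⟩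

theorem param_snd_rep {n : ℕ} (c : Chart n) (y : Fin n → ℂ) :
    ∃ v : ℂ, v ≠ 0 ∧ (param c y).1.2.rep = v • dir c.1 y := by
  obtain ⟨v, hv⟩ := Projectivization.exists_smul_eq_mk_rep ℂ (dir c.1 y) (dir_ne_zero c.1 y)
  exact ⟨v, v.ne_zero, hv.symm⟩

theorem coord_param {n : ℕ} (c : Chart n) (y : Fin n → ℂ) : coord c (param c y) = y := by
  obtain ⟨u, hu0, hu⟩ := param_fst_rep c y
  obtain ⟨v, hv0, hv⟩ := param_snd_rep c y
  obtain ⟨i, s⟩ := c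
  funext j
  by_cases hj : j = i
  · subst hj
    cases s <;> simp [coord, hu, baseVec, dir, hu0]
  · cases s <;> simp [coord, hv, dir, hv0, hj]

/-- The charts cover `X_n`. -/
theorem exists_param {n : ℕ} (p : X n) : ∃ c y, param (n := n) c y = p := by
  obtain ⟨⟨m, l⟩, h⟩ := p
  simp only at h
  have hl := l.rep_nonzero
  have hm := m.rep_nonzero
  obtain ⟨i, hi⟩ : ∃ i, l.rep i ≠ 0 := by
    by_contra! hc
    exact hl (funext hc)
  have hZ : ∀ q : ℂ, dir i (Function.update (fun j => l.rep j / l.rep i) i q)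
      = (l.rep i)⁻¹ • l.rep := by
    intro q
    funext j
    by_cases hj : j = i
    · subst hj; simp [dir, hi]
    · simp [dir, hj, div_eq_inv_mul]
  have hx : m.rep.1 = (m.rep.1 i / l.rep i) • l.rep := by
    funext j
    have := h i j
    simp only [Pi.smul_apply, smul_eq_mul]
    field_simp
    linear_combination -this
  by_cases ht : m.rep.2 = 0
  · have hxi : m.rep.1 i ≠ 0 := by
      intro h0
      apply hm
      refine Prod.ext ?_ ht
      rw [hx, h0]
      simp
    refine ⟨(i, Side.infinity),
      Function.update (fun j => l.rep j / l.rep i) i (m.rep.2 / m.rep.1 i), ?_⟩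
    apply Subtype.ext
    refine Prod.ext ?_ ?_
    · simp only [param]
      conv_rhs => rw [← m.mk_rep]
      rw [Projectivization.mk_eq_mk_iff']
      refine ⟨(m.rep.1 i)⁻¹, ?_⟩
      refine Prod.ext ?_ ?_
      · simp only [baseVec, hZ, Prod.smul_fst]
        conv_lhs => arg 2; rw [hx]
        simp only [smul_smul]
        congr 1
        field_simp
      · simp [baseVec, div_eq_inv_mul]
    · simp only [param]
      conv_rhs => rw [← l.mk_rep]
      rw [Projectivization.mk_eq_mk_iff']
      exact ⟨(l.rep i)⁻¹, (hZ _).symm⟩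
  · refine ⟨(i, Side.zero),
      Function.update (fun j => l.rep j / l.rep i) i (m.rep.1 i / m.rep.2), ?_⟩
    apply Subtype.ext
    refine Prod.ext ?_ ?_
    · simp only [param]
      conv_rhs => rw [← m.mk_rep]
      rw [Projectivization.mk_eq_mk_iff']
      refine ⟨(m.rep.2)⁻¹, ?_⟩
      refine Prod.ext ?_ ?_
      · simp only [baseVec, hZ, Prod.smul_fst]
        conv_lhs => rw [hx]
        simp only [Function.update_self, smul_smul]
        congr 1
        field_simp
      · simp [baseVec, ht]
    · simp only [param]
      conv_rhs => rw [← l.mk_rep]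
      rw [Projectivization.mk_eq_mk_iff']
      exact ⟨(l.rep i)⁻¹, (hZ _).symm⟩

/-! ### Functions and real (1,1)-forms on `X_n` -/

/-- Smooth real functions on `X_n`: smooth in every chart. -/
def SmoothFun {n : ℕ} (φ : X n → ℝ) : Prop :=
  ∀ c : Chart n, ContDiff ℝ (⊤ : ℕ∞) (fun y => φ (param c y))

/-- The Wirtinger derivative `∂F/∂y_j = (∂F/∂x_j - √-1 ∂F/∂t_j) / 2`, where `y_j = x_j + √-1 t_j`. -/
def dz {n : ℕ} (j : Fin n) (F : (Fin n → ℂ) → ℂ) (y : Fin n → ℂ) : ℂ :=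
  (fderiv ℝ F y (Pi.single j 1) - Complex.I * fderiv ℝ F y (Pi.single j Complex.I)) / 2

/-- The Wirtinger derivative `∂F/∂ȳ_j = (∂F/∂x_j + √-1 ∂F/∂t_j) / 2`, where `y_j = x_j + √-1 t_j`. -/
def dzbar {n : ℕ} (j : Fin n) (F : (Fin n → ℂ) → ℂ) (y : Fin n → ℂ) : ℂ :=
  (fderiv ℝ F y (Pi.single j 1) + Complex.I * fderiv ℝ F y (Pi.single j Complex.I)) / 2

/-- The complex Hessian `(∂²u / ∂y_j ∂ȳ_l)`. -/
def complexHessian {n : ℕ} (u : (Fin n → ℂ) → ℝ) (y : Fin n → ℂ) : Matrix (Fin n) (Fin n) ℂ :=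
  Matrix.of fun j l => dz j (dzbar l (fun y' => (u y' : ℂ))) y

/-- The complex Jacobian matrix at `y` of the holomorphic change of coordinates from chart `c` to
chart `d`. -/
def jacobian {n : ℕ} (c d : Chart n) (y : Fin n → ℂ) : Matrix (Fin n) (Fin n) ℂ :=
  Matrix.of fun m j => fderiv ℂ (fun y' => coord d (param c y')) y (Pi.single j 1) m

/-- A smooth real (1,1)-form on `X_n`.  In the chart `c` it is
`η = (√-1 / 2π) ∑ (coeff c)_{jl} dy_j ∧ dȳ_l`, with a Hermitian coefficient matrix, and the matrices
transform as such a form does between two charts. -/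
structure Form (n : ℕ) where
  coeff : Chart n → (Fin n → ℂ) → Matrix (Fin n) (Fin n) ℂ
  smooth : ∀ c j l, ContDiff ℝ (⊤ : ℕ∞) (fun y => coeff c y j l)
  hermitian : ∀ c y, (coeff c y).IsHermitian
  compat : ∀ c d y y', param c y = param d y' →
    coeff c y = (jacobian c d y).transpose * coeff d y' * (jacobian c d y).map (starRingEnd ℂ)

/-- A Kähler metric (form): positive definite and closed.  For a Hermitian coefficient matrix `H`,
closedness is `∂H_{jl}/∂y_m = ∂H_{ml}/∂y_j` (the `∂̄` half is the conjugate identity). -/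
def Form.IsKahler {n : ℕ} (η : Form n) : Prop :=
  (∀ c y, (η.coeff c y).PosDef) ∧
  ∀ c y j l m, dz m (fun y' => η.coeff c y' j l) y = dz j (fun y' => η.coeff c y' m l) y

/-- `η = (√-1 / 2π) ∂∂̄ u` on `X_n ∖ (E₀ ∪ E_∞)`. -/
def Form.HasPotential {n : ℕ} (η : Form n) (u : X n → ℝ) : Prop :=
  ∀ c y, param c y ∉ E0 n ∪ Einf n → η.coeff c y = complexHessian (fun y' => u (param c y')) y

/-- `η` lies in the class `β [E_∞] - α [E₀]`.  If `σ₀`, `σ_∞` are the defining sections of the two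
divisors, the class of `β E_∞ - α E₀` consists of the forms that are `(√-1 / 2π) ∂∂̄ u` off the
divisors, where `u = α log |σ₀|² - β log |σ_∞|²` plus a function that is smooth across the divisors;
`y_i` is a local equation of `E₀`, respectively of `E_∞`, in the chart `(i, ·)`. -/
def Form.InClass {n : ℕ} (η : Form n) (β α : ℝ) : Prop :=
  ∃ u : X n → ℝ, η.HasPotential u ∧ ∀ i : Fin n,
    (∃ v : (Fin n → ℂ) → ℝ, ContDiff ℝ (⊤ : ℕ∞) v ∧ ∀ y, y i ≠ 0 →
      u (param (i, Side.zero) y) = α * Real.log (‖y i‖ ^ 2) + v y) ∧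
    (∃ v : (Fin n → ℂ) → ℝ, ContDiff ℝ (⊤ : ℕ∞) v ∧ ∀ y, y i ≠ 0 →
      u (param (i, Side.infinity) y) = -β * Real.log (‖y i‖ ^ 2) + v y)

/-- `η = η₀ + (√-1 / 2π) ∂∂̄ φ` on `X_n`, with `φ` smooth on `X_n`. -/
def Form.IsPerturbation {n : ℕ} (η η₀ : Form n) (φ : X n → ℝ) : Prop :=
  SmoothFun φ ∧
  ∀ c y, η.coeff c y = η₀.coeff c y + complexHessian (fun y' => φ (param c y')) y

/-! ### The Calabi ansatz -/

/-- `s = log |·|_h²`, the logarithm of the fibrewise squared norm: `log |x|²` at the point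
`x ∈ ℂⁿ ∖ {0} = X_n ∖ (E₀ ∪ E_∞)`.  (The value on the divisors is irrelevant.) -/
def logNorm {n : ℕ} (p : X n) : ℝ :=
  Real.log ((∑ i, ‖p.1.1.rep.1 i‖ ^ 2) / ‖p.1.1.rep.2‖ ^ 2)

/-- The profiles of the Calabi ansatz with class `β [E_∞] - α [E₀]`: smooth functions `f` on the line
with `f' > 0`, `f'' > 0` such that `F₀(t) = f(log t) - α log t` and `F_∞(t) = f(-log t) + β log t`
extend smoothly to `t = 0`, with positive derivative there. -/
structure IsProfile (f : ℝ → ℝ) (α β : ℝ) : Prop where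
  smooth : ContDiff ℝ (⊤ : ℕ∞) f
  deriv_pos : ∀ s, 0 < deriv f s
  deriv_deriv_pos : ∀ s, 0 < deriv (deriv f) s
  at_zero : ∃ F : ℝ → ℝ, ContDiffOn ℝ (⊤ : ℕ∞) F (Set.Ici 0) ∧
    (∀ t, 0 < t → F t = f (Real.log t) - α * Real.log t) ∧ 0 < derivWithin F (Set.Ici 0) 0
  at_infinity : ∃ F : ℝ → ℝ, ContDiffOn ℝ (⊤ : ℕ∞) F (Set.Ici 0) ∧
    (∀ t, 0 < t → F t = f (-Real.log t) + β * Real.log t) ∧ 0 < derivWithin F (Set.Ici 0) 0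

/-- `η` is the Kähler metric `(√-1 / 2π) ∂∂̄ f(s)` in `β [E_∞] - α [E₀]` given by the Calabi ansatz
with profile `f`. -/
structure IsCalabiMetric {n : ℕ} (η : Form n) (f : ℝ → ℝ) (β α : ℝ) : Prop where
  profile : IsProfile f α β
  potential : η.HasPotential (fun p => f (logNorm p))
  kahler : η.IsKahler
  inClass : η.InClass β α

/-! ### The modified J-equation -/

/-- The components of the holomorphic vector field `ξ = k w ∂/∂w`, where `w` is the fibre coordinate;
with `v = 1 / w` it is `-k v ∂/∂v`. -/
def fieldXi {n : ℕ} (k : ℝ) : Chart n → (Fin n → ℂ) → (Fin n → ℂ)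
  | (i, Side.zero), y => Pi.single i ((k : ℂ) * y i)
  | (i, Side.infinity), y => Pi.single i (-(k : ℂ) * y i)

/-- The density of `χⁿ` in the chart `c`: `χⁿ = (n! / πⁿ) * volDensity * (Lebesgue measure)`. -/
def volDensity {n : ℕ} (χ : Form n) (c : Chart n) (y : Fin n → ℂ) : ℝ :=
  (χ.coeff c y).det.re

/-- The density of `n ω ∧ χⁿ⁻¹`, the first order term in `t` of `(χ + t ω)ⁿ`, so that of
`det (H_χ + t H_ω)`:  `n ω ∧ χⁿ⁻¹ = (n! / πⁿ) * mixedDensity * (Lebesgue measure)`. -/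
def mixedDensity {n : ℕ} (ω χ : Form n) (c : Chart n) (y : Fin n → ℂ) : ℝ :=
  ((χ.coeff c y).adjugate * ω.coeff c y).trace.re

/-- The integral over `X_n` of the `2n`-form which is `(n! / πⁿ) ρ` times Lebesgue measure in one
chart; the complement of the range of a chart has measure zero. -/
def topIntegral {n : ℕ} (ρ : (Fin n → ℂ) → ℝ) : ℝ :=
  (n.factorial : ℝ) / Real.pi ^ n * ∫ y, ρ y

/-- `θ = θ_ξ(χ)` is the normalized Hamiltonian of `ξ = k w ∂/∂w`:  `θ` is smooth,
`i_ξ χ = (√-1 / 2π) ∂̄ θ` and `∫_X θ χⁿ = 0` (computed in any chart). -/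
def IsHamiltonian {n : ℕ} (k : ℝ) (χ : Form n) (θ : X n → ℝ) : Prop :=
  SmoothFun θ ∧
  (∀ c y l, ∑ j, fieldXi k c y j * χ.coeff c y j l
    = dzbar l (fun y' => (θ (param c y') : ℂ)) y) ∧
  ∀ c, MeasureTheory.Integrable (fun y => θ (param c y) * volDensity χ c y) ∧
    topIntegral (fun y => θ (param c y) * volDensity χ c y) = 0

/-- The constant `n ([ω] · [χ]ⁿ⁻¹) / [χ]ⁿ`, with the integrals computed in the chart `c`. -/
def slope {n : ℕ} (ω χ : Form n) (c : Chart n) : ℝ :=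
  topIntegral (mixedDensity ω χ c) / topIntegral (volDensity χ c)

/-- The modified J-equation `n ω ∧ χⁿ⁻¹ / χⁿ = c + θ_ξ(χ)` on `X_n`, for `ξ = k w ∂/∂w` and the
constant `c = n ([ω] · [χ]ⁿ⁻¹) / [χ]ⁿ`. -/
def SolvesModifiedJ {n : ℕ} (k : ℝ) (ω χ : Form n) : Prop :=
  ∃ θ : X n → ℝ, IsHamiltonian k χ θ ∧
    ∀ c y, mixedDensity ω χ c y / volDensity χ c y = slope ω χ c + θ (param c y)

/-- `c = n (a bⁿ⁻¹ - 1) / (bⁿ - 1)`. -/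
def cConst (n : ℕ) (a b : ℝ) : ℝ := n * ((a * b ^ (n - 1) - 1) / (b ^ n - 1))

/-- `c_k = c - (n k / (n + 1)) (bⁿ⁺¹ - 1) / (bⁿ - 1)`. -/
def ckConst (n : ℕ) (a b k : ℝ) : ℝ :=
  cConst n a b - n * k / (n + 1) * ((b ^ (n + 1) - 1) / (b ^ n - 1))

/-- `ψ(τ) = k τ² / (n + 1) + (c_k / n) τ + ((n + 1 - k) / (n + 1) - c_k / n) τ¹⁻ⁿ`. -/
def psi (n : ℕ) (a b k τ : ℝ) : ℝ :=
  k * τ ^ 2 / (n + 1) + ckConst n a b k / n * τ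
    + ((n + 1 - k) / (n + 1) - ckConst n a b k / n) * τ ^ (1 - (n : ℤ))

end CalabiJ

end

/-! In a chart, the form with profile f is f' times the pulled-back Fubini–Study form plus f'' times
the rank one form ∂s ∧ ∂̄s. Hence two Calabi metrics are simultaneously diagonal at every point
(`calabiMatrix_eq_mul`): relative to χ, the metric ω has the eigenvalue g'/f' with multiplicity n -
1 and g''/f'' along the fibre. The field ξ is vertical, so contracting it with χ sees only the
second summand, and the Hamiltonian is k f' plus a constant. Put τ = f' and g' = ψ(f'), so that g''
= ψ'(f') f''. The modified J-equation becomes the linear equation ψ' + (n - 1) ψ / τ = k τ + c_k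
(`psi_ode`), whose derivative is the second order equation of the theorem. Its solutions are a fixed
quadratic polynomial plus a multiple of τ^(1-n); ψ(1) = 1 determines the multiple and ψ(b) = a
determines c_k.

The condition c_k + k > n - 1 says exactly that ψ'(1) > 0, and `psiDeriv_pos` propagates this to all
τ ≥ 1. So ψ has a smooth inverse on a neighbourhood of [1, b], and f' must be ψ⁻¹ ∘ g'. That a
primitive of it is again a profile with the right ends is `exists_profile_psi`; the boundary
behaviour comes from Hadamard's lemma on a half-line.

The coordinate s is singular along the two divisors, but f' and f'' / ‖y_i‖² are smooth functions in
each chart, because they are smooth up to 0 in the squared fibre norm `radius`. Thus the form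
extends over X_n (`IsProfile.form`), and every identity of forms is computed off the divisors and
extended by continuity and density.

The constants come from integration over the fibres. The fibre integral of p(f') f'' is a difference
of values of a primitive of p, so f' pushes χⁿ forward to a multiple of τ^(n-1) dτ on [1, b]
(`chart_integral`). The mean of k f' + c_k is then c; this gives both the value of the slope and the
normalization of θ = k f' + c_k - c.

Finally, potentials of two forms in the same class have the same logarithmic poles, so their
difference is a global smooth function (`exists_isPerturbation`). -/

open Filter Topology

noncomputable section

namespace CalabiJ

/-! ### Calculus of Wirtinger derivatives. -/

section Wirtinger

variable {n : ℕ} {F G : (Fin n → ℂ) → ℂ} {y : Fin n → ℂ}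

theorem dz_congr (j : Fin n) (h : F =ᶠ[𝓝 y] G) : dz j F y = dz j G y := by
  simp only [dz, h.fderiv_eq]

theorem dzbar_congr (j : Fin n) (h : F =ᶠ[𝓝 y] G) : dzbar j F y = dzbar j G y := by
  simp only [dzbar, h.fderiv_eq]

theorem eventuallyEq_dzbar (j : Fin n) (h : F =ᶠ[𝓝 y] G) : dzbar j F =ᶠ[𝓝 y] dzbar j G := by
  filter_upwards [h.eventuallyEq_nhds] with y' h' using dzbar_congr j h'

theorem dz_const (j : Fin n) (a : ℂ) : dz j (fun _ => a) y = 0 := by simp [dz]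

theorem dz_add (j : Fin n) (hF : DifferentiableAt ℝ F y) (hG : DifferentiableAt ℝ G y) :
    dz j (fun y => F y + G y) y = dz j F y + dz j G y := by
  simp only [dz, fderiv_fun_add hF hG, add_apply]
  ring

theorem dzbar_add (j : Fin n) (hF : DifferentiableAt ℝ F y) (hG : DifferentiableAt ℝ G y) :
    dzbar j (fun y => F y + G y) y = dzbar j F y + dzbar j G y := by
  simp only [dzbar, fderiv_fun_add hF hG, add_apply]
  ring

theorem dz_mul (j : Fin n) (hF : DifferentiableAt ℝ F y) (hG : DifferentiableAt ℝ G y) :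
    dz j (fun y => F y * G y) y = dz j F y * G y + F y * dz j G y := by
  simp only [dz, fderiv_fun_mul hF hG, add_apply, smul_apply, smul_eq_mul]
  ring

theorem dz_sum {ι : Type*} (j : Fin n) (s : Finset ι) {F : ι → (Fin n → ℂ) → ℂ}
    (hF : ∀ i ∈ s, DifferentiableAt ℝ (F i) y) :
    dz j (fun y => ∑ i ∈ s, F i y) y = ∑ i ∈ s, dz j (F i) y := by
  simp only [dz, fderiv_fun_sum hF, sum_apply, Finset.mul_sum,
    ← Finset.sum_sub_distrib, Finset.sum_div]

theorem fderiv_conj_comp (v : Fin n → ℂ) (hF : DifferentiableAt ℝ F y) :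
    fderiv ℝ (fun y => starRingEnd ℂ (F y)) y v = starRingEnd ℂ (fderiv ℝ F y v) := by
  have := (Complex.conjCLE.toContinuousLinearMap.hasFDerivAt.comp y hF.hasFDerivAt).fderiv
  have h2 : (fun y => starRingEnd ℂ (F y)) = (Complex.conjCLE.toContinuousLinearMap ∘ F) := rfl
  rw [h2, this]
  simp

theorem dz_conj (j : Fin n) (hF : DifferentiableAt ℝ F y) :
    dz j (fun y => starRingEnd ℂ (F y)) y = starRingEnd ℂ (dzbar j F y) := by
  simp only [dz, dzbar, fderiv_conj_comp _ hF, map_div₀, map_add, map_mul, Complex.conj_I,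
    map_ofNat]
  ring

theorem dzbar_conj (j : Fin n) (hF : DifferentiableAt ℝ F y) :
    dzbar j (fun y => starRingEnd ℂ (F y)) y = starRingEnd ℂ (dz j F y) := by
  simp only [dz, dzbar, fderiv_conj_comp _ hF, map_div₀, map_sub, map_mul, Complex.conj_I,
    map_ofNat]
  ring

/-- A real function composed with a real-valued function, for a Wirtinger derivative. -/
theorem dz_real_comp (j : Fin n) {f : ℝ → ℝ} {f' : ℝ} {s : (Fin n → ℂ) → ℝ}
    (hf : HasDerivAt f f' (s y)) (hs : DifferentiableAt ℝ s y) :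
    dz j (fun y => (f (s y) : ℂ)) y = f' * dz j (fun y => (s y : ℂ)) y := by
  have h1 := (Complex.ofRealCLM.hasFDerivAt.comp y (hf.comp_hasFDerivAt y hs.hasFDerivAt)).fderiv
  have h2 := (Complex.ofRealCLM.hasFDerivAt.comp y hs.hasFDerivAt).fderiv
  have h3 : (fun y => (f (s y) : ℂ)) = Complex.ofRealCLM ∘ (f ∘ s) := rfl
  have h4 : (fun y => (s y : ℂ)) = Complex.ofRealCLM ∘ s := rfl
  rw [h3, h4]
  simp only [dz, h1, h2]
  simp
  ring

theorem dzbar_real_comp (j : Fin n) {f : ℝ → ℝ} {f' : ℝ} {s : (Fin n → ℂ) → ℝ}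
    (hf : HasDerivAt f f' (s y)) (hs : DifferentiableAt ℝ s y) :
    dzbar j (fun y => (f (s y) : ℂ)) y = f' * dzbar j (fun y => (s y : ℂ)) y := by
  have h1 := (Complex.ofRealCLM.hasFDerivAt.comp y (hf.comp_hasFDerivAt y hs.hasFDerivAt)).fderiv
  have h2 := (Complex.ofRealCLM.hasFDerivAt.comp y hs.hasFDerivAt).fderiv
  have h3 : (fun y => (f (s y) : ℂ)) = Complex.ofRealCLM ∘ (f ∘ s) := rfl
  have h4 : (fun y => (s y : ℂ)) = Complex.ofRealCLM ∘ s := rfl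
  rw [h3, h4]
  simp only [dzbar, h1, h2]
  simp
  ring

theorem dz_of_holomorphic (j : Fin n) (hF : DifferentiableAt ℂ F y) :
    dz j F y = fderiv ℂ F y (Pi.single j 1) := by
  have h : Pi.single j Complex.I = Complex.I • (Pi.single j 1 : Fin n → ℂ) := by
    rw [← Pi.single_smul]; simp
  simp only [dz, hF.fderiv_restrictScalars ℝ, ContinuousLinearMap.coe_restrictScalars', h, map_smul,
    smul_eq_mul]
  linear_combination (-1 / 2 : ℂ) * fderiv ℂ F y (Pi.single j 1) * Complex.I_mul_I

theorem dzbar_of_holomorphic (j : Fin n) (hF : DifferentiableAt ℂ F y) : dzbar j F y = 0 := by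
  have h : Pi.single j Complex.I = Complex.I • (Pi.single j 1 : Fin n → ℂ) := by
    rw [← Pi.single_smul]; simp
  simp only [dzbar, hF.fderiv_restrictScalars ℝ, ContinuousLinearMap.coe_restrictScalars', h,
    map_smul, smul_eq_mul]
  linear_combination (1 / 2 : ℂ) * fderiv ℂ F y (Pi.single j 1) * Complex.I_mul_I

/-- The real differential is the sum of a complex linear and an antilinear part. A holomorphic map
respects this splitting, which gives the chain rules `dz_comp_holomorphic` and
`dzbar_comp_holomorphic`. -/
theorem fderiv_eq_sum (v : Fin n → ℂ) :
    fderiv ℝ F y v = ∑ j, (dz j F y * v j + dzbar j F y * starRingEnd ℂ (v j)) := by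
  have hv : v = ∑ j, ((v j).re • (Pi.single j 1 : Fin n → ℂ) + (v j).im • (Pi.single j Complex.I : Fin n → ℂ)) := by
    conv_lhs => rw [← Finset.univ_sum_single v]
    refine Finset.sum_congr rfl fun j _ => ?_
    rw [← Pi.single_smul, ← Pi.single_smul, ← Pi.single_add]
    congr 1
    apply Complex.ext <;> simp
  conv_lhs => rw [hv]
  rw [map_sum]
  refine Finset.sum_congr rfl fun j _ => ?_
  rw [map_add, map_smul, map_smul]
  conv_rhs => rw [← Complex.re_add_im (v j)]
  simp only [dz, dzbar, map_add, map_mul, Complex.conj_ofReal, Complex.conj_I, Complex.real_smul]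
  linear_combination (fderiv ℝ F y (Pi.single j Complex.I) * (v j).im) * Complex.I_mul_I

variable {Φ : (Fin n → ℂ) → Fin n → ℂ}

theorem dz_comp_holomorphic (j : Fin n) (hF : DifferentiableAt ℝ F (Φ y))
    (hΦ : DifferentiableAt ℂ Φ y) :
    dz j (fun y => F (Φ y)) y = ∑ m, dz m F (Φ y) * fderiv ℂ Φ y (Pi.single j 1) m := by
  have h : Pi.single j Complex.I = Complex.I • (Pi.single j 1 : Fin n → ℂ) := by
    rw [← Pi.single_smul]; simp
  have h1 := (hF.hasFDerivAt.comp y (hΦ.restrictScalars ℝ).hasFDerivAt).fderiv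
  have h2 : (fun y => F (Φ y)) = F ∘ Φ := rfl
  rw [dz, h2, h1]
  simp only [hΦ.fderiv_restrictScalars ℝ, ContinuousLinearMap.comp_apply,
    ContinuousLinearMap.coe_restrictScalars', h, map_smul]
  rw [fderiv_eq_sum, fderiv_eq_sum, Finset.mul_sum, ← Finset.sum_sub_distrib, Finset.sum_div]
  refine Finset.sum_congr rfl fun m _ => ?_
  simp only [Pi.smul_apply, smul_eq_mul, map_mul, Complex.conj_I]
  linear_combination (-1 / 2 * dz m F (Φ y) * (fderiv ℂ Φ y (Pi.single j 1) m)
    + 1 / 2 * dzbar m F (Φ y) * starRingEnd ℂ (fderiv ℂ Φ y (Pi.single j 1) m)) * Complex.I_mul_I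

theorem dzbar_comp_holomorphic (j : Fin n) (hF : DifferentiableAt ℝ F (Φ y))
    (hΦ : DifferentiableAt ℂ Φ y) :
    dzbar j (fun y => F (Φ y)) y
      = ∑ m, dzbar m F (Φ y) * starRingEnd ℂ (fderiv ℂ Φ y (Pi.single j 1) m) := by
  have h : Pi.single j Complex.I = Complex.I • (Pi.single j 1 : Fin n → ℂ) := by
    rw [← Pi.single_smul]; simp
  have h1 := (hF.hasFDerivAt.comp y (hΦ.restrictScalars ℝ).hasFDerivAt).fderiv
  have h2 : (fun y => F (Φ y)) = F ∘ Φ := rfl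
  rw [dzbar, h2, h1]
  simp only [hΦ.fderiv_restrictScalars ℝ, ContinuousLinearMap.comp_apply,
    ContinuousLinearMap.coe_restrictScalars', h, map_smul]
  rw [fderiv_eq_sum, fderiv_eq_sum, Finset.mul_sum, ← Finset.sum_add_distrib, Finset.sum_div]
  refine Finset.sum_congr rfl fun m _ => ?_
  simp only [Pi.smul_apply, smul_eq_mul, map_mul, Complex.conj_I]
  linear_combination (1 / 2 * dz m F (Φ y) * (fderiv ℂ Φ y (Pi.single j 1) m)
    - 1 / 2 * dzbar m F (Φ y) * starRingEnd ℂ (fderiv ℂ Φ y (Pi.single j 1) m)) * Complex.I_mul_I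

theorem _root_.ContDiffAt.dz {m : ℕ∞} (j : Fin n) (hF : ContDiffAt ℝ (m + 1) F y) :
    ContDiffAt ℝ m (dz j F) y := by
  have h : ContDiffAt ℝ m (fderiv ℝ F) y := hF.fderiv_right le_rfl
  unfold CalabiJ.dz
  fun_prop

theorem _root_.ContDiffAt.dzbar {m : ℕ∞} (j : Fin n) (hF : ContDiffAt ℝ (m + 1) F y) :
    ContDiffAt ℝ m (dzbar j F) y := by
  have h : ContDiffAt ℝ m (fderiv ℝ F) y := hF.fderiv_right le_rfl
  unfold CalabiJ.dzbar
  fun_prop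

/-- This is the symmetry of the real second derivative. Applied to ∂̄-derivatives of a potential, it
yields closedness of ∂∂̄u. -/
theorem dz_comm (j l : Fin n) (hF : ContDiffAt ℝ 2 F y) : dz j (dz l F) y = dz l (dz j F) y := by
  have h : DifferentiableAt ℝ (fderiv ℝ F) y :=
    (hF.fderiv_right (m := 1) (by norm_num)).differentiableAt (by norm_num)
  have hs := hF.isSymmSndFDerivAt (by simp)
  have key : ∀ v : Fin n → ℂ, ∀ q : Fin n, fderiv ℝ (dz q F) y v
      = (fderiv ℝ (fderiv ℝ F) y v (Pi.single q 1)
        - Complex.I * fderiv ℝ (fderiv ℝ F) y v (Pi.single q Complex.I)) / 2 := by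
    intro v q
    have e : ∀ w : Fin n → ℂ, HasFDerivAt (fun y => fderiv ℝ F y w)
        ((fderiv ℝ (fderiv ℝ F) y).flip w) y := by
      intro w
      simpa using h.hasFDerivAt.clm_apply (hasFDerivAt_const w y)
    have := (((e (Pi.single q 1)).sub ((e (Pi.single q Complex.I)).const_mul Complex.I)).mul_const
      ((2 : ℂ)⁻¹)).fderiv
    have h2 : dz q F = fun y => (fderiv ℝ F y (Pi.single q 1)
      - Complex.I * fderiv ℝ F y (Pi.single q Complex.I)) * (2 : ℂ)⁻¹ := by
      funext y; simp only [dz, div_eq_mul_inv]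
    rw [h2]
    erw [this]
    simp
    ring
  rw [dz, dz, key, key, key, key, hs.eq (Pi.single j 1), hs.eq (Pi.single j Complex.I),
    hs.eq (Pi.single j 1), hs.eq (Pi.single j Complex.I)]
  ring

end Wirtinger

/-! ### The complex Hessian. -/

section Hessian

variable {n : ℕ} {u v : (Fin n → ℂ) → ℝ} {y : Fin n → ℂ}

theorem _root_.ContDiffAt.ofReal_comp {m : WithTop ℕ∞} (hu : ContDiffAt ℝ m u y) :
    ContDiffAt ℝ m (fun y => (u y : ℂ)) y :=
  Complex.ofRealCLM.contDiff.contDiffAt.comp y hu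

theorem _root_.DifferentiableAt.ofReal_comp' (hu : DifferentiableAt ℝ u y) :
    DifferentiableAt ℝ (fun y => (u y : ℂ)) y :=
  Complex.ofRealCLM.differentiableAt.comp y hu

theorem complexHessian_congr (h : u =ᶠ[𝓝 y] v) : complexHessian u y = complexHessian v y := by
  ext j l
  exact dz_congr j (eventuallyEq_dzbar l (h.fun_comp Complex.ofReal))

theorem eventually_dzbar_add (l : Fin n) (hu : ContDiffAt ℝ 2 u y) (hv : ContDiffAt ℝ 2 v y) :
    ∀ᶠ y' in 𝓝 y, dzbar l (fun y => (u y : ℂ) + v y) y'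
      = dzbar l (fun y => (u y : ℂ)) y' + dzbar l (fun y => (v y : ℂ)) y' := by
  filter_upwards [hu.eventually (by simp), hv.eventually (by simp)] with y' h1 h2
  exact dzbar_add l (h1.differentiableAt (by norm_num)).ofReal_comp'
    (h2.differentiableAt (by norm_num)).ofReal_comp'

theorem differentiableAt_dzbar (l : Fin n) (hu : ContDiffAt ℝ 2 u y) :
    DifferentiableAt ℝ (dzbar l fun y => (u y : ℂ)) y :=
  (ContDiffAt.dzbar (m := 1) l (hu.ofReal_comp.of_le (by norm_num))).differentiableAt (by norm_num)

theorem complexHessian_add (hu : ContDiffAt ℝ 2 u y) (hv : ContDiffAt ℝ 2 v y) :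
    complexHessian (fun y => u y + v y) y = complexHessian u y + complexHessian v y := by
  ext j l
  simp only [complexHessian, Matrix.of_apply, Matrix.add_apply, Complex.ofReal_add]
  rw [dz_congr j (eventually_dzbar_add l hu hv)]
  exact dz_add j (differentiableAt_dzbar l hu) (differentiableAt_dzbar l hv)

theorem complexHessian_sub (hu : ContDiffAt ℝ 2 u y) (hv : ContDiffAt ℝ 2 v y) :
    complexHessian (fun y => u y - v y) y = complexHessian u y - complexHessian v y := by
  have h := complexHessian_add (hu.sub hv) hv
  simp only [sub_add_cancel] at h
  rw [h, add_sub_cancel_right]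

/-- The chain rule ∂∂̄ f(u) = f' ∂∂̄u + f'' ∂u ∧ ∂̄u; for u = s it is the source of the horizontal
and vertical parts of a Calabi metric. -/
theorem complexHessian_real_comp {f : ℝ → ℝ} (hf : ContDiffAt ℝ 2 f (u y))
    (hu : ContDiffAt ℝ 2 u y) (j l : Fin n) :
    complexHessian (fun y => f (u y)) y j l
      = ((deriv f (u y) : ℝ) : ℂ) * complexHessian u y j l
        + ((deriv (deriv f) (u y) : ℝ) : ℂ) *
          (dz j (fun y => (u y : ℂ)) y * dzbar l (fun y => (u y : ℂ)) y) := by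
  have hev : ∀ᶠ y' in 𝓝 y, dzbar l (fun y => (f (u y) : ℂ)) y'
      = ((deriv f (u y') : ℝ) : ℂ) * dzbar l (fun y => (u y : ℂ)) y' := by
    filter_upwards [hu.continuousAt.eventually (hf.eventually (by simp)),
      hu.eventually (by simp)] with y' h1 h2
    exact dzbar_real_comp l (h1.differentiableAt (by norm_num)).hasDerivAt
      (h2.differentiableAt (by norm_num))
  have hd : DifferentiableAt ℝ (deriv f) (u y) := by
    have := (hf.fderiv_right (m := 1) (by norm_num)).differentiableAt (by norm_num)
    exact this.clm_apply (differentiableAt_const 1)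
  have hud := hu.differentiableAt (by norm_num)
  simp only [complexHessian, Matrix.of_apply]
  rw [dz_congr j hev, dz_mul j (DifferentiableAt.ofReal_comp' (u := fun y => deriv f (u y)) (hd.comp y hud))
    (differentiableAt_dzbar l hu), dz_real_comp j hd.hasDerivAt hud]
  ring

theorem contDiffAt_complexHessian (hu : ContDiffAt ℝ (⊤ : ℕ∞) u y) (j l : Fin n) :
    ContDiffAt ℝ (⊤ : ℕ∞) (fun y => complexHessian u y j l) y :=
  ContDiffAt.dz (m := ⊤) j (ContDiffAt.dzbar (m := ⊤) l hu.ofReal_comp)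

theorem contDiff_complexHessian (hu : ContDiff ℝ (⊤ : ℕ∞) u) (j l : Fin n) :
    ContDiff ℝ (⊤ : ℕ∞) (fun y => complexHessian u y j l) :=
  contDiff_iff_contDiffAt.2 fun _ => contDiffAt_complexHessian hu.contDiffAt j l

/-- The complex Hessian transforms as a (1,1)-form under a holomorphic map. -/
theorem complexHessian_comp_holomorphic {Φ : (Fin n → ℂ) → Fin n → ℂ}
    (hu : ContDiffAt ℝ 2 u (Φ y)) (hΦ : ContDiffAt ℂ 2 Φ y) :
    complexHessian (fun y => u (Φ y)) y
      = (Matrix.of fun m j => fderiv ℂ Φ y (Pi.single j 1) m).transpose * complexHessian u (Φ y)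
        * (Matrix.of fun m j => fderiv ℂ Φ y (Pi.single j 1) m).map (starRingEnd ℂ) := by
  have hev : ∀ l, ∀ᶠ y' in 𝓝 y, dzbar l (fun y => (u (Φ y) : ℂ)) y'
      = ∑ m, dzbar m (fun y => (u y : ℂ)) (Φ y')
        * starRingEnd ℂ (fderiv ℂ Φ y' (Pi.single l 1) m) := by
    intro l
    filter_upwards [hΦ.continuousAt.eventually (hu.eventually (by simp)),
      hΦ.eventually (by simp)] with y' h1 h2
    exact dzbar_comp_holomorphic l (F := fun y => (u y : ℂ))
      (h1.differentiableAt (by norm_num)).ofReal_comp' (h2.differentiableAt (by norm_num))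
  have hΦd : DifferentiableAt ℂ Φ y := hΦ.differentiableAt (by norm_num)
  have hJ : ∀ l m, DifferentiableAt ℂ (fun y' => fderiv ℂ Φ y' (Pi.single l 1) m) y := by
    intro l m
    have h : DifferentiableAt ℂ (fderiv ℂ Φ) y :=
      (hΦ.fderiv_right (m := 1) (by norm_num)).differentiableAt (by norm_num)
    fun_prop
  have hJr : ∀ l m, DifferentiableAt ℝ
      (fun y' => starRingEnd ℂ (fderiv ℂ Φ y' (Pi.single l 1) m)) y := by
    intro l m
    exact Complex.conjCLE.differentiableAt.comp y ((hJ l m).restrictScalars ℝ)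
  have hH : ∀ m, DifferentiableAt ℝ (fun y' => dzbar m (fun y => (u y : ℂ)) (Φ y')) y := by
    intro m
    exact (differentiableAt_dzbar m hu).comp y (hΦd.restrictScalars ℝ)
  ext j l
  have h0 : complexHessian (fun y => u (Φ y)) y j l
      = dz j (dzbar l fun y => (u (Φ y) : ℂ)) y := rfl
  rw [h0, dz_congr j (hev l), dz_sum j _ fun m _ => DifferentiableAt.fun_mul (hH m) (hJr l m)]
  simp only [Matrix.mul_apply, Matrix.transpose_apply, Matrix.of_apply, Matrix.map_apply]
  refine Finset.sum_congr rfl fun m _ => ?_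
  -- The conjugated Jacobian entry is antiholomorphic, so `dz` falls only on the other factor.
  rw [dz_mul j (hH m) (hJr l m), dz_comp_holomorphic j (differentiableAt_dzbar m hu) hΦd,
    dz_conj j ((hJ l m).restrictScalars ℝ), dzbar_of_holomorphic j (hJ l m), map_zero, mul_zero,
    add_zero]
  congr 1
  exact Finset.sum_congr rfl fun p _ => mul_comm _ _

end Hessian

/-! ### The boundary value problem for ψ and its monotonicity. -/

section Psi

variable {n : ℕ} {a b k : ℝ}

/-- With denominators restored this is (τⁿ - 1)/n ≤ (τⁿ⁺¹ - 1)/(n + 1). The expression for n + 1 is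
τ times the one for n plus (τ - 1)(τⁿ⁺¹ - 1), whence the induction. -/
theorem natCast_mul_pow_sub_nonneg {τ : ℝ} (hτ : 1 ≤ τ) (n : ℕ) :
    0 ≤ n * τ ^ (n + 1) - (n + 1) * τ ^ n + 1 := by
  induction n with
  | zero => simp
  | succ n ih =>
    have h1 : 0 ≤ (τ - 1) * (τ ^ (n + 1) - 1) :=
      mul_nonneg (by linarith) (by linarith [one_le_pow₀ hτ (n := n + 1)])
    have h2 := mul_nonneg (by linarith : 0 ≤ τ) ih
    push_cast
    ring_nf at h1 h2 ⊢
    linarith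

theorem contDiffOn_psi : ContDiffOn ℝ (⊤ : ℕ∞) (psi n a b k) (Set.Ioi 0) := by
  intro τ hτ
  have hτ' : τ ≠ 0 := ne_of_gt hτ
  have h : ContDiffAt ℝ (⊤ : ℕ∞) (fun τ : ℝ => τ ^ (1 - (n : ℤ))) τ := by
    rcases le_or_gt 0 (1 - (n : ℤ)) with h | h
    · obtain ⟨m, hm⟩ := Int.eq_ofNat_of_zero_le h
      simp only [hm, zpow_natCast]
      fun_prop
    · obtain ⟨m, hm⟩ := Int.eq_ofNat_of_zero_le (a := -(1 - (n : ℤ))) (by omega)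
      have : (1 - (n : ℤ)) = -(m : ℤ) := by omega
      simp only [this, zpow_neg, zpow_natCast]
      exact (contDiffAt_id.pow m).inv (by simp [hτ'])
  apply ContDiffAt.contDiffWithinAt
  unfold psi
  fun_prop

/-- The explicit derivative of `psi`. -/
def psiDeriv (n : ℕ) (a b k τ : ℝ) : ℝ :=
  2 * k * τ / (n + 1) + ckConst n a b k / n
    + ((n + 1 - k) / (n + 1) - ckConst n a b k / n) * ((1 - n) * τ ^ (-(n : ℤ)))

theorem hasDerivAt_psi {τ : ℝ} (hτ : τ ≠ 0) :
    HasDerivAt (psi n a b k) (psiDeriv n a b k τ) τ := by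
  have h := hasDerivAt_zpow (1 - (n : ℤ)) τ (Or.inl hτ)
  have h1 := (((hasDerivAt_pow 2 τ).const_mul k).div_const ((n : ℝ) + 1)).add
    ((hasDerivAt_id τ).const_mul (ckConst n a b k / n))
  have h2 := h1.add (h.const_mul ((n + 1 - k) / (n + 1) - ckConst n a b k / n))
  refine h2.congr_deriv ?_
  rw [psiDeriv, show (1 - (n : ℤ) - 1) = -n by ring]
  push_cast
  ring

theorem deriv_psi {τ : ℝ} (hτ : τ ≠ 0) : deriv (psi n a b k) τ = psiDeriv n a b k τ :=
  (hasDerivAt_psi hτ).deriv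

/-- The first integral of the second order equation, and the form in which the modified J-equation
for Calabi metrics appears. The power τ^(1-n) solves the homogeneous equation; the other two terms
are a particular solution. -/
theorem psi_ode {τ : ℝ} (hτ : τ ≠ 0) (hn : n ≠ 0) :
    (n - 1) * psi n a b k τ / τ + psiDeriv n a b k τ = k * τ + ckConst n a b k := by
  have hz : τ ^ (-(n : ℤ)) = τ ^ (1 - (n : ℤ)) / τ := by
    rw [sub_eq_add_neg, zpow_add₀ hτ]; field_simp
  have hn' : (n : ℝ) ≠ 0 := by exact_mod_cast hn
  have hn1 : (n : ℝ) + 1 ≠ 0 := by positivity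
  rw [psiDeriv, psi, hz]
  field_simp
  ring

theorem psi_second_order {τ : ℝ} (hτ : 0 < τ) (hn : n ≠ 0) :
    deriv (deriv (psi n a b k)) τ + ((n : ℝ) - 1) * (deriv (psi n a b k) τ / τ)
      - ((n : ℝ) - 1) * (psi n a b k τ / τ ^ 2) - k = 0 := by
  have hτ' := hτ.ne'
  have h1 : deriv (deriv (psi n a b k)) τ = k + ((n : ℝ) - 1) * (psi n a b k τ / τ ^ 2)
      - ((n : ℝ) - 1) * (psiDeriv n a b k τ / τ) := by
    have hev : deriv (psi n a b k) =ᶠ[𝓝 τ]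
        fun τ => k * τ + ckConst n a b k - (n - 1) * psi n a b k τ / τ := by
      filter_upwards [lt_mem_nhds hτ] with σ hσ
      rw [deriv_psi hσ.ne']
      linear_combination psi_ode (a := a) (b := b) (k := k) hσ.ne' hn
    rw [hev.deriv_eq]
    have h := (((hasDerivAt_id τ).const_mul k).add_const (ckConst n a b k)).sub
      (((hasDerivAt_psi (n := n) (a := a) (b := b) (k := k) hτ').const_mul ((n : ℝ) - 1)).div
        (hasDerivAt_id τ) hτ')
    refine h.deriv.trans ?_
    simp only [id]
    field_simp
    ring
  rw [h1, deriv_psi hτ']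
  ring

theorem psi_one (hn : n ≠ 0) : psi n a b k 1 = 1 := by
  have hn' : (n : ℝ) ≠ 0 := by exact_mod_cast hn
  have hn1 : (n : ℝ) + 1 ≠ 0 := by positivity
  simp only [psi, one_zpow]
  field_simp
  ring

/-- This linear condition on the coefficient c_k is what the definition of `ckConst` solves. -/
theorem psi_right (hn : n ≠ 0) (hb : 1 < b) : psi n a b k b = a := by
  obtain ⟨m, rfl⟩ := Nat.exists_eq_succ_of_ne_zero hn
  have hb0 : b ≠ 0 := by positivity
  have h1 : b ^ (m + 1) - 1 ≠ 0 := (sub_pos.2 (one_lt_pow₀ hb (by simp))).ne'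
  have hn' : (m : ℝ) + 1 ≠ 0 := by positivity
  have hn1 : (m : ℝ) + 1 + 1 ≠ 0 := by positivity
  have hz : b ^ (1 - ((m + 1 : ℕ) : ℤ)) = (b ^ m)⁻¹ := by
    rw [show (1 - ((m + 1 : ℕ) : ℤ)) = -(m : ℤ) by push_cast; ring, zpow_neg, zpow_natCast]
  simp only [psi, ckConst, cConst, Nat.succ_eq_add_one, hz]
  push_cast
  field_simp
  ring

/-- Let P and Q be the integrals of σⁿ and σⁿ⁻¹ over [1, τ]. Then τⁿ ψ'(τ) = 2kP + c_k Q + (k + c_k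
- (n - 1)), where the last bracket is ψ'(1) > 0. As c_k alone may be negative, the first two terms
are regrouped as (c_k + k) Q + 2k (P - Q) + k Q, which is nonnegative because P ≥ Q ≥ 0. -/
theorem psiDeriv_pos (hn : 2 ≤ n) (hk : 0 ≤ k) (hck : (n : ℝ) - 1 < ckConst n a b k + k)
    {τ : ℝ} (hτ : 1 ≤ τ) : 0 < psiDeriv n a b k τ := by
  set c := ckConst n a b k with hc
  have hn2 : (2 : ℝ) ≤ n := by exact_mod_cast hn
  have hτ0 : 0 < τ := by linarith
  have hQ : 0 ≤ (τ ^ n - 1) / n := div_nonneg (by linarith [one_le_pow₀ hτ (n := n)]) (by linarith)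
  have hPQ : (τ ^ n - 1) / n ≤ (τ ^ (n + 1) - 1) / (n + 1) := by
    rw [div_le_div_iff₀ (by linarith) (by linarith)]
    linarith [natCast_mul_pow_sub_nonneg hτ n]
  have key : τ ^ n * psiDeriv n a b k τ
      = 2 * k * ((τ ^ (n + 1) - 1) / (n + 1)) + c * ((τ ^ n - 1) / n) + (k + c - (n - 1)) := by
    rw [psiDeriv, ← hc, zpow_neg, zpow_natCast]
    field_simp
    ring
  have h3 : 0 ≤ (c + k) * ((τ ^ n - 1) / n) := mul_nonneg (by linarith) hQ
  have h4 : 0 ≤ 2 * k * ((τ ^ (n + 1) - 1) / (n + 1) - (τ ^ n - 1) / n) :=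
    mul_nonneg (by linarith) (by linarith)
  have h5 : 0 ≤ k * ((τ ^ n - 1) / n) := mul_nonneg hk hQ
  have : 0 < τ ^ n * psiDeriv n a b k τ := by rw [key]; linarith
  exact (pos_iff_pos_of_mul_pos this).1 (by positivity)

theorem strictMonoOn_psi (hn : 2 ≤ n) (hk : 0 ≤ k) (hck : (n : ℝ) - 1 < ckConst n a b k + k) :
    StrictMonoOn (psi n a b k) (Set.Ici 1) := by
  refine strictMonoOn_of_deriv_pos (convex_Ici 1) (contDiffOn_psi.continuousOn.mono ?_) ?_
  · exact fun x hx => Set.mem_Ioi.2 (lt_of_lt_of_le one_pos (Set.mem_Ici.1 hx))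
  · intro x hx
    rw [interior_Ici] at hx
    have hx' : (1 : ℝ) < x := hx
    rw [deriv_psi (by linarith)]
    exact psiDeriv_pos hn hk hck hx'.le

/-- A one-to-one function on an open set, smooth with nowhere vanishing derivative, has a smooth
inverse. -/
theorem exists_smooth_leftInverse {h : ℝ → ℝ} {U : Set ℝ} (hU : IsOpen U)
    (hh : ContDiffOn ℝ (⊤ : ℕ∞) h U) (hinj : Set.InjOn h U) (hd : ∀ x ∈ U, deriv h x ≠ 0) :
    ∃ r : ℝ → ℝ, (∀ x ∈ U, r (h x) = x) ∧ ∀ x ∈ U, ContDiffAt ℝ (⊤ : ℕ∞) r (h x) := by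
  refine ⟨Function.invFunOn h U, fun x hx => hinj.leftInvOn_invFunOn hx, fun x hx => ?_⟩
  have hx' : ContDiffAt ℝ (⊤ : ℕ∞) h x := hh.contDiffAt (hU.mem_nhds hx)
  have hfd : HasFDerivAt h
      ((ContinuousLinearEquiv.unitsEquivAut ℝ (Units.mk0 (deriv h x) (hd x hx)) : ℝ ≃L[ℝ] ℝ) :
        ℝ →L[ℝ] ℝ) x := by
    have := (hx'.differentiableAt (by simp)).hasDerivAt.hasFDerivAt
    refine this.congr_fderiv ?_
    ext
    simp
  have hne : ((⊤ : ℕ∞) : WithTop ℕ∞) ≠ 0 := by simp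
  refine (hx'.to_localInverse hfd hne).congr_of_eventuallyEq ?_
  have hs := hx'.hasStrictFDerivAt' hfd hne
  have hL : ContDiffAt.localInverse hx' hfd hne (h x) = x := hx'.localInverse_apply_image hfd hne
  have hcont : Tendsto (ContDiffAt.localInverse hx' hfd hne) (𝓝 (h x)) (𝓝 x) := by
    have := (hx'.to_localInverse hfd hne).continuousAt.tendsto
    rwa [hL] at this
  -- Near `h x` the local inverse takes values in `U`, so injectivity on `U` identifies it with the
  -- set-theoretic inverse.
  filter_upwards [hs.eventually_right_inverse, hcont.eventually (hU.mem_nhds hx)] with z hz hzU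
  have hz' : h (ContDiffAt.localInverse hx' hfd hne z) = z := hz
  have := hinj.leftInvOn_invFunOn hzU
  rwa [hz'] at this

end Psi

/-! ### Hadamard's lemma on a closed half-line. -/

section Hadamard

open MeasureTheory

/-- The moments `∫₀¹ uᵏ B(t u) du`; the values of `B` on the negative half-line are not used. -/
def halfMoment (k : ℕ) (B : ℝ → ℝ) (t : ℝ) : ℝ := ∫ u in (0 : ℝ)..1, u ^ k * B (max (t * u) 0)

variable {B B' : ℝ → ℝ}

theorem continuous_comp_max (hB : ContinuousOn B (Set.Ici 0)) :
    Continuous fun x => B (max x 0) :=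
  hB.comp_continuous (by fun_prop) fun x => le_max_right x 0

theorem continuous_halfMoment (k : ℕ) (hB : ContinuousOn B (Set.Ici 0)) :
    Continuous (halfMoment k B) := by
  have h := continuous_comp_max hB
  refine intervalIntegral.continuous_parametric_intervalIntegral_of_continuous' (f := fun t u => u ^ k * B (max (t * u) 0))
    ?_ 0 1
  exact (continuous_snd.pow k).mul (h.comp (continuous_fst.mul continuous_snd))

theorem continuous_pow_mul_comp_max (k : ℕ) (hB : ContinuousOn B (Set.Ici 0)) :
    Continuous fun x => x ^ k * B (max x 0) :=
  (continuous_pow k).mul (continuous_comp_max hB)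

theorem mul_halfMoment (k : ℕ) (t : ℝ) :
    t ^ (k + 1) * halfMoment k B t = ∫ x in (0 : ℝ)..t, x ^ k * B (max x 0) := by
  have h := intervalIntegral.smul_integral_comp_mul_left (a := 0) (b := 1) (fun x => x ^ k * B (max x 0)) t
  simp only [mul_zero, mul_one, smul_eq_mul] at h
  rw [← h, halfMoment, pow_succ, mul_comm (t ^ k) t, mul_assoc]
  rw [← intervalIntegral.integral_const_mul, ← intervalIntegral.integral_const_mul,
    ← intervalIntegral.integral_const_mul]
  refine intervalIntegral.integral_congr fun u _ => ?_
  simp only [mul_pow]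
  ring

theorem integral_pow_mul_deriv (k : ℕ) (hB : ∀ t ∈ Set.Ici (0 : ℝ), HasDerivWithinAt B (B' t) (Set.Ici 0) t)
    (hB' : ContinuousOn B' (Set.Ici 0)) {t : ℝ} (ht : 0 ≤ t) :
    (∫ x in (0 : ℝ)..t, x ^ (k + 1) * B' (max x 0))
      = t ^ (k + 1) * B t - (k + 1) * ∫ x in (0 : ℝ)..t, x ^ k * B (max x 0) := by
  have hBc : ContinuousOn B (Set.Ici 0) := fun t ht => (hB t ht).continuousWithinAt
  have c1 := continuous_pow_mul_comp_max (k + 1) hB'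
  have c2 := continuous_pow_mul_comp_max k hBc
  have h := intervalIntegral.integral_eq_sub_of_hasDerivAt_of_le ht
    (f := fun x => x ^ (k + 1) * B x)
    (f' := fun x => (k + 1) * (x ^ k * B (max x 0)) + x ^ (k + 1) * B' (max x 0)) ?_ ?_ ?_
  · rw [intervalIntegral.integral_add, intervalIntegral.integral_const_mul] at h
    · rw [eq_sub_iff_add_eq, add_comm]
      simpa using h
    · exact (c2.const_mul _).intervalIntegrable _ _
    · exact c1.intervalIntegrable _ _
  · exact (continuous_pow _).continuousOn.mul (hBc.mono Set.Icc_subset_Ici_self)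
  · intro x hx
    have h1 := (hasDerivAt_pow (k + 1) x).mul ((hB x hx.1.le).hasDerivAt (Ici_mem_nhds hx.1))
    refine h1.congr_deriv ?_
    rw [max_eq_left hx.1.le]
    push_cast
    ring
  · exact ((c2.const_mul _).add c1).intervalIntegrable _ _

/-- For t > 0 the moment is t^(-k-1) times a primitive of x^k B(x), so the quotient rule and
integration by parts replace differentiation under the integral. The family of moments is closed
under differentiation (k becomes k + 1, B becomes B'), which drives the induction in
`contDiffOn_halfMoment`. -/
theorem hasDerivWithinAt_halfMoment (k : ℕ)
    (hB : ∀ t ∈ Set.Ici (0 : ℝ), HasDerivWithinAt B (B' t) (Set.Ici 0) t)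
    (hB' : ContinuousOn B' (Set.Ici 0)) {t : ℝ} (ht : t ∈ Set.Ici (0 : ℝ)) :
    HasDerivWithinAt (halfMoment k B) (halfMoment (k + 1) B' t) (Set.Ici 0) t := by
  have hBc : ContinuousOn B (Set.Ici 0) := fun t ht => (hB t ht).continuousWithinAt
  have c2 := continuous_pow_mul_comp_max k hBc
  have hpos : ∀ t : ℝ, 0 < t → HasDerivAt (halfMoment k B) (halfMoment (k + 1) B' t) t := by
    intro t ht
    have hP : HasDerivAt (fun t => ∫ x in (0 : ℝ)..t, x ^ k * B (max x 0)) (t ^ k * B t) t := by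
      have := intervalIntegral.integral_hasDerivAt_right
        (c2.intervalIntegrable (μ := volume) 0 t)
        (c2.stronglyMeasurableAtFilter _ _) c2.continuousAt
      rwa [max_eq_left ht.le] at this
    have hq := hP.div (hasDerivAt_pow (k + 1) t) (pow_ne_zero _ ht.ne')
    have hev : halfMoment k B =ᶠ[𝓝 t]
        fun t => (∫ x in (0 : ℝ)..t, x ^ k * B (max x 0)) / t ^ (k + 1) := by
      filter_upwards [lt_mem_nhds ht] with σ hσ
      rw [← mul_halfMoment, mul_div_cancel_left₀ _ (pow_ne_zero _ hσ.ne')]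
    refine (hq.congr_of_eventuallyEq hev).congr_deriv ?_
    have e := mul_halfMoment (k + 1) (B := B') t
    rw [integral_pow_mul_deriv k hB hB' ht.le] at e
    rw [eq_comm, eq_div_iff (by positivity)]
    simp only [Nat.add_sub_cancel]
    push_cast
    linear_combination t ^ k * e
  rcases (Set.mem_Ici.1 ht).eq_or_lt with h0 | h0
  · subst h0
    -- At the boundary point the one-sided derivative is the limit of the derivatives from the
    -- right.
    refine hasDerivWithinAt_Ici_of_tendsto_deriv (s := Set.Ioi 0)
      (fun t ht => (hpos t ht).differentiableAt.differentiableWithinAt)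
      (continuous_halfMoment k hBc).continuousWithinAt self_mem_nhdsWithin ?_
    refine ((continuous_halfMoment (k + 1) hB').continuousAt.tendsto.mono_left
      nhdsWithin_le_nhds).congr' ?_
    filter_upwards [self_mem_nhdsWithin] with t ht using (hpos t ht).deriv.symm
  · exact (hpos t h0).hasDerivWithinAt

theorem _root_.ContDiffOn.hasDerivWithinAt_Ici (hB : ContDiffOn ℝ (⊤ : ℕ∞) B (Set.Ici 0)) {t : ℝ}
    (ht : 0 ≤ t) : HasDerivWithinAt B (derivWithin B (Set.Ici 0) t) (Set.Ici 0) t :=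
  (hB.differentiableOn (by simp) t ht).hasDerivWithinAt

theorem _root_.ContDiffOn.derivWithin_Ici (hB : ContDiffOn ℝ (⊤ : ℕ∞) B (Set.Ici 0)) :
    ContDiffOn ℝ (⊤ : ℕ∞) (derivWithin B (Set.Ici 0)) (Set.Ici 0) :=
  ((contDiffOn_infty_iff_derivWithin (uniqueDiffOn_Ici 0)).1 hB).2

theorem contDiffOn_halfMoment (m k : ℕ) (hB : ContDiffOn ℝ (⊤ : ℕ∞) B (Set.Ici 0)) :
    ContDiffOn ℝ m (halfMoment k B) (Set.Ici 0) := by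
  induction m generalizing k B with
  | zero => exact contDiffOn_zero.2 (continuous_halfMoment k hB.continuousOn).continuousOn
  | succ m ih =>
    have hd : ∀ t ∈ Set.Ici (0 : ℝ), HasDerivWithinAt (halfMoment k B)
        (halfMoment (k + 1) (derivWithin B (Set.Ici 0)) t) (Set.Ici 0) t := fun t ht =>
      hasDerivWithinAt_halfMoment k (fun t ht => hB.hasDerivWithinAt_Ici ht)
        hB.derivWithin_Ici.continuousOn ht
    push_cast
    rw [contDiffOn_succ_iff_derivWithin (uniqueDiffOn_Ici 0)]
    refine ⟨fun t ht => (hd t ht).differentiableWithinAt, by simp, ?_⟩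
    exact (ih (k + 1) hB.derivWithin_Ici).congr fun t ht =>
      (hd t ht).derivWithin (uniqueDiffOn_Ici 0 t ht)

/-- Hadamard's lemma on a half-line: `B t - B 0 = t q(t)` with `q` smooth up to the boundary. -/
theorem exists_smooth_quotient (hB : ContDiffOn ℝ (⊤ : ℕ∞) B (Set.Ici 0)) :
    ∃ q : ℝ → ℝ, Continuous q ∧ ContDiffOn ℝ (⊤ : ℕ∞) q (Set.Ici 0) ∧
      q 0 = derivWithin B (Set.Ici 0) 0 ∧ ∀ t, 0 ≤ t → t * q t = B t - B 0 := by
  -- The quotient is the mean ∫₀¹ B'(tu) du.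
  refine ⟨halfMoment 0 (derivWithin B (Set.Ici 0)),
    continuous_halfMoment 0 hB.derivWithin_Ici.continuousOn,
    contDiffOn_infty.2 fun m => contDiffOn_halfMoment m 0 hB.derivWithin_Ici, ?_, fun t ht => ?_⟩
  · simp [halfMoment]
  · have h := mul_halfMoment 0 (B := derivWithin B (Set.Ici 0)) t
    rw [zero_add, pow_one] at h
    rw [h]
    refine intervalIntegral.integral_eq_sub_of_hasDerivAt_of_le ht
      (hB.continuousOn.mono Set.Icc_subset_Ici_self) (fun x hx => ?_) ?_
    · rw [max_eq_left hx.1.le, pow_zero, one_mul]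
      exact (hB.hasDerivWithinAt_Ici hx.1.le).hasDerivAt (Ici_mem_nhds hx.1)
    · have := continuous_comp_max hB.derivWithin_Ici.continuousOn
      exact Continuous.intervalIntegrable (by fun_prop) _ _

end Hadamard

/-- The sign of `s` against `log ‖y_i‖²` in the charts of a side. -/
def Side.eps : Side → ℝ
  | Side.zero => 1
  | Side.infinity => -1

/-- The limit of `f'` along the divisor of a side. -/
def Side.endVal (α β : ℝ) : Side → ℝ
  | Side.zero => α
  | Side.infinity => β

@[simp]
theorem Side.eps_mul_eps (s : Side) : s.eps * s.eps = 1 := by cases s <;> simp [Side.eps]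

theorem Side.eps_ne_zero (s : Side) : s.eps ≠ 0 := by cases s <;> simp [Side.eps]

/-! ### Profiles near the two ends, and construction of the profile of χ. -/

section Ends

variable {f g h : ℝ → ℝ} {α β : ℝ} {F : ℝ → ℝ} {s : Side}

/-- `F` is the smooth extension of the profile `f` along the divisor of the side `s`. -/
structure IsEnd (f : ℝ → ℝ) (s : Side) (γ : ℝ) (F : ℝ → ℝ) : Prop where
  smooth : ContDiffOn ℝ (⊤ : ℕ∞) F (Set.Ici 0)
  eq : ∀ t, 0 < t → F t = f (s.eps * Real.log t) - s.eps * γ * Real.log t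
  pos : 0 < derivWithin F (Set.Ici 0) 0

/-- `f'` as a function of `t`, smooth up to `t = 0`. -/
def endMomentum (s : Side) (γ : ℝ) (F : ℝ → ℝ) (t : ℝ) : ℝ :=
  γ + s.eps * (t * derivWithin F (Set.Ici 0) t)

/-- `f'' / t` as a function of `t`, smooth up to `t = 0`. -/
def endDensity (F : ℝ → ℝ) (t : ℝ) : ℝ :=
  derivWithin F (Set.Ici 0) t + t * derivWithin (derivWithin F (Set.Ici 0)) (Set.Ici 0) t

theorem IsProfile.exists_isEnd (hf : IsProfile f α β) (s : Side) :
    ∃ F, IsEnd f s (s.endVal α β) F := by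
  cases s
  · obtain ⟨F, h1, h2, h3⟩ := hf.at_zero
    exact ⟨F, h1, fun t ht => by simp [h2 t ht, Side.eps, Side.endVal], h3⟩
  · obtain ⟨F, h1, h2, h3⟩ := hf.at_infinity
    exact ⟨F, h1, fun t ht => by simp [h2 t ht, Side.eps, Side.endVal], h3⟩

theorem IsProfile.of_isEnd (hf : ContDiff ℝ (⊤ : ℕ∞) f) (h1 : ∀ s, 0 < deriv f s)
    (h2 : ∀ s, 0 < deriv (deriv f) s) (hend : ∀ s : Side, ∃ F, IsEnd f s (s.endVal α β) F) :
    IsProfile f α β := by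
  refine ⟨hf, h1, h2, ?_, ?_⟩
  · obtain ⟨F, hF⟩ := hend Side.zero
    exact ⟨F, hF.smooth, fun t ht => by simp [hF.eq t ht, Side.eps, Side.endVal], hF.pos⟩
  · obtain ⟨F, hF⟩ := hend Side.infinity
    exact ⟨F, hF.smooth, fun t ht => by simp [hF.eq t ht, Side.eps, Side.endVal], hF.pos⟩

theorem contDiffOn_endMomentum (γ : ℝ) (hF : ContDiffOn ℝ (⊤ : ℕ∞) F (Set.Ici 0)) :
    ContDiffOn ℝ (⊤ : ℕ∞) (endMomentum s γ F) (Set.Ici 0) := by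
  have := hF.derivWithin_Ici
  unfold endMomentum
  fun_prop

theorem contDiffOn_endDensity (hF : ContDiffOn ℝ (⊤ : ℕ∞) F (Set.Ici 0)) :
    ContDiffOn ℝ (⊤ : ℕ∞) (endDensity F) (Set.Ici 0) := by
  have := hF.derivWithin_Ici
  have := hF.derivWithin_Ici.derivWithin_Ici
  unfold endDensity
  fun_prop

@[simp]
theorem endMomentum_zero (γ : ℝ) : endMomentum s γ F 0 = γ := by simp [endMomentum]

theorem hasDerivWithinAt_endMomentum (γ : ℝ) (hF : ContDiffOn ℝ (⊤ : ℕ∞) F (Set.Ici 0)) {t : ℝ}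
    (ht : 0 ≤ t) :
    HasDerivWithinAt (endMomentum s γ F) (s.eps * endDensity F t) (Set.Ici 0) t := by
  have h := (((hasDerivWithinAt_id t (Set.Ici 0)).mul
    (hF.derivWithin_Ici.hasDerivWithinAt_Ici ht)).const_mul s.eps).const_add γ
  refine h.congr_deriv ?_
  simp only [endDensity, id]
  ring

/-- Differentiating F(t) = f(ε log t) - εγ log t gives t F' = ε (f' - γ), and ε² = 1. A second
differentiation gives `IsEnd.endDensity_eq`. -/
theorem IsEnd.endMomentum_eq {γ : ℝ} (hF : IsEnd f s γ F) (hf : Differentiable ℝ f) {t : ℝ}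
    (ht : 0 < t) : endMomentum s γ F t = deriv f (s.eps * Real.log t) := by
  have h1 : HasDerivAt F (derivWithin F (Set.Ici 0) t) t :=
    (hF.smooth.hasDerivWithinAt_Ici ht.le).hasDerivAt (Ici_mem_nhds ht)
  have hl := (Real.hasDerivAt_log ht.ne').const_mul s.eps
  have h2 := ((hf (s.eps * Real.log t)).hasDerivAt.comp t hl).sub
    ((Real.hasDerivAt_log ht.ne').const_mul (s.eps * γ))
  have h3 : F =ᶠ[𝓝 t] fun t => f (s.eps * Real.log t) - s.eps * γ * Real.log t := by
    filter_upwards [lt_mem_nhds ht] with σ hσ using hF.eq σ hσ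
  have h4 := h1.unique (h2.congr_of_eventuallyEq h3)
  rw [endMomentum, h4]
  field_simp
  linear_combination (deriv f (s.eps * Real.log t) - γ) * s.eps_mul_eps

theorem IsEnd.endDensity_eq {γ : ℝ} (hF : IsEnd f s γ F) (hf : ContDiff ℝ (⊤ : ℕ∞) f) {t : ℝ}
    (ht : 0 < t) : t * endDensity F t = deriv (deriv f) (s.eps * Real.log t) := by
  have h1 := (hasDerivWithinAt_endMomentum (s := s) γ hF.smooth ht.le).hasDerivAt (Ici_mem_nhds ht)
  have hd : Differentiable ℝ (deriv f) :=
    ((contDiff_infty_iff_deriv.1 hf).2).differentiable (by simp)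
  have h2 := (hd (s.eps * Real.log t)).hasDerivAt.comp t
    ((Real.hasDerivAt_log ht.ne').const_mul s.eps)
  have h3 : endMomentum s γ F =ᶠ[𝓝 t] deriv f ∘ fun t => s.eps * Real.log t := by
    filter_upwards [lt_mem_nhds ht] with σ hσ
    exact hF.endMomentum_eq (hf.differentiable (by simp)) hσ
  have h4 := h1.unique (h2.congr_of_eventuallyEq h3)
  have h5 : endDensity F t = deriv (deriv f) (s.eps * Real.log t) * t⁻¹ := by
    refine mul_left_cancel₀ s.eps_ne_zero ?_
    rw [h4]
    ring
  rw [h5]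
  field_simp

theorem IsProfile.endMomentum_pos (hf : IsProfile f α β) (hα : 0 < α) (hβ : 0 < β)
    (hF : IsEnd f s (s.endVal α β) F) {t : ℝ} (ht : 0 ≤ t) :
    0 < endMomentum s (s.endVal α β) F t := by
  rcases ht.eq_or_lt with rfl | ht
  · cases s <;> simpa [Side.endVal]
  · rw [hF.endMomentum_eq (hf.smooth.differentiable (by simp)) ht]
    exact hf.deriv_pos _

theorem IsProfile.endDensity_pos (hf : IsProfile f α β)
    (hF : IsEnd f s (s.endVal α β) F) {t : ℝ} (ht : 0 ≤ t) : 0 < endDensity F t := by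
  rcases ht.eq_or_lt with rfl | ht
  · simpa [endDensity] using hF.pos
  · have := hF.endDensity_eq hf.smooth ht
    have h2 := hf.deriv_deriv_pos (s.eps * Real.log t)
    rw [← this] at h2
    exact (pos_iff_pos_of_mul_pos h2).1 ht

theorem IsProfile.deriv_eq_endMomentum (hf : IsProfile f α β)
    (hF : IsEnd f s (s.endVal α β) F) (x : ℝ) :
    deriv f x = endMomentum s (s.endVal α β) F (Real.exp (s.eps * x)) := by
  rw [hF.endMomentum_eq (hf.smooth.differentiable (by simp)) (Real.exp_pos _), Real.log_exp,
    ← mul_assoc, s.eps_mul_eps, one_mul]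

theorem IsEnd.tendsto_endMomentum {γ : ℝ} (hF : IsEnd f s γ F) {ι : Type*} {l : Filter ι}
    {x : ι → ℝ} (hx : Tendsto x l (𝓝 0)) (h0 : ∀ i, 0 ≤ x i) :
    Tendsto (fun i => endMomentum s γ F (x i)) l (𝓝 γ) := by
  have h := (contDiffOn_endMomentum (s := s) γ hF.smooth).continuousOn 0 Set.self_mem_Ici
  have h2 := h.tendsto.comp (tendsto_nhdsWithin_iff.2 ⟨hx, Eventually.of_forall h0⟩)
  rwa [endMomentum_zero] at h2

theorem IsProfile.tendsto_deriv_atBot (hf : IsProfile f α β) :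
    Tendsto (deriv f) atBot (𝓝 α) := by
  obtain ⟨F, hF⟩ := hf.exists_isEnd Side.zero
  have h : deriv f = _ := funext (hf.deriv_eq_endMomentum hF)
  rw [h]
  refine hF.tendsto_endMomentum ?_ fun _ => (Real.exp_pos _).le
  simpa [Side.eps] using Real.tendsto_exp_atBot

theorem IsProfile.tendsto_deriv_atTop (hf : IsProfile f α β) :
    Tendsto (deriv f) atTop (𝓝 β) := by
  obtain ⟨F, hF⟩ := hf.exists_isEnd Side.infinity
  have h : deriv f = _ := funext (hf.deriv_eq_endMomentum hF)
  rw [h]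
  refine hF.tendsto_endMomentum ?_ fun _ => (Real.exp_pos _).le
  simp only [Side.eps, neg_mul, one_mul]
  exact Real.tendsto_exp_atBot.comp tendsto_neg_atTop_atBot

theorem IsProfile.strictMono_deriv (hf : IsProfile f α β) : StrictMono (deriv f) :=
  strictMono_of_deriv_pos hf.deriv_deriv_pos

theorem IsProfile.deriv_mem_Ioo (hf : IsProfile f α β) (x : ℝ) : deriv f x ∈ Set.Ioo α β := by
  have hm := hf.strictMono_deriv
  constructor
  -- Comparison with x - 1, and below with x + 1, makes the bounds by the limits strict.
  · exact (hm.monotone.le_of_tendsto hf.tendsto_deriv_atBot (x - 1)).trans_lt (hm (by linarith))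
  · exact (hm (by linarith : x < x + 1)).trans_le
      (hm.monotone.ge_of_tendsto hf.tendsto_deriv_atTop (x + 1))

/-- A positive increasing function with the right behaviour at the two ends is the derivative of a
profile. -/
theorem exists_profile_of_deriv (hh : ContDiff ℝ (⊤ : ℕ∞) h) (h0 : ∀ x, 0 < h x)
    (h1 : ∀ x, 0 < deriv h x)
    (hend : ∀ s : Side, ∃ A : ℝ → ℝ, ContDiffOn ℝ (⊤ : ℕ∞) A (Set.Ici 0) ∧
      (∀ t, 0 < t → A t = h (s.eps * Real.log t)) ∧ A 0 = s.endVal α β ∧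
      0 < s.eps * derivWithin A (Set.Ici 0) 0) :
    ∃ f, IsProfile f α β ∧ deriv f = h := by
  have hf : ∀ x, HasDerivAt (fun x => ∫ r in (0 : ℝ)..x, h r) (h x) x := fun x =>
    intervalIntegral.integral_hasDerivAt_right (hh.continuous.intervalIntegrable _ _)
      (hh.continuous.stronglyMeasurableAtFilter _ _) hh.continuous.continuousAt
  set f : ℝ → ℝ := fun x => ∫ r in (0 : ℝ)..x, h r with hfdef
  have hdf : deriv f = h := funext fun x => (hf x).deriv
  refine ⟨f, IsProfile.of_isEnd ?_ (by simpa [hdf] using h0) (by simpa [hdf] using h1) ?_, hdf⟩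
  · rw [contDiff_infty_iff_deriv, hdf]
    exact ⟨fun x => (hf x).differentiableAt, hh⟩
  intro s
  obtain ⟨A, hA, hAh, hA0, hA1⟩ := hend s
  -- The function f(ε log t) - εγ log t has derivative ε (A(t) - A(0)) / t = ε q(t), since A(0) = γ.
  -- Smoothness of q up to 0 therefore makes a primitive of ε q the required extension.
  obtain ⟨q, hqc, hqs, hq0, hq⟩ := exists_smooth_quotient hA
  have hq' : ∀ x, HasDerivAt (fun x => f 0 + s.eps * ∫ r in (1 : ℝ)..x, q r) (s.eps * q x) x :=
    fun x => ((intervalIntegral.integral_hasDerivAt_right (hqc.intervalIntegrable _ _)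
      (hqc.stronglyMeasurableAtFilter _ _) hqc.continuousAt).const_mul s.eps).const_add (f 0)
  have hdw : ∀ x ∈ Set.Ici (0 : ℝ), derivWithin (fun x => f 0 + s.eps * ∫ r in (1 : ℝ)..x, q r)
      (Set.Ici 0) x = s.eps * q x := fun x hx =>
    (hq' x).hasDerivWithinAt.derivWithin (uniqueDiffOn_Ici 0 x hx)
  -- The base point 1 and the constant `f 0` make the two functions agree at t = 1, where log t = 0.
  refine ⟨fun x => f 0 + s.eps * ∫ r in (1 : ℝ)..x, q r, ?_, ?_, ?_⟩
  · rw [contDiffOn_infty_iff_derivWithin (uniqueDiffOn_Ici 0)]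
    exact ⟨fun x _ => (hq' x).differentiableAt.differentiableWithinAt,
      (contDiffOn_const.mul hqs).congr hdw⟩
  · have key : Set.EqOn (fun x => f 0 + s.eps * ∫ r in (1 : ℝ)..x, q r)
        (fun t => f (s.eps * Real.log t) - s.eps * s.endVal α β * Real.log t) (Set.Ioi 0) := by
      have hr : ∀ t : ℝ, 0 < t → HasDerivAt
          (fun t => f (s.eps * Real.log t) - s.eps * s.endVal α β * Real.log t)
          (s.eps * q t) t := by
        intro t ht
        have e := ((hf (s.eps * Real.log t)).comp t
          ((Real.hasDerivAt_log ht.ne').const_mul s.eps)).sub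
          ((Real.hasDerivAt_log ht.ne').const_mul (s.eps * s.endVal α β))
        refine e.congr_deriv ?_
        have := hq t ht.le
        rw [hAh t ht, hA0] at this
        field_simp
        linear_combination -s.eps * this
      refine isOpen_Ioi.eqOn_of_deriv_eq isPreconnected_Ioi
        (fun x _ => (hq' x).differentiableAt.differentiableWithinAt)
        (fun x hx => (hr x hx).differentiableAt.differentiableWithinAt)
        (fun x hx => (hq' x).deriv.trans (hr x hx).deriv.symm) (x := 1) (by simp) ?_
      simp
    exact fun t ht => key ht
  · rw [hdw 0 Set.self_mem_Ici, hq0]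
    exact hA1

/-- The profile `f` with `psi (f') = g'`. -/
theorem exists_profile_psi {n : ℕ} {a b k : ℝ} (hn : 2 ≤ n) (hb : 1 < b) (hk : 0 ≤ k)
    (hck : (n : ℝ) - 1 < ckConst n a b k + k) (hg : IsProfile g 1 a) :
    ∃ f, IsProfile f 1 b ∧ ∀ x, deriv f x ∈ Set.Ioo 1 b ∧ psi n a b k (deriv f x) = deriv g x := by
  have hn0 : n ≠ 0 := by omega
  have hpsi1 : psi n a b k 1 = 1 := psi_one hn0
  have hpsib : psi n a b k b = a := psi_right hn0 hb
  -- the derivative is positive on an open half-line containing `[1, b]`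
  obtain ⟨δ, hδ0, hδ1, hδ⟩ : ∃ δ : ℝ, 0 < δ ∧ δ < 1 ∧ ∀ x, δ < x → 0 < psiDeriv n a b k x := by
    have hc : ContinuousAt (deriv (psi n a b k)) 1 :=
      ((contDiffOn_psi.contDiffAt (Ioi_mem_nhds one_pos)).fderiv_right (m := 0)
        (by simp)).continuousAt.clm_apply continuousAt_const
    have hev := hc.eventually (lt_mem_nhds (a := 0)
      (by rw [deriv_psi one_ne_zero]; exact psiDeriv_pos hn hk hck le_rfl))
    obtain ⟨r, hr, hr'⟩ := Metric.eventually_nhds_iff.1 hev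
    -- The bound 1/2 keeps the half-line away from τ = 0.
    refine ⟨max (1 - r) (1 / 2), by positivity, by simp [hr]; norm_num, fun x hx => ?_⟩
    have hx0 : 0 < x := lt_of_le_of_lt (by positivity) hx
    rcases le_or_gt 1 x with h1 | h1
    · exact psiDeriv_pos hn hk hck h1
    · rw [← deriv_psi hx0.ne']
      refine hr' ?_
      rw [Real.dist_eq, abs_lt]
      constructor <;> linarith [le_max_left (1 - r) (1 / 2)]
  have hpos : ∀ x, δ < x → 0 < deriv (psi n a b k) x := fun x hx => by
    rw [deriv_psi (hδ0.trans hx).ne']; exact hδ x hx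
  have hsm : ContDiffOn ℝ (⊤ : ℕ∞) (psi n a b k) (Set.Ioi δ) :=
    contDiffOn_psi.mono (Set.Ioi_subset_Ioi hδ0.le)
  have hmono : StrictMonoOn (psi n a b k) (Set.Ioi δ) :=
    strictMonoOn_of_deriv_pos (convex_Ioi δ) hsm.continuousOn (by simpa using hpos)
  obtain ⟨r, hrl, hrs⟩ := exists_smooth_leftInverse isOpen_Ioi hsm hmono.injOn
    fun x hx => (hpos x hx).ne'
  -- the range of `psi` on `[1, b]`
  have himg : ∀ z ∈ Set.Icc 1 a, ∃ x ∈ Set.Icc 1 b, psi n a b k x = z := by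
    intro z hz
    have := intermediate_value_Icc hb.le
      (hsm.continuousOn.mono fun x hx => Set.mem_Ioi.2 (hδ1.trans_le hx.1))
    rw [hpsi1, hpsib] at this
    exact this hz
  have hrz : ∀ z ∈ Set.Icc 1 a, ContDiffAt ℝ (⊤ : ℕ∞) r z ∧ r z ∈ Set.Icc 1 b ∧
      psi n a b k (r z) = z := by
    intro z hz
    obtain ⟨x, hx, rfl⟩ := himg z hz
    have hxδ : x ∈ Set.Ioi δ := Set.mem_Ioi.2 (hδ1.trans_le hx.1)
    rw [hrl x hxδ]
    exact ⟨hrs x hxδ, hx, rfl⟩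
  have hr1 : r 1 = 1 := by
    have := hrl 1 hδ1
    rwa [hpsi1] at this
  have hra : r a = b := by
    have := hrl b (hδ1.trans hb)
    rwa [hpsib] at this
  have hg' : ContDiff ℝ (⊤ : ℕ∞) (deriv g) := (contDiff_infty_iff_deriv.1 hg.smooth).2
  have hgm : ∀ x, deriv g x ∈ Set.Icc 1 a := fun x => Set.Ioo_subset_Icc_self (hg.deriv_mem_Ioo x)
  have hh : ContDiff ℝ (⊤ : ℕ∞) fun x => r (deriv g x) := contDiff_iff_contDiffAt.2 fun x =>
    (hrz _ (hgm x)).1.comp x hg'.contDiffAt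
  have hIoo : ∀ x, r (deriv g x) ∈ Set.Ioo 1 b := by
    intro x
    obtain ⟨-, h2, h3⟩ := hrz _ (hgm x)
    refine ⟨lt_of_le_of_ne h2.1 ?_, lt_of_le_of_ne h2.2 ?_⟩
    · intro e
      rw [← e, hpsi1] at h3
      exact (hg.deriv_mem_Ioo x).1.ne h3
    · intro e
      rw [e, hpsib] at h3
      exact (hg.deriv_mem_Ioo x).2.ne h3.symm
  have hrd : ∀ z ∈ Set.Icc 1 a, 0 < deriv r z := by
    intro z hz
    obtain ⟨h1, h2, h3⟩ := hrz z hz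
    have hx0 : r z ∈ Set.Ioi δ := Set.mem_Ioi.2 (hδ1.trans_le h2.1)
    have hp := (hasDerivAt_psi (n := n) (a := a) (b := b) (k := k)
      (hδ0.trans hx0).ne')
    have hr' : HasDerivAt r (deriv r z) (psi n a b k (r z)) := by
      rw [h3]; exact (h1.differentiableAt (by simp)).hasDerivAt
    have hcomp := hr'.comp (r z) hp
    have hid : HasDerivAt (r ∘ psi n a b k) 1 (r z) := by
      refine (hasDerivAt_id (r z)).congr_of_eventuallyEq ?_
      filter_upwards [Ioi_mem_nhds hx0] with x hx using hrl x hx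
    have := hcomp.unique hid
    -- The derivative of r ∘ ψ = id gives r' ψ' = 1 with ψ' > 0.
    exact (pos_iff_pos_of_mul_pos (by rw [this]; exact one_pos)).2 (hδ _ hx0)
  have hder : ∀ x, 0 < deriv (fun x => r (deriv g x)) x := by
    intro x
    have h1 := ((hrz _ (hgm x)).1.differentiableAt (by simp)).hasDerivAt.comp x
      (hg'.differentiable (by simp) x).hasDerivAt
    rw [show deriv (fun x => r (deriv g x)) x = _ from h1.deriv]
    exact mul_pos (hrd _ (hgm x)) (hg.deriv_deriv_pos x)
  have hend : ∀ s : Side, ∃ A : ℝ → ℝ, ContDiffOn ℝ (⊤ : ℕ∞) A (Set.Ici 0) ∧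
      (∀ t, 0 < t → A t = r (deriv g (s.eps * Real.log t))) ∧ A 0 = s.endVal 1 b ∧
      0 < s.eps * derivWithin A (Set.Ici 0) 0 := by
    intro s
    obtain ⟨F, hF⟩ := hg.exists_isEnd s
    have hAs := contDiffOn_endMomentum (s := s) (s.endVal 1 a) hF.smooth
    have hAm : ∀ t ∈ Set.Ici (0 : ℝ), endMomentum s (s.endVal 1 a) F t ∈ Set.Icc 1 a := by
      intro t ht
      rcases (Set.mem_Ici.1 ht).eq_or_lt with rfl | ht
      · have ha := (hgm 0).1.trans (hgm 0).2
        cases s <;> simpa [Side.endVal]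
      · rw [hF.endMomentum_eq (hg.smooth.differentiable (by simp)) ht]
        exact hgm _
    -- The inverse `r` is smooth also at the end values 1 and a, because ψ' > 0 on a neighbourhood
    -- of [1, b]. So composing it with the extension of g' stays smooth up to t = 0, and its slope
    -- there is ε r' times a positive density.
    refine ⟨fun t => r (endMomentum s (s.endVal 1 a) F t), ?_, ?_, ?_, ?_⟩
    · intro t ht
      exact (hrz _ (hAm t ht)).1.comp_contDiffWithinAt t (hAs t ht)
    · intro t ht
      simp only [hF.endMomentum_eq (hg.smooth.differentiable (by simp)) ht]
    · cases s <;> simp [Side.endVal, hr1, hra]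
    · have h0 := hAm 0 Set.self_mem_Ici
      have h1 := ((hrz _ h0).1.differentiableAt (by simp)).hasDerivAt.comp_hasDerivWithinAt 0
        (hasDerivWithinAt_endMomentum (s := s) (s.endVal 1 a) hF.smooth le_rfl)
      rw [show derivWithin (fun t => r (endMomentum s (s.endVal 1 a) F t)) (Set.Ici 0) 0 = _ from
        h1.derivWithin (uniqueDiffOn_Ici 0 0 Set.self_mem_Ici), mul_left_comm, ← mul_assoc s.eps,
        s.eps_mul_eps, one_mul]
      exact mul_pos (hrd _ h0) (hg.endDensity_pos hF le_rfl)
  obtain ⟨f, hf, hdf⟩ := exists_profile_of_deriv (α := 1) (β := b) hh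
    (fun x => one_pos.trans (hIoo x).1) hder hend
  refine ⟨f, hf, fun x => ?_⟩
  rw [hdf]
  exact ⟨hIoo x, (hrz _ (hgm x)).2.2⟩

end Ends

/-! ### Changes of coordinates, and the function s in the charts. -/

section Charts

variable {n : ℕ}

/-- The last component of the change of coordinates into a chart of the given side. -/
def fibreRatio (s : Side) (p q : ℂ) : ℂ :=
  match s with
  | Side.zero => p / q
  | Side.infinity => q / p

/-- The denominator of `fibreRatio`. -/
def fibreDenom (s : Side) (p q : ℂ) : ℂ :=
  match s with
  | Side.zero => q
  | Side.infinity => p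

theorem coord_param_eq (c d : Chart n) (y : Fin n → ℂ) :
    coord d (param c y) = Function.update (fun m => dir c.1 y m / dir c.1 y d.1) d.1
      (fibreRatio d.2 ((baseVec c y).1 d.1) (baseVec c y).2) := by
  obtain ⟨u, hu0, hu⟩ := param_fst_rep c y
  obtain ⟨v, hv0, hv⟩ := param_snd_rep c y
  obtain ⟨j, s⟩ := d
  cases s <;> simp [coord, hu, hv, fibreRatio, mul_div_mul_left, hu0, hv0]

theorem param_coord {p : X n} {j : Fin n} {s : Side} (hj : p.1.2.rep j ≠ 0)
    (hs : fibreDenom s (p.1.1.rep.1 j) p.1.1.rep.2 ≠ 0) : param (j, s) (coord (j, s) p) = p := by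
  obtain ⟨⟨m, l⟩, h⟩ := p
  simp only at h hj hs
  have hZ : ∀ q : ℂ, dir j (Function.update (fun i => l.rep i / l.rep j) j q)
      = (l.rep j)⁻¹ • l.rep := by
    intro q
    funext i
    by_cases hi : i = j
    · subst hi; simp [dir, hj]
    · simp [dir, hi, div_eq_inv_mul]
  have hx : m.rep.1 = (m.rep.1 j / l.rep j) • l.rep := by
    funext i
    have := h j i
    simp only [Pi.smul_apply, smul_eq_mul]
    field_simp
    linear_combination -this
  apply Subtype.ext
  refine Prod.ext ?_ ?_
  · change _ = m
    conv_rhs => rw [← m.mk_rep]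
    cases s
    · simp only [param]
      rw [Projectivization.mk_eq_mk_iff']
      refine ⟨(m.rep.2)⁻¹, Prod.ext ?_ ?_⟩
      · simp only [baseVec, coord, hZ, Prod.smul_fst]
        conv_lhs => rw [hx]
        simp only [Function.update_self, smul_smul]
        congr 1
        field_simp
      · have hs' : m.rep.2 ≠ 0 := hs
        simp [baseVec, hs']
    · simp only [param]
      rw [Projectivization.mk_eq_mk_iff']
      have hs' : m.rep.1 j ≠ 0 := hs
      refine ⟨(m.rep.1 j)⁻¹, Prod.ext ?_ ?_⟩
      · simp only [baseVec, coord, hZ, Prod.smul_fst]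
        conv_lhs => arg 2; rw [hx]
        simp only [smul_smul]
        congr 1
        field_simp
      · simp [baseVec, coord, div_eq_inv_mul]
  · change _ = l
    conv_rhs => rw [← l.mk_rep]
    cases s <;>
    · simp only [param, coord]
      rw [Projectivization.mk_eq_mk_iff']
      exact ⟨(l.rep j)⁻¹, (hZ _).symm⟩

/-- The part of the chart `c` that meets the chart `d`. -/
def overlap (c d : Chart n) : Set (Fin n → ℂ) :=
  {y | dir c.1 y d.1 ≠ 0 ∧ fibreDenom d.2 ((baseVec c y).1 d.1) (baseVec c y).2 ≠ 0}

theorem param_coord_param {c d : Chart n} {y : Fin n → ℂ} (hy : y ∈ overlap c d) :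
    param d (coord d (param c y)) = param c y := by
  obtain ⟨u, hu0, hu⟩ := param_fst_rep c y
  obtain ⟨v, hv0, hv⟩ := param_snd_rep c y
  obtain ⟨j, s⟩ := d
  obtain ⟨h1, h2⟩ := hy
  refine param_coord ?_ ?_
  · rw [hv]
    simpa [hv0] using h1
  · rw [hu]
    cases s <;> simpa [fibreDenom, hu0] using h2

/-- Homogeneous vectors of the same point are proportional, and the coordinates serving as
denominators equal 1 in the chart `d`; so they cannot vanish in the chart `c`. -/
theorem mem_overlap_of_param_eq {c d : Chart n} {y y' : Fin n → ℂ} (h : param c y = param d y') :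
    y ∈ overlap c d := by
  obtain ⟨u, hu0, hu⟩ := param_fst_rep c y
  obtain ⟨v, hv0, hv⟩ := param_snd_rep c y
  obtain ⟨u', hu0', hu'⟩ := param_fst_rep d y'
  obtain ⟨v', hv0', hv'⟩ := param_snd_rep d y'
  rw [h, hu'] at hu
  rw [h, hv'] at hv
  obtain ⟨j, s⟩ := d
  constructor
  · have e : v' * dir j y' j = v * dir c.1 y j := congrFun hv j
    intro h0
    rw [show dir c.1 y j = 0 from h0] at e
    simp [dir, hv0'] at e
  · intro h0
    cases s
    · have e : u' * 1 = u * (baseVec c y).2 := congrArg Prod.snd hu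
      rw [show (baseVec c y).2 = 0 from h0] at e
      simp [hu0'] at e
    · have e : u' * dir j y' j = u * (baseVec c y).1 j := congrFun (congrArg Prod.fst hu) j
      rw [show (baseVec c y).1 j = 0 from h0] at e
      simp [dir, hu0'] at e

theorem contDiff_dir {𝕜 : Type*} [NontriviallyNormedField 𝕜] [NormedAlgebra 𝕜 ℂ] {m : WithTop ℕ∞}
    (i j : Fin n) : ContDiff 𝕜 m (fun y : Fin n → ℂ => dir i y j) := by
  by_cases h : j = i
  · subst h
    simpa [dir] using contDiff_const
  · simpa [dir, h] using contDiff_apply 𝕜 ℂ j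

theorem contDiff_baseVec_fst {m : WithTop ℕ∞} (c : Chart n) (j : Fin n) :
    ContDiff ℂ m (fun y : Fin n → ℂ => (baseVec c y).1 j) := by
  obtain ⟨i, s⟩ := c
  cases s
  · simpa [baseVec] using (contDiff_apply ℂ ℂ i).mul (contDiff_dir i j)
  · simpa [baseVec] using contDiff_dir i j

theorem contDiff_baseVec_snd {m : WithTop ℕ∞} (c : Chart n) :
    ContDiff ℂ m (fun y : Fin n → ℂ => (baseVec c y).2) := by
  obtain ⟨i, s⟩ := c
  cases s
  · simpa [baseVec] using contDiff_const
  · simpa [baseVec] using contDiff_apply ℂ ℂ i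

theorem isOpen_overlap (c d : Chart n) : IsOpen (overlap c d) := by
  refine (isOpen_ne_fun (contDiff_dir (𝕜 := ℂ) (m := 0) c.1 d.1).continuous
    continuous_const).inter ?_
  obtain ⟨j, s⟩ := d
  cases s
  · exact isOpen_ne_fun (contDiff_baseVec_snd (m := 0) c).continuous continuous_const
  · exact isOpen_ne_fun (contDiff_baseVec_fst (m := 0) c j).continuous continuous_const

/-- The changes of coordinates are holomorphic. -/
theorem contDiffAt_coord_param {m : WithTop ℕ∞} {c d : Chart n} {y : Fin n → ℂ}
    (hy : y ∈ overlap c d) : ContDiffAt ℂ m (fun y => coord d (param c y)) y := by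
  rw [contDiffAt_pi]
  intro l
  simp only [coord_param_eq]
  by_cases hl : l = d.1
  · subst hl
    simp only [Function.update_self]
    obtain ⟨j, s⟩ := d
    cases s
    · exact (contDiff_baseVec_fst c j).contDiffAt.div (contDiff_baseVec_snd c).contDiffAt hy.2
    · exact (contDiff_baseVec_snd c).contDiffAt.div (contDiff_baseVec_fst c j).contDiffAt hy.2
  · simp only [Function.update_of_ne hl]
    exact (contDiff_dir c.1 l).contDiffAt.div (contDiff_dir c.1 d.1).contDiffAt hy.1

theorem param_mem_divisors_iff (c : Chart n) (y : Fin n → ℂ) :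
    param c y ∈ E0 n ∪ Einf n ↔ y c.1 = 0 := by
  obtain ⟨u, hu0, hu⟩ := param_fst_rep c y
  obtain ⟨i, s⟩ := c
  have h1 := dir_ne_zero i y
  cases s <;> simp [E0, Einf, hu, baseVec, hu0, h1]

/-- Formulas in s hold only off the divisors; this density carries them across. -/
theorem dense_apply_ne_zero (i : Fin n) : Dense {y : Fin n → ℂ | y i ≠ 0} :=
  (dense_compl_singleton (0 : ℂ)).preimage (isOpenMap_eval i)

theorem isOpen_apply_ne_zero (i : Fin n) : IsOpen {y : Fin n → ℂ | y i ≠ 0} :=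
  isOpen_ne_fun (continuous_apply i) continuous_const

/-- Continuous functions that agree off the divisor agree. -/
theorem eq_of_eq_off_divisor {E : Type*} [TopologicalSpace E] [T2Space E] (i : Fin n)
    {F G : (Fin n → ℂ) → E} (hF : Continuous F) (hG : Continuous G)
    (h : ∀ y, y i ≠ 0 → F y = G y) : F = G :=
  Continuous.ext_on (dense_apply_ne_zero i) hF hG h

/-- Functions continuous at a point that agree off the divisor near it agree there. -/
theorem eq_at_of_eq_off_divisor {E : Type*} [TopologicalSpace E] [T2Space E] (i : Fin n)
    {F G : (Fin n → ℂ) → E} {y : Fin n → ℂ} (hF : ContinuousAt F y) (hG : ContinuousAt G y)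
    (h : ∀ᶠ y' in 𝓝 y, y' i ≠ 0 → F y' = G y') : F y = G y := by
  have : (𝓝[{y | y i ≠ 0}] y).NeBot := mem_closure_iff_nhdsWithin_neBot.1 (dense_apply_ne_zero i y)
  refine tendsto_nhds_unique_of_eventuallyEq (l := 𝓝[{y | y i ≠ 0}] y) (hF.mono_left nhdsWithin_le_nhds)
    (hG.mono_left nhdsWithin_le_nhds) ?_
  filter_upwards [h.filter_mono nhdsWithin_le_nhds, self_mem_nhdsWithin] with y' h1 h2 using h1 h2

/-- The squared norm of the homogeneous vector `dir i y`. -/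
def dirNormSq (i : Fin n) (y : Fin n → ℂ) : ℝ := ∑ m, ‖dir i y m‖ ^ 2

/-- The square of the fibrewise norm of the coordinate that vanishes on the divisor of the chart. -/
def radius (c : Chart n) (y : Fin n → ℂ) : ℝ :=
  match c with
  | (i, Side.zero) => ‖y i‖ ^ 2 * dirNormSq i y
  | (i, Side.infinity) => ‖y i‖ ^ 2 * (dirNormSq i y)⁻¹

theorem one_le_dirNormSq (i : Fin n) (y : Fin n → ℂ) : 1 ≤ dirNormSq i y := by
  refine le_trans ?_ (Finset.single_le_sum (f := fun m => ‖dir i y m‖ ^ 2)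
    (fun m _ => by positivity) (Finset.mem_univ i))
  simp [dir]

theorem dirNormSq_pos (i : Fin n) (y : Fin n → ℂ) : 0 < dirNormSq i y :=
  one_pos.trans_le (one_le_dirNormSq i y)

theorem contDiff_dirNormSq (i : Fin n) : ContDiff ℝ (⊤ : ℕ∞) (dirNormSq (n := n) i) := by
  unfold dirNormSq
  exact ContDiff.sum fun m _ => (contDiff_dir i m).norm_sq ℝ

/-- Writing the sign ε = ±1 as a real exponent allows both kinds of charts to be treated at once. -/
theorem radius_eq (c : Chart n) (y : Fin n → ℂ) :
    radius c y = ‖y c.1‖ ^ 2 * dirNormSq c.1 y ^ (c.2.eps) := by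
  obtain ⟨i, s⟩ := c
  cases s
  · simp [radius, Side.eps]
  · simp [radius, Side.eps, Real.rpow_neg_one]

theorem radius_nonneg (c : Chart n) (y : Fin n → ℂ) : 0 ≤ radius c y := by
  rw [radius_eq]
  have := dirNormSq_pos c.1 y
  positivity

theorem radius_pos {c : Chart n} {y : Fin n → ℂ} (hy : y c.1 ≠ 0) : 0 < radius c y := by
  rw [radius_eq]
  have := dirNormSq_pos c.1 y
  positivity

theorem contDiff_radius (c : Chart n) : ContDiff ℝ (⊤ : ℕ∞) (radius c) := by
  obtain ⟨i, s⟩ := c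
  have h := contDiff_dirNormSq i
  have h1 : ContDiff ℝ (⊤ : ℕ∞) fun y : Fin n → ℂ => ‖y i‖ ^ 2 := (contDiff_apply ℝ ℂ i).norm_sq ℝ
  cases s
  · exact h1.mul h
  · exact h1.mul (h.inv fun y => (dirNormSq_pos i y).ne')

theorem logNorm_param (c : Chart n) (y : Fin n → ℂ) :
    logNorm (param c y) = c.2.eps * Real.log (radius c y) := by
  obtain ⟨u, hu0, hu⟩ := param_fst_rep c y
  obtain ⟨i, s⟩ := c
  have hu' : ‖u‖ ^ 2 ≠ 0 := by positivity
  cases s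
  · simp only [logNorm, hu, baseVec, radius, dirNormSq, Side.eps, one_mul]
    congr 1
    simp only [Prod.smul_fst, Prod.smul_snd, Pi.smul_apply, smul_eq_mul, norm_mul, mul_pow,
      ← Finset.mul_sum, mul_one]
    field_simp
  · simp only [logNorm, hu, baseVec, radius, dirNormSq, Side.eps, neg_mul, one_mul, ← Real.log_inv]
    congr 1
    simp only [Prod.smul_fst, Prod.smul_snd, Pi.smul_apply, smul_eq_mul, norm_mul, mul_pow,
      ← Finset.mul_sum, mul_inv, inv_inv]
    field_simp

theorem log_radius {c : Chart n} {y : Fin n → ℂ} (hy : y c.1 ≠ 0) :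
    Real.log (radius c y) = Real.log (‖y c.1‖ ^ 2) + c.2.eps * Real.log (dirNormSq c.1 y) := by
  have := dirNormSq_pos c.1 y
  rw [radius_eq, Real.log_mul (by positivity) (by positivity), Real.log_rpow this]

end Charts

/-! ### The Hessian of a function of s: horizontal and vertical parts. -/

section HessianOfProfile

variable {n : ℕ} {y : Fin n → ℂ}

theorem two_le_infty : (2 : WithTop ℕ∞) ≤ ((⊤ : ℕ∞) : WithTop ℕ∞) :=
  WithTop.coe_le_coe.2 (le_top : (2 : ℕ∞) ≤ ⊤)

theorem dz_apply (j m : Fin n) : dz j (fun y => y m) y = if m = j then 1 else 0 := by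
  rw [dz_of_holomorphic j (by fun_prop)]
  have : HasFDerivAt (fun y : Fin n → ℂ => y m)
      (ContinuousLinearMap.proj (R := ℂ) (φ := fun _ : Fin n => ℂ) m) y := hasFDerivAt_apply m y
  rw [this.fderiv]
  simp [Pi.single_apply]

theorem dzbar_apply (j m : Fin n) : dzbar j (fun y => y m) y = 0 :=
  dzbar_of_holomorphic j (by fun_prop)

/-- The vector `dir i y` without its component `1` in place `i`. -/
def transVec (i : Fin n) (y : Fin n → ℂ) : Fin n → ℂ := Function.update y i 0

theorem differentiable_dir (i m : Fin n) : Differentiable ℂ fun y : Fin n → ℂ => dir i y m :=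
  (contDiff_dir (m := 1) i m).differentiable (by norm_num)

theorem dz_dir (i j m : Fin n) : dz j (fun y => dir i y m) y = if m = j ∧ m ≠ i then 1 else 0 := by
  by_cases h : m = i
  · subst h
    simp [dir, dz_const]
  · simp [dir, h, dz_apply]

theorem dz_transVec (i j m : Fin n) :
    dz j (fun y => transVec i y m) y = if m = j ∧ m ≠ i then 1 else 0 := by
  by_cases h : m = i
  · subst h
    simp [transVec, dz_const]
  · simp [transVec, h, dz_apply]

theorem dirNormSq_eq_sum (i : Fin n) (y : Fin n → ℂ) :
    (dirNormSq i y : ℂ) = ∑ m, dir i y m * starRingEnd ℂ (dir i y m) := by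
  simp [dirNormSq, Complex.mul_conj']

theorem dz_dirNormSq (i j : Fin n) :
    dz j (fun y => (dirNormSq i y : ℂ)) y = starRingEnd ℂ (transVec i y j) := by
  have hd : ∀ m, DifferentiableAt ℝ (fun y : Fin n → ℂ => dir i y m) y := fun m =>
    ((differentiable_dir i m).restrictScalars ℝ).differentiableAt
  have hc : ∀ m, DifferentiableAt ℝ (fun y : Fin n → ℂ => starRingEnd ℂ (dir i y m)) y := fun m =>
    Complex.conjCLE.differentiableAt.comp y (hd m)
  simp only [dirNormSq_eq_sum]
  rw [dz_sum j _ fun m _ => (hd m).fun_mul (hc m)]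
  have : ∀ m, dz j (fun y => dir i y m * starRingEnd ℂ (dir i y m)) y
      = if m = j ∧ m ≠ i then starRingEnd ℂ (dir i y m) else 0 := by
    intro m
    rw [dz_mul j (hd m) (hc m), dz_conj j (hd m), dzbar_of_holomorphic j (differentiable_dir i m y),
      dz_dir]
    simp
  simp only [this]
  rw [Finset.sum_eq_single j (by aesop) (by simp)]
  by_cases h : j = i
  · simp [h, transVec]
  · simp [h, transVec, dir]

theorem dzbar_ofReal (j : Fin n) {u : (Fin n → ℂ) → ℝ} (hu : DifferentiableAt ℝ u y) :
    dzbar j (fun y => (u y : ℂ)) y = starRingEnd ℂ (dz j (fun y => (u y : ℂ)) y) := by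
  rw [← dzbar_conj j hu.ofReal_comp']
  simp

theorem dzbar_dirNormSq (i j : Fin n) :
    dzbar j (fun y => (dirNormSq i y : ℂ)) y = transVec i y j := by
  rw [dzbar_ofReal j ((contDiff_dirNormSq i).differentiable (by simp) y), dz_dirNormSq]
  simp

theorem complexHessian_dirNormSq (i j l : Fin n) :
    complexHessian (dirNormSq i) y j l = if l = j ∧ l ≠ i then 1 else 0 := by
  simp only [complexHessian, Matrix.of_apply]
  rw [show dzbar l (fun y => (dirNormSq i y : ℂ)) = fun y => transVec i y l from
    funext fun y => dzbar_dirNormSq i l]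
  exact dz_transVec i j l

theorem dz_normSq_apply (i j : Fin n) :
    dz j (fun y => ((‖y i‖ ^ 2 : ℝ) : ℂ)) y = if i = j then starRingEnd ℂ (y i) else 0 := by
  have hd : DifferentiableAt ℝ (fun y : Fin n → ℂ => y i) y := by fun_prop
  have hc : DifferentiableAt ℝ (fun y : Fin n → ℂ => starRingEnd ℂ (y i)) y :=
    Complex.conjCLE.differentiableAt.comp y hd
  have : (fun y : Fin n → ℂ => ((‖y i‖ ^ 2 : ℝ) : ℂ)) = fun y => y i * starRingEnd ℂ (y i) := by
    funext y
    simp [Complex.mul_conj']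
  rw [this, dz_mul j hd hc, dz_conj j hd, dzbar_apply, dz_apply]
  simp

theorem contDiff_normSq_apply (i : Fin n) :
    ContDiff ℝ (⊤ : ℕ∞) fun y : Fin n → ℂ => ‖y i‖ ^ 2 := (contDiff_apply ℝ ℂ i).norm_sq ℝ

theorem dzbar_normSq_apply (i j : Fin n) :
    dzbar j (fun y => ((‖y i‖ ^ 2 : ℝ) : ℂ)) y = if i = j then y i else 0 := by
  rw [dzbar_ofReal j ((contDiff_normSq_apply i).differentiable (by simp) y), dz_normSq_apply]
  split_ifs <;> simp

theorem complexHessian_normSq_apply (i j l : Fin n) :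
    complexHessian (fun y => ‖y i‖ ^ 2) y j l = if i = j ∧ i = l then 1 else 0 := by
  simp only [complexHessian, Matrix.of_apply]
  rw [show dzbar l (fun y => ((‖y i‖ ^ 2 : ℝ) : ℂ)) = fun y => if i = l then y i else 0 from
    funext fun y => dzbar_normSq_apply i l]
  by_cases h : i = l
  · simp [h, dz_apply]
  · simp [h, dz_const]

theorem deriv_const_mul_log (r x : ℝ) : deriv (fun x => r * Real.log x) x = r * x⁻¹ := by
  simp

theorem deriv_deriv_const_mul_log (r x : ℝ) :
    deriv (deriv fun x => r * Real.log x) x = -(r * (x ^ 2)⁻¹) := by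
  rw [show (deriv fun x => r * Real.log x) = fun x => r * x⁻¹ from funext (deriv_const_mul_log r)]
  simp

/-- Since log ‖y_i‖² is pluriharmonic off the divisor, the logarithmic pole of a potential
contributes nothing to the form there. -/
theorem complexHessian_log_normSq_apply (r : ℝ) {i : Fin n} (hy : y i ≠ 0) :
    complexHessian (fun y => r * Real.log (‖y i‖ ^ 2)) y = 0 := by
  have hy2 : ‖y i‖ ^ 2 ≠ 0 := by positivity
  ext j l
  rw [complexHessian_real_comp (f := fun x => r * Real.log x)
    (contDiffAt_const.mul (Real.contDiffAt_log.2 hy2))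
    ((contDiff_normSq_apply i).contDiffAt.of_le two_le_infty),
    deriv_const_mul_log, deriv_deriv_const_mul_log, complexHessian_normSq_apply, dz_normSq_apply,
    dzbar_normSq_apply]
  by_cases h : i = j
  · by_cases h' : i = l
    · have e : ((‖y i‖ ^ 2 : ℝ) : ℂ) = y i * starRingEnd ℂ (y i) := by simp [Complex.mul_conj']
      have hc : starRingEnd ℂ (y i) ≠ 0 := by simpa using hy
      simp only [← h, ← h', and_self, if_true, Complex.ofReal_mul, Complex.ofReal_neg,
        Complex.ofReal_inv, Complex.ofReal_pow (‖y i‖ ^ 2) 2, e, Matrix.zero_apply]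
      field_simp
      ring
    · simp [h']
  · simp [h]

/-- The coefficients of the Fubini–Study form of `ℙⁿ⁻¹`, pulled back to a chart. -/
def fubiniStudy (i : Fin n) (y : Fin n → ℂ) : Matrix (Fin n) (Fin n) ℂ :=
  Matrix.of fun j l => (if l = j ∧ l ≠ i then 1 else 0) / (dirNormSq i y : ℂ)
    - starRingEnd ℂ (transVec i y j) * transVec i y l / (dirNormSq i y : ℂ) ^ 2

theorem contDiff_const_mul_log_dirNormSq (r : ℝ) (i : Fin n) :
    ContDiff ℝ (⊤ : ℕ∞) fun y : Fin n → ℂ => r * Real.log (dirNormSq i y) :=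
  contDiff_const.mul ((contDiff_dirNormSq i).log fun y => (dirNormSq_pos i y).ne')

theorem complexHessian_log_dirNormSq (r : ℝ) (i : Fin n) :
    complexHessian (fun y => r * Real.log (dirNormSq i y)) y = (r : ℂ) • fubiniStudy i y := by
  have hN := (dirNormSq_pos i y).ne'
  ext j l
  rw [complexHessian_real_comp (f := fun x => r * Real.log x)
    (contDiffAt_const.mul (Real.contDiffAt_log.2 hN))
    ((contDiff_dirNormSq i).contDiffAt.of_le two_le_infty),
    deriv_const_mul_log, deriv_deriv_const_mul_log, complexHessian_dirNormSq, dz_dirNormSq,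
    dzbar_dirNormSq]
  simp only [fubiniStudy, Matrix.smul_apply, Matrix.of_apply, smul_eq_mul]
  push_cast
  ring

/-- `y_i ∂s`, smooth across the divisor. -/
def vertical (c : Chart n) (y : Fin n → ℂ) : Fin n → ℂ :=
  Function.update (fun j => y c.1 * starRingEnd ℂ (y j) / (dirNormSq c.1 y : ℂ)) c.1
    (c.2.eps : ℂ)

/-- `A` times the Fubini–Study form plus `κ` times the vertical form. -/
def calabiMatrix (c : Chart n) (y : Fin n → ℂ) (A κ : ℝ) : Matrix (Fin n) (Fin n) ℂ :=
  (A : ℂ) • fubiniStudy c.1 y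
    + (κ : ℂ) • Matrix.vecMulVec (vertical c y) (fun l => starRingEnd ℂ (vertical c y l))

theorem logNorm_param_of_ne_zero {c : Chart n} (hy : y c.1 ≠ 0) :
    logNorm (param c y) = c.2.eps * Real.log (‖y c.1‖ ^ 2) + 1 * Real.log (dirNormSq c.1 y) := by
  rw [logNorm_param, log_radius hy, mul_add, ← mul_assoc, c.2.eps_mul_eps]

theorem eventually_logNorm_param {c : Chart n} (hy : y c.1 ≠ 0) :
    (fun y => logNorm (param c y)) =ᶠ[𝓝 y]
      fun y => c.2.eps * Real.log (‖y c.1‖ ^ 2) + 1 * Real.log (dirNormSq c.1 y) := by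
  filter_upwards [(isOpen_apply_ne_zero c.1).mem_nhds hy] with y' hy'
    using logNorm_param_of_ne_zero hy'

theorem contDiffAt_const_mul_log_normSq_apply {m : WithTop ℕ∞} (r : ℝ) {i : Fin n} (hy : y i ≠ 0) :
    ContDiffAt ℝ m (fun y : Fin n → ℂ => r * Real.log (‖y i‖ ^ 2)) y := by
  have hy2 : ‖y i‖ ^ 2 ≠ 0 := by positivity
  exact contDiffAt_const.mul ((((contDiff_apply ℝ ℂ i).norm_sq ℝ).contDiffAt).log hy2)

theorem contDiffAt_logNorm_param {c : Chart n} (hy : y c.1 ≠ 0) :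
    ContDiffAt ℝ (⊤ : ℕ∞) (fun y => logNorm (param c y)) y :=
  ((contDiffAt_const_mul_log_normSq_apply _ hy).add
    (contDiff_const_mul_log_dirNormSq 1 c.1).contDiffAt).congr_of_eventuallyEq
    (eventually_logNorm_param hy)

theorem dz_logNorm_param {c : Chart n} (hy : y c.1 ≠ 0) (j : Fin n) :
    dz j (fun y => (logNorm (param c y) : ℂ)) y = vertical c y j / y c.1 := by
  have hy2 : ‖y c.1‖ ^ 2 ≠ 0 := by positivity
  have hN := (dirNormSq_pos c.1 y).ne'
  have hNC : (dirNormSq c.1 y : ℂ) ≠ 0 := by exact_mod_cast hN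
  have hev : (fun y => (logNorm (param c y) : ℂ)) =ᶠ[𝓝 y] _ :=
    (eventually_logNorm_param hy).fun_comp Complex.ofReal
  rw [dz_congr j hev, Function.comp_def]
  simp only [Complex.ofReal_add]
  rw [dz_add j
      ((contDiffAt_const_mul_log_normSq_apply (m := 1) _ hy).differentiableAt (by simp)).ofReal_comp'
      ((contDiff_const_mul_log_dirNormSq 1 c.1).differentiable (by simp) y).ofReal_comp',
    dz_real_comp j (f := fun x => c.2.eps * Real.log x)
      ((Real.hasDerivAt_log hy2).const_mul c.2.eps)
      ((contDiff_normSq_apply c.1).differentiable (by simp) y),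
    dz_real_comp j (f := fun x => 1 * Real.log x)
      ((Real.hasDerivAt_log hN).const_mul 1)
      ((contDiff_dirNormSq c.1).differentiable (by simp) y), dz_normSq_apply, dz_dirNormSq]
  have e : ((‖y c.1‖ ^ 2 : ℝ) : ℂ) = y c.1 * starRingEnd ℂ (y c.1) := by simp [Complex.mul_conj']
  have hc : starRingEnd ℂ (y c.1) ≠ 0 := by simpa using hy
  rw [Complex.ofReal_mul, Complex.ofReal_inv, e, Complex.ofReal_mul, Complex.ofReal_inv]
  by_cases h : c.1 = j
  · subst h
    simp [vertical, transVec]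
    field_simp
  · simp [vertical, transVec, h, Ne.symm h]
    field_simp

theorem dzbar_logNorm_param {c : Chart n} (hy : y c.1 ≠ 0) (j : Fin n) :
    dzbar j (fun y => (logNorm (param c y) : ℂ)) y
      = starRingEnd ℂ (vertical c y j) / starRingEnd ℂ (y c.1) := by
  rw [dzbar_ofReal j ((contDiffAt_logNorm_param hy).differentiableAt (by simp)),
    dz_logNorm_param hy, map_div₀]

theorem complexHessian_logNorm_param {c : Chart n} (hy : y c.1 ≠ 0) :
    complexHessian (fun y => logNorm (param c y)) y = fubiniStudy c.1 y := by
  rw [complexHessian_congr (eventually_logNorm_param hy),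
    complexHessian_add (contDiffAt_const_mul_log_normSq_apply _ hy)
      ((contDiff_const_mul_log_dirNormSq 1 c.1).contDiffAt.of_le two_le_infty),
    complexHessian_log_normSq_apply _ hy, complexHessian_log_dirNormSq]
  simp

/-- Here ∂∂̄s is the Fubini–Study form and ∂s is `vertical` divided by y_i. Moving the factor
‖y_i‖⁻² from ∂s ∧ ∂̄s to f'' leaves two factors that both extend across the divisor. -/
theorem complexHessian_profile {f : ℝ → ℝ} (hf : ContDiff ℝ (⊤ : ℕ∞) f) {c : Chart n}
    (hy : y c.1 ≠ 0) :
    complexHessian (fun y => f (logNorm (param c y))) y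
      = calabiMatrix c y (deriv f (logNorm (param c y)))
        (deriv (deriv f) (logNorm (param c y)) / ‖y c.1‖ ^ 2) := by
  ext j l
  rw [complexHessian_real_comp (hf.contDiffAt.of_le two_le_infty)
    ((contDiffAt_logNorm_param hy).of_le two_le_infty),
    complexHessian_logNorm_param hy, dz_logNorm_param hy, dzbar_logNorm_param hy]
  have hc : starRingEnd ℂ (y c.1) ≠ 0 := by simpa using hy
  have e : ((‖y c.1‖ ^ 2 : ℝ) : ℂ) = y c.1 * starRingEnd ℂ (y c.1) := by simp [Complex.mul_conj']
  simp only [calabiMatrix, Matrix.add_apply, Matrix.smul_apply, smul_eq_mul, Matrix.vecMulVec_apply,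
    Complex.ofReal_div, e]
  field_simp

end HessianOfProfile

/-! ### Continuity and positivity of the Calabi matrices. -/

section CalabiMatrix

open scoped Matrix

variable {n : ℕ}

theorem dirNormSq_eq_one_add (i : Fin n) (y : Fin n → ℂ) :
    dirNormSq i y = 1 + ∑ m, ‖transVec i y m‖ ^ 2 := by
  have h1 := Finset.add_sum_erase Finset.univ (fun m => ‖dir i y m‖ ^ 2) (Finset.mem_univ i)
  have h2 := Finset.add_sum_erase Finset.univ (fun m => ‖transVec i y m‖ ^ 2) (Finset.mem_univ i)
  rw [dirNormSq, ← h1, ← h2]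
  have : ∀ m ∈ Finset.univ.erase i, ‖dir i y m‖ ^ 2 = ‖transVec i y m‖ ^ 2 := by
    intro m hm
    simp [dir, transVec, (Finset.mem_erase.1 hm).1]
  rw [Finset.sum_congr rfl this]
  simp [dir, transVec]

theorem continuous_fubiniStudy (i : Fin n) : Continuous (fubiniStudy (n := n) i) := by
  refine continuous_matrix fun j l => ?_
  have hN : Continuous fun y : Fin n → ℂ => (dirNormSq i y : ℂ) :=
    Complex.continuous_ofReal.comp (contDiff_dirNormSq i).continuous
  have h0 : ∀ y : Fin n → ℂ, (dirNormSq i y : ℂ) ≠ 0 := fun y => by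
    exact_mod_cast (dirNormSq_pos i y).ne'
  have hz : ∀ m, Continuous fun y : Fin n → ℂ => transVec i y m := fun m =>
    (continuous_apply m).comp (continuous_id.update i continuous_const)
  simp only [fubiniStudy, Matrix.of_apply]
  exact (continuous_const.div hN h0).sub
    (((Complex.continuous_conj.comp (hz j)).mul (hz l)).div (hN.pow 2) fun y => pow_ne_zero 2 (h0 y))

theorem continuous_vertical (c : Chart n) (j : Fin n) : Continuous fun y => vertical c y j := by
  have hN : Continuous fun y : Fin n → ℂ => (dirNormSq c.1 y : ℂ) :=
    Complex.continuous_ofReal.comp (contDiff_dirNormSq c.1).continuous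
  have h0 : ∀ y : Fin n → ℂ, (dirNormSq c.1 y : ℂ) ≠ 0 := fun y => by
    exact_mod_cast (dirNormSq_pos c.1 y).ne'
  by_cases h : j = c.1
  · simpa [vertical, h] using continuous_const
  · simp only [vertical, Function.update_of_ne h]
    exact ((continuous_apply _).mul (Complex.continuous_conj.comp (continuous_apply j))).div hN h0

theorem continuous_calabiMatrix (c : Chart n) {A κ : (Fin n → ℂ) → ℝ} (hA : Continuous A)
    (hκ : Continuous κ) : Continuous fun y => calabiMatrix c y (A y) (κ y) := by
  unfold calabiMatrix
  refine ((Complex.continuous_ofReal.comp hA).smul (continuous_fubiniStudy c.1)).add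
    ((Complex.continuous_ofReal.comp hκ).smul ?_)
  refine continuous_matrix fun j l => ?_
  simp only [Matrix.vecMulVec_apply]
  exact (continuous_vertical c j).mul (Complex.continuous_conj.comp (continuous_vertical c l))

theorem isHermitian_calabiMatrix (c : Chart n) (y : Fin n → ℂ) (A κ : ℝ) :
    (calabiMatrix c y A κ).IsHermitian := by
  refine Matrix.IsHermitian.ext fun j l => ?_
  simp only [calabiMatrix, fubiniStudy, Matrix.add_apply, Matrix.smul_apply, Matrix.of_apply,
    Matrix.vecMulVec_apply, smul_eq_mul, RCLike.star_def, map_add, map_mul, map_sub, map_div₀,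
    Complex.conj_ofReal, map_pow, Complex.conj_conj]
  have : starRingEnd ℂ (if j = l ∧ j ≠ c.1 then 1 else 0) = if l = j ∧ l ≠ c.1 then 1 else 0 := by
    by_cases h : j = l
    · subst h; split_ifs <;> simp
    · simp [h, Ne.symm h]
  rw [this]
  ring

theorem star_dotProduct_calabiMatrix_mulVec (c : Chart n) (y x : Fin n → ℂ) (A κ : ℝ) :
    star x ⬝ᵥ calabiMatrix c y A κ *ᵥ x
      = ((A * ((∑ j, ‖transVec c.1 x j‖ ^ 2) / dirNormSq c.1 y
          - ‖∑ l, transVec c.1 y l * x l‖ ^ 2 / dirNormSq c.1 y ^ 2)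
        + κ * ‖∑ l, starRingEnd ℂ (vertical c y l) * x l‖ ^ 2 : ℝ) : ℂ) := by
  have e1 : star x ⬝ᵥ fubiniStudy c.1 y *ᵥ x
      = (∑ j, (‖transVec c.1 x j‖ ^ 2 : ℂ)) / dirNormSq c.1 y
        - (‖∑ l, transVec c.1 y l * x l‖ ^ 2 : ℂ) / (dirNormSq c.1 y : ℂ) ^ 2 := by
    have h1 : (‖∑ l, transVec c.1 y l * x l‖ ^ 2 : ℂ)
        = ∑ j, ∑ l, starRingEnd ℂ (x j) * (starRingEnd ℂ (transVec c.1 y j) * transVec c.1 y l)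
          * x l := by
      rw [← Complex.conj_mul', map_sum, Finset.sum_mul_sum]
      refine Finset.sum_congr rfl fun j _ => Finset.sum_congr rfl fun l _ => ?_
      rw [map_mul]
      ring
    have h2 : ∑ j, (‖transVec c.1 x j‖ ^ 2 : ℂ)
        = ∑ j, ∑ l, starRingEnd ℂ (x j) * (if l = j ∧ l ≠ c.1 then 1 else 0) * x l := by
      refine Finset.sum_congr rfl fun j _ => ?_
      rw [Finset.sum_eq_single j (by aesop) (by simp)]
      by_cases h : j = c.1
      · simp [h, transVec]
      · simp [h, transVec, Complex.conj_mul']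
    rw [h1, h2, Finset.sum_div, Finset.sum_div, ← Finset.sum_sub_distrib]
    simp only [dotProduct, Matrix.mulVec, Finset.mul_sum, Finset.sum_div, ← Finset.sum_sub_distrib]
    refine Finset.sum_congr rfl fun j _ => Finset.sum_congr rfl fun l _ => ?_
    simp only [fubiniStudy, Matrix.of_apply, Pi.star_apply, RCLike.star_def]
    ring
  have e2 : star x ⬝ᵥ Matrix.vecMulVec (vertical c y) (fun l => starRingEnd ℂ (vertical c y l)) *ᵥ x
      = (‖∑ l, starRingEnd ℂ (vertical c y l) * x l‖ ^ 2 : ℂ) := by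
    rw [← Complex.conj_mul', map_sum, Finset.sum_mul_sum]
    simp only [dotProduct, Matrix.mulVec, Finset.mul_sum, Matrix.vecMulVec_apply]
    refine Finset.sum_congr rfl fun j _ => Finset.sum_congr rfl fun l _ => ?_
    simp only [Pi.star_apply, RCLike.star_def, map_mul, Complex.conj_conj]
    ring
  rw [calabiMatrix, Matrix.add_mulVec, dotProduct_add, Matrix.smul_mulVec, Matrix.smul_mulVec,
    dotProduct_smul, dotProduct_smul, e1, e2]
  push_cast
  simp only [smul_eq_mul]

/-- By Cauchy–Schwarz the Fubini–Study part is at least P / N², with P the squared norm of the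
components of x transverse to the fibre. If P = 0, only the fibre component is left, and the
vertical form detects it with coefficient ε = ±1. -/
theorem posDef_calabiMatrix (c : Chart n) (y : Fin n → ℂ) {A κ : ℝ} (hA : 0 < A) (hκ : 0 < κ) :
    (calabiMatrix c y A κ).PosDef := by
  refine Matrix.PosDef.of_dotProduct_mulVec_pos (isHermitian_calabiMatrix c y A κ) fun x hx => ?_
  rw [star_dotProduct_calabiMatrix_mulVec]
  rw [← Complex.ofReal_zero, Complex.real_lt_real]
  set P := ∑ j, ‖transVec c.1 x j‖ ^ 2 with hP
  set N := dirNormSq c.1 y with hN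
  have hN0 : 0 < N := dirNormSq_pos c.1 y
  have hP0 : 0 ≤ P := Finset.sum_nonneg fun j _ => by positivity
  have hq : ‖∑ l, transVec c.1 y l * x l‖ ^ 2 ≤ (N - 1) * P := by
    have h1 : ∑ l, transVec c.1 y l * x l = ∑ l, transVec c.1 y l * transVec c.1 x l := by
      refine Finset.sum_congr rfl fun l _ => ?_
      by_cases h : l = c.1
      · simp [h, transVec]
      · simp [h, transVec]
    have h2 : ‖∑ l, transVec c.1 y l * transVec c.1 x l‖
        ≤ ∑ l, ‖transVec c.1 y l‖ * ‖transVec c.1 x l‖ := by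
      refine (norm_sum_le _ _).trans (le_of_eq ?_)
      simp
    rw [h1]
    refine (pow_le_pow_left₀ (norm_nonneg _) h2 2).trans ?_
    refine (Finset.sum_mul_sq_le_sq_mul_sq _ _ _).trans (le_of_eq ?_)
    rw [hN, dirNormSq_eq_one_add]
    ring
  have hFS : P / N ^ 2 ≤ P / N - ‖∑ l, transVec c.1 y l * x l‖ ^ 2 / N ^ 2 := by
    have : P / N = N * P / N ^ 2 := by field_simp
    rw [this, ← sub_div]
    gcongr
    linarith
  rcases hP0.eq_or_lt with h0 | h0
  · have hx0 : ∀ j, j ≠ c.1 → x j = 0 := by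
      intro j hj
      have := (Finset.sum_eq_zero_iff_of_nonneg (fun j _ => by positivity)).1 h0.symm j
        (Finset.mem_univ j)
      simpa [transVec, hj] using this
    have hxi : x c.1 ≠ 0 := by
      intro h
      refine hx (funext fun j => ?_)
      by_cases hj : j = c.1
      · rw [hj, h]; rfl
      · exact hx0 j hj
    have hw : ∑ l, starRingEnd ℂ (vertical c y l) * x l = c.2.eps * x c.1 := by
      rw [Finset.sum_eq_single c.1 (fun j _ hj => by rw [hx0 j hj, mul_zero]) (by simp)]
      simp [vertical]
    have he : (c.2.eps : ℂ) ≠ 0 := by exact_mod_cast c.2.eps_ne_zero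
    have h1 : 0 < κ * ‖∑ l, starRingEnd ℂ (vertical c y l) * x l‖ ^ 2 := by
      have hne : (c.2.eps : ℂ) * x c.1 ≠ 0 := mul_ne_zero he hxi
      rw [hw]
      positivity
    have h2 : 0 ≤ A * (P / N - ‖∑ l, transVec c.1 y l * x l‖ ^ 2 / N ^ 2) :=
      mul_nonneg hA.le (le_trans (by positivity) hFS)
    linarith
  · have h1 : 0 < A * (P / N - ‖∑ l, transVec c.1 y l * x l‖ ^ 2 / N ^ 2) :=
      mul_pos hA (lt_of_lt_of_le (by positivity) hFS)
    have h2 : 0 ≤ κ * ‖∑ l, starRingEnd ℂ (vertical c y l) * x l‖ ^ 2 := by positivity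
    linarith

end CalabiMatrix

/-! ### The global Kähler form of a profile. -/

section CalabiForm

variable {n : ℕ} {f : ℝ → ℝ} {α β : ℝ}

/-- Coefficient matrices with a common potential off the divisors transform as a (1,1)-form. -/
theorem compat_of_potential {H : Chart n → (Fin n → ℂ) → Matrix (Fin n) (Fin n) ℂ} {u : X n → ℝ}
    (hH : ∀ c, Continuous (H c))
    (hu : ∀ c y, y c.1 ≠ 0 → ContDiffAt ℝ 2 (fun y => u (param c y)) y)
    (hHu : ∀ c y, y c.1 ≠ 0 → H c y = complexHessian (fun y => u (param c y)) y)
    (c d : Chart n) (y y' : Fin n → ℂ) (h : param c y = param d y') :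
    H c y = (jacobian c d y).transpose * H d y' * (jacobian c d y).map (starRingEnd ℂ) := by
  have hy := mem_overlap_of_param_eq h
  have hΦy : coord d (param c y) = y' := by rw [h, coord_param]
  have hΦ := contDiffAt_coord_param (m := 2) hy
  have hJ : ContinuousAt (jacobian c d) y := by
    have h1 : ContinuousAt (fderiv ℂ fun y => coord d (param c y)) y :=
      (hΦ.fderiv_right (m := 1) (by norm_num)).continuousAt
    refine continuousAt_pi.2 fun m => continuousAt_pi.2 fun j => ?_
    exact (continuousAt_pi.1 (h1.clm_apply continuousAt_const) m)
  have hJb : ContinuousAt (fun y => (jacobian c d y).map (starRingEnd ℂ)) y :=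
    (Continuous.matrix_map continuous_id Complex.continuous_conj).continuousAt.comp hJ
  have hJt : ContinuousAt (fun y => (jacobian c d y).transpose) y :=
    (Continuous.matrix_transpose continuous_id).continuousAt.comp hJ
  have hHd : ContinuousAt (fun y => H d (coord d (param c y))) y :=
    (hH d).continuousAt.comp hΦ.continuousAt
  rw [← hΦy]
  -- Both sides are continuous at `y`, so it suffices to compare them off the divisor, where they
  -- are Hessians of the same function in two holomorphic coordinate systems.
  refine eq_at_of_eq_off_divisor c.1 (F := H c)
    (G := fun y => (jacobian c d y).transpose * H d (coord d (param c y))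
      * (jacobian c d y).map (starRingEnd ℂ)) (hH c).continuousAt ((hJt.mul hHd).mul hJb) ?_
  filter_upwards [(isOpen_overlap c d).mem_nhds hy] with z hz hz0
  have hz1 : coord d (param c z) d.1 ≠ 0 := by
    rw [Ne, ← param_mem_divisors_iff, param_coord_param hz, param_mem_divisors_iff]
    exact hz0
  have hev : (fun y => u (param c y)) =ᶠ[𝓝 z] fun y => u (param d (coord d (param c y))) := by
    filter_upwards [(isOpen_overlap c d).mem_nhds hz] with x hx
    rw [param_coord_param hx]
  rw [hHu c z hz0, hHu d _ hz1, complexHessian_congr hev]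
  exact complexHessian_comp_holomorphic (u := fun y => u (param d y))
    (Φ := fun y => coord d (param c y)) (hu d _ hz1) (contDiffAt_coord_param hz)

theorem Form.hasPotential_iff {η : Form n} {u : X n → ℝ} : η.HasPotential u ↔
    ∀ c y, y c.1 ≠ 0 → η.coeff c y = complexHessian (fun y' => u (param c y')) y := by
  simp only [Form.HasPotential, param_mem_divisors_iff, ne_eq]

theorem Form.continuous_coeff (η : Form n) (c : Chart n) : Continuous (η.coeff c) :=
  continuous_matrix fun j l => (η.smooth c j l).continuous

/-- A form is determined by its potential off the divisors. -/
theorem Form.coeff_eq_of_hasPotential {η η' : Form n} {u : X n → ℝ} (h : η.HasPotential u)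
    (h' : η'.HasPotential u) (c : Chart n) : η.coeff c = η'.coeff c :=
  eq_of_eq_off_divisor c.1 (η.continuous_coeff c) (η'.continuous_coeff c) fun y hy => by
    rw [Form.hasPotential_iff.1 h c y hy, Form.hasPotential_iff.1 h' c y hy]

/-- The smooth extension of a profile along the divisor of a side. -/
def IsProfile.ext (hf : IsProfile f α β) (s : Side) : ℝ → ℝ := (hf.exists_isEnd s).choose

theorem IsProfile.isEnd_ext (hf : IsProfile f α β) (s : Side) :
    IsEnd f s (s.endVal α β) (hf.ext s) := (hf.exists_isEnd s).choose_spec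

/-- `f'` in a chart. -/
def IsProfile.momentum (hf : IsProfile f α β) (c : Chart n) (y : Fin n → ℂ) : ℝ :=
  endMomentum c.2 (c.2.endVal α β) (hf.ext c.2) (radius c y)

/-- `f'' / ‖y_i‖²` in a chart. -/
def IsProfile.density (hf : IsProfile f α β) (c : Chart n) (y : Fin n → ℂ) : ℝ :=
  dirNormSq c.1 y ^ c.2.eps * endDensity (hf.ext c.2) (radius c y)

/-- The Kähler potential in a chart. -/
def IsProfile.localPotential (hf : IsProfile f α β) (c : Chart n) (y : Fin n → ℂ) : ℝ :=
  c.2.endVal α β * Real.log (dirNormSq c.1 y) + hf.ext c.2 (radius c y)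

theorem contDiff_comp_radius {F : ℝ → ℝ} (hF : ContDiffOn ℝ (⊤ : ℕ∞) F (Set.Ici 0)) (c : Chart n) :
    ContDiff ℝ (⊤ : ℕ∞) fun y => F (radius c y) :=
  hF.comp_contDiff (contDiff_radius c) fun y => radius_nonneg c y

theorem IsProfile.contDiff_momentum (hf : IsProfile f α β) (c : Chart n) :
    ContDiff ℝ (⊤ : ℕ∞) (hf.momentum c) :=
  contDiff_comp_radius (contDiffOn_endMomentum _ (hf.isEnd_ext c.2).smooth) c

theorem IsProfile.continuous_density (hf : IsProfile f α β) (c : Chart n) :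
    Continuous (hf.density c) :=
  ((contDiff_dirNormSq c.1).continuous.rpow_const fun y => Or.inl (dirNormSq_pos c.1 y).ne').mul
    (contDiff_comp_radius (contDiffOn_endDensity (hf.isEnd_ext c.2).smooth) c).continuous

theorem IsProfile.contDiff_localPotential (hf : IsProfile f α β) (c : Chart n) :
    ContDiff ℝ (⊤ : ℕ∞) (hf.localPotential c) :=
  (contDiff_const_mul_log_dirNormSq _ c.1).add (contDiff_comp_radius (hf.isEnd_ext c.2).smooth c)

theorem IsProfile.momentum_eq (hf : IsProfile f α β) {c : Chart n} {y : Fin n → ℂ}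
    (hy : y c.1 ≠ 0) : hf.momentum c y = deriv f (logNorm (param c y)) := by
  rw [logNorm_param]
  exact (hf.isEnd_ext c.2).endMomentum_eq (hf.smooth.differentiable (by simp)) (radius_pos hy)

theorem IsProfile.density_eq (hf : IsProfile f α β) {c : Chart n} {y : Fin n → ℂ}
    (hy : y c.1 ≠ 0) :
    hf.density c y = deriv (deriv f) (logNorm (param c y)) / ‖y c.1‖ ^ 2 := by
  rw [logNorm_param, ← (hf.isEnd_ext c.2).endDensity_eq hf.smooth (radius_pos hy), radius_eq,
    IsProfile.density, radius_eq]
  have : ‖y c.1‖ ≠ 0 := by positivity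
  field_simp

theorem IsProfile.momentum_pos (hf : IsProfile f α β) (hα : 0 < α) (hβ : 0 < β) (c : Chart n)
    (y : Fin n → ℂ) : 0 < hf.momentum c y :=
  hf.endMomentum_pos hα hβ (hf.isEnd_ext c.2) (radius_nonneg c y)

theorem IsProfile.density_pos (hf : IsProfile f α β) (c : Chart n) (y : Fin n → ℂ) :
    0 < hf.density c y :=
  mul_pos (Real.rpow_pos_of_pos (dirNormSq_pos c.1 y) _)
    (hf.endDensity_pos (hf.isEnd_ext c.2) (radius_nonneg c y))

/-- This isolates the logarithmic pole of f(s): the remainder is smooth on the whole chart. It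
yields both the extension of the form and its class. -/
theorem IsProfile.apply_logNorm (hf : IsProfile f α β) {c : Chart n} {y : Fin n → ℂ}
    (hy : y c.1 ≠ 0) :
    f (logNorm (param c y))
      = c.2.eps * c.2.endVal α β * Real.log (‖y c.1‖ ^ 2) + hf.localPotential c y := by
  have h := (hf.isEnd_ext c.2).eq _ (radius_pos hy)
  rw [← logNorm_param, log_radius hy] at h
  rw [IsProfile.localPotential, h]
  linear_combination (c.2.endVal α β * Real.log (dirNormSq c.1 y)) * c.2.eps_mul_eps

theorem IsProfile.complexHessian_localPotential_of_ne (hf : IsProfile f α β) {c : Chart n}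
    {y : Fin n → ℂ} (hy : y c.1 ≠ 0) :
    complexHessian (hf.localPotential c) y
      = complexHessian (fun y => f (logNorm (param c y))) y := by
  have hev : (fun y => f (logNorm (param c y))) =ᶠ[𝓝 y] fun y =>
      c.2.eps * c.2.endVal α β * Real.log (‖y c.1‖ ^ 2) + hf.localPotential c y := by
    filter_upwards [(isOpen_apply_ne_zero c.1).mem_nhds hy] with z hz using hf.apply_logNorm hz
  rw [complexHessian_congr hev, complexHessian_add (contDiffAt_const_mul_log_normSq_apply _ hy)
    ((hf.contDiff_localPotential c).contDiffAt.of_le two_le_infty),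
    complexHessian_log_normSq_apply _ hy, zero_add]

/-- Off the divisor the local potential differs from f(s) by a pluriharmonic term; continuity of
both sides gives the formula on the divisor as well. -/
theorem IsProfile.complexHessian_localPotential (hf : IsProfile f α β) (c : Chart n)
    (y : Fin n → ℂ) : complexHessian (hf.localPotential c) y
      = calabiMatrix c y (hf.momentum c y) (hf.density c y) := by
  refine congrFun (eq_of_eq_off_divisor c.1
    (continuous_matrix fun j l =>
      (contDiff_complexHessian (hf.contDiff_localPotential c) j l).continuous)
    (continuous_calabiMatrix c (hf.contDiff_momentum c).continuous (hf.continuous_density c))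
    fun y hy => ?_) y
  rw [hf.complexHessian_localPotential_of_ne hy, complexHessian_profile hf.smooth hy,
    hf.momentum_eq hy, hf.density_eq hy]

/-- The form `(√-1 / 2π) ∂∂̄ f(s)` on `X_n`. -/
def IsProfile.form (hf : IsProfile f α β) (n : ℕ) : Form n where
  coeff c := complexHessian (hf.localPotential c)
  smooth c j l := contDiff_complexHessian (hf.contDiff_localPotential c) j l
  hermitian c y := by
    rw [hf.complexHessian_localPotential]
    exact isHermitian_calabiMatrix c y _ _
  compat := compat_of_potential (u := fun p => f (logNorm p))
    (fun c => continuous_matrix fun j l =>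
      (contDiff_complexHessian (hf.contDiff_localPotential c) j l).continuous)
    (fun _ _ hy => (hf.smooth.contDiffAt.comp _ (contDiffAt_logNorm_param hy)).of_le two_le_infty)
    fun _ _ hy => hf.complexHessian_localPotential_of_ne hy

theorem IsProfile.form_coeff (hf : IsProfile f α β) (c : Chart n) (y : Fin n → ℂ) :
    (hf.form n).coeff c y = calabiMatrix c y (hf.momentum c y) (hf.density c y) :=
  hf.complexHessian_localPotential c y

theorem IsProfile.form_hasPotential (hf : IsProfile f α β) :
    (hf.form n).HasPotential fun p => f (logNorm p) :=
  Form.hasPotential_iff.2 fun _ _ hy => hf.complexHessian_localPotential_of_ne hy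

theorem IsProfile.form_isKahler (hf : IsProfile f α β) (hα : 0 < α) (hβ : 0 < β) :
    (hf.form n).IsKahler := by
  refine ⟨fun c y => ?_, fun c y j l m => ?_⟩
  · rw [hf.form_coeff]
    exact posDef_calabiMatrix c y (hf.momentum_pos hα hβ c y) (hf.density_pos c y)
  · refine dz_comm m j ?_
    exact (ContDiffAt.dzbar (m := ⊤) l
      (hf.contDiff_localPotential c).contDiffAt.ofReal_comp).of_le two_le_infty

theorem IsProfile.form_inClass (hf : IsProfile f α β) : (hf.form n).InClass β α := by
  refine ⟨fun p => f (logNorm p), hf.form_hasPotential, fun i => ⟨?_, ?_⟩⟩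
  · refine ⟨hf.localPotential (i, Side.zero), hf.contDiff_localPotential _, fun y hy => ?_⟩
    simpa [Side.eps, Side.endVal] using hf.apply_logNorm (c := (i, Side.zero)) hy
  · refine ⟨hf.localPotential (i, Side.infinity), hf.contDiff_localPotential _, fun y hy => ?_⟩
    simpa [Side.eps, Side.endVal] using hf.apply_logNorm (c := (i, Side.infinity)) hy

theorem IsProfile.isCalabiMetric_form (hf : IsProfile f α β) (hα : 0 < α) (hβ : 0 < β) :
    IsCalabiMetric (hf.form n) f β α :=
  ⟨hf, hf.form_hasPotential, hf.form_isKahler hα hβ, hf.form_inClass⟩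

end CalabiForm

/-! ### Simultaneous diagonalization, determinant and trace. -/

section Determinant

open scoped Matrix

variable {n : ℕ}

/-- The unit matrix with the column of the fibre coordinate replaced by `vertical c y`. -/
def shear (c : Chart n) (y : Fin n → ℂ) : Matrix (Fin n) (Fin n) ℂ :=
  Matrix.updateCol 1 c.1 (vertical c y)

/-- The common rank one perturbation of the identity in all Calabi matrices. -/
def baseFactor (i : Fin n) (y : Fin n → ℂ) : Matrix (Fin n) (Fin n) ℂ :=
  1 + Matrix.vecMulVec (fun j => -(starRingEnd ℂ (transVec i y j) / (dirNormSq i y : ℂ)))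
    (transVec i y)

/-- The diagonal entries of a Calabi matrix in an adapted frame. -/
def diagEntry (i : Fin n) (y : Fin n → ℂ) (A κ : ℝ) (j : Fin n) : ℂ :=
  if j = i then (κ : ℂ) else (A : ℂ) / (dirNormSq i y : ℂ)

/-- All dependence on A and κ is in the diagonal factor; this is what makes two Calabi matrices
comparable. -/
theorem diagonal_mul_baseFactor (i : Fin n) (y : Fin n → ℂ) (A κ : ℝ) :
    Matrix.diagonal (diagEntry i y A κ) * baseFactor i y
      = (A : ℂ) • fubiniStudy i y + Matrix.single i i (κ : ℂ) := by
  have h0 : (dirNormSq i y : ℂ) ≠ 0 := by exact_mod_cast (dirNormSq_pos i y).ne'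
  ext j l
  simp only [Matrix.diagonal_mul, baseFactor, Matrix.add_apply, Matrix.vecMulVec_apply,
    Matrix.smul_apply, fubiniStudy, Matrix.of_apply, smul_eq_mul, diagEntry, Matrix.single_apply,
    Matrix.one_apply]
  by_cases hj : j = i
  · subst hj
    by_cases hl : j = l
    · subst hl
      simp [transVec]
    · simp [transVec, hl, Ne.symm hl]
  · by_cases hl : j = l
    · subst hl
      simp only [hj, Ne.symm hj, if_true, if_false, not_false_eq_true, ne_eq, and_self]
      field_simp
      ring
    · simp only [hj, Ne.symm hj, hl, Ne.symm hl, if_false, false_and]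
      field_simp
      ring

theorem shear_apply_of_ne (c : Chart n) (y : Fin n → ℂ) (j : Fin n) {m : Fin n} (hm : m ≠ c.1) :
    shear c y j m = if j = m then 1 else 0 := by
  simp [shear, hm, Matrix.one_apply]

theorem shear_apply_self (c : Chart n) (y : Fin n → ℂ) (j : Fin n) :
    shear c y j c.1 = vertical c y j := by
  simp [shear]

theorem fubiniStudy_left (i : Fin n) (y : Fin n → ℂ) (l : Fin n) : fubiniStudy i y i l = 0 := by
  by_cases h : l = i <;> simp [fubiniStudy, transVec, h]

theorem fubiniStudy_right (i : Fin n) (y : Fin n → ℂ) (j : Fin n) : fubiniStudy i y j i = 0 := by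
  simp [fubiniStudy, transVec]

/-- The shear differs from the identity only in the fibre column, which meets the zero row of the
Fubini–Study matrix. -/
theorem shear_mul_fubiniStudy (c : Chart n) (y : Fin n → ℂ) :
    shear c y * fubiniStudy c.1 y = fubiniStudy c.1 y := by
  ext j l
  rw [Matrix.mul_apply]
  have : ∀ m, shear c y j m * fubiniStudy c.1 y m l
      = (if j = m then 1 else 0) * fubiniStudy c.1 y m l := by
    intro m
    by_cases hm : m = c.1
    · rw [hm, fubiniStudy_left, mul_zero, mul_zero]
    · rw [shear_apply_of_ne c y j hm]
  simp [this]

theorem fubiniStudy_mul_shear (c : Chart n) (y : Fin n → ℂ) :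
    fubiniStudy c.1 y * (shear c y)ᴴ = fubiniStudy c.1 y := by
  ext j l
  rw [Matrix.mul_apply]
  have : ∀ m, fubiniStudy c.1 y j m * (shear c y)ᴴ m l
      = fubiniStudy c.1 y j m * (if l = m then 1 else 0) := by
    intro m
    by_cases hm : m = c.1
    · rw [hm, fubiniStudy_right, zero_mul, zero_mul]
    · rw [Matrix.conjTranspose_apply, shear_apply_of_ne c y l hm]
      split_ifs <;> simp
  rw [Finset.sum_congr rfl fun m _ => this m]
  simp

theorem shear_mul_single_mul_shear (c : Chart n) (y : Fin n → ℂ) (κ : ℂ) :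
    shear c y * Matrix.single c.1 c.1 κ * (shear c y)ᴴ
      = κ • Matrix.vecMulVec (vertical c y) (fun l => starRingEnd ℂ (vertical c y l)) := by
  ext j l
  rw [Matrix.mul_apply, Finset.sum_eq_single c.1 (fun m _ hm => by
    rw [Matrix.mul_single_apply_of_ne _ _ _ _ _ hm, zero_mul]) (by simp)]
  simp only [Matrix.mul_single_apply_same, shear_apply_self, Matrix.conjTranspose_apply,
    Matrix.smul_apply, Matrix.vecMulVec_apply, smul_eq_mul, RCLike.star_def]
  ring

/-- All Calabi matrices at a point are diagonal up to the same factors on both sides. -/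
theorem calabiMatrix_eq_mul (c : Chart n) (y : Fin n → ℂ) (A κ : ℝ) :
    calabiMatrix c y A κ = shear c y * Matrix.diagonal (diagEntry c.1 y A κ)
      * (baseFactor c.1 y * (shear c y)ᴴ) := by
  rw [Matrix.mul_assoc, ← Matrix.mul_assoc (Matrix.diagonal _), diagonal_mul_baseFactor,
    ← Matrix.mul_assoc, Matrix.mul_add, Matrix.add_mul, shear_mul_single_mul_shear,
    Matrix.mul_smul, Matrix.smul_mul, shear_mul_fubiniStudy, fubiniStudy_mul_shear, calabiMatrix]

theorem det_shear (c : Chart n) (y : Fin n → ℂ) : (shear c y).det = c.2.eps := by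
  rw [shear, ← Matrix.cramer_apply, Matrix.cramer_one]
  simp [vertical]

theorem det_baseFactor (i : Fin n) (y : Fin n → ℂ) :
    (baseFactor i y).det = (dirNormSq i y : ℂ)⁻¹ := by
  have h0 : (dirNormSq i y : ℂ) ≠ 0 := by exact_mod_cast (dirNormSq_pos i y).ne'
  rw [baseFactor, Matrix.vecMulVec_eq Unit, Matrix.det_one_add_replicateCol_mul_replicateRow]
  have h1 : (dirNormSq i y : ℂ) - 1 = ∑ m, (‖transVec i y m‖ : ℂ) ^ 2 := by
    rw [dirNormSq_eq_one_add]
    push_cast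
    ring
  have h2 : transVec i y ⬝ᵥ (fun j => -(starRingEnd ℂ (transVec i y j) / (dirNormSq i y : ℂ)))
      = -(((dirNormSq i y : ℂ) - 1) / dirNormSq i y) := by
    rw [h1, Finset.sum_div, ← Finset.sum_neg_distrib]
    refine Finset.sum_congr rfl fun j _ => ?_
    rw [← Complex.mul_conj']
    ring
  rw [h2]
  field_simp
  ring

theorem det_calabiMatrix (c : Chart n) (y : Fin n → ℂ) (A κ : ℝ) :
    (calabiMatrix c y A κ).det = ((A ^ (n - 1) * κ / dirNormSq c.1 y ^ n : ℝ) : ℂ) := by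
  have h0 : (dirNormSq c.1 y : ℂ) ≠ 0 := by exact_mod_cast (dirNormSq_pos c.1 y).ne'
  have h1 : ∏ j, diagEntry c.1 y A κ j = κ * ((A : ℂ) / dirNormSq c.1 y) ^ (n - 1) := by
    rw [← Finset.mul_prod_erase _ _ (Finset.mem_univ c.1)]
    have : ∀ j ∈ Finset.univ.erase c.1, diagEntry c.1 y A κ j = (A : ℂ) / dirNormSq c.1 y := by
      intro j hj
      simp [diagEntry, (Finset.mem_erase.1 hj).1]
    rw [Finset.prod_congr rfl this, Finset.prod_const, Finset.card_erase_of_mem (Finset.mem_univ _)]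
    simp [diagEntry]
  have he : (c.2.eps : ℂ) * c.2.eps = 1 := by exact_mod_cast c.2.eps_mul_eps
  have hn : n ≠ 0 := fun h => by subst h; exact c.1.elim0
  rw [calabiMatrix_eq_mul]
  simp only [Matrix.det_mul, Matrix.det_conjTranspose, det_shear, det_baseFactor,
    Matrix.det_diagonal, h1, RCLike.star_def, Complex.conj_ofReal]
  obtain ⟨m, rfl⟩ := Nat.exists_eq_succ_of_ne_zero hn
  push_cast
  simp only [Nat.succ_eq_add_one, div_pow]
  field_simp
  linear_combination (κ : ℂ) * A ^ m * dirNormSq c.1 y * dirNormSq c.1 y ^ m * he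

/-- The two matrices are P R and P ρ R, where the diagonal matrix ρ holds the relative eigenvalues
κ'/κ and A'/A. Cyclicity of the trace and adj(P) P = det P, R adj(R) = det R leave det(P R) times
the trace of ρ. -/
theorem trace_adjugate_mul_calabiMatrix (c : Chart n) (y : Fin n → ℂ) {A κ : ℝ} (A' κ' : ℝ)
    (hA : A ≠ 0) (hκ : κ ≠ 0) :
    ((calabiMatrix c y A κ).adjugate * calabiMatrix c y A' κ').trace
      = (calabiMatrix c y A κ).det * ((κ' / κ + (n - 1) * (A' / A) : ℝ) : ℂ) := by
  set P := shear c y * Matrix.diagonal (diagEntry c.1 y A κ) with hP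
  set R := baseFactor c.1 y * (shear c y)ᴴ with hR
  have h0 : (dirNormSq c.1 y : ℂ) ≠ 0 := by exact_mod_cast (dirNormSq_pos c.1 y).ne'
  have hA' : (A : ℂ) ≠ 0 := by exact_mod_cast hA
  have hκ' : (κ : ℂ) ≠ 0 := by exact_mod_cast hκ
  set ρ : Fin n → ℂ := fun j => if j = c.1 then (κ' : ℂ) / κ else (A' : ℂ) / A with hρ
  have hd : Matrix.diagonal (diagEntry c.1 y A' κ')
      = Matrix.diagonal (diagEntry c.1 y A κ) * Matrix.diagonal ρ := by
    rw [Matrix.diagonal_mul_diagonal]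
    congr 1
    funext j
    by_cases hj : j = c.1
    · simp [diagEntry, hρ, hj]
      field_simp
    · simp [diagEntry, hρ, hj]
      field_simp
  have h1 : calabiMatrix c y A κ = P * R := calabiMatrix_eq_mul c y A κ
  have h2 : calabiMatrix c y A' κ' = P * (Matrix.diagonal ρ * R) := by
    rw [calabiMatrix_eq_mul, hd, hP]
    simp only [Matrix.mul_assoc, hR]
  have htr : (Matrix.diagonal ρ).trace = ((κ' / κ + (n - 1) * (A' / A) : ℝ) : ℂ) := by
    rw [Matrix.trace_diagonal, ← Finset.add_sum_erase _ _ (Finset.mem_univ c.1)]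
    have : ∀ j ∈ Finset.univ.erase c.1, ρ j = (A' : ℂ) / A := by
      intro j hj
      simp [hρ, (Finset.mem_erase.1 hj).1]
    have hn : 1 ≤ n := Nat.one_le_iff_ne_zero.2 fun h => by subst h; exact c.1.elim0
    rw [Finset.sum_congr rfl this, Finset.sum_const, Finset.card_erase_of_mem (Finset.mem_univ _)]
    simp [hρ, Nat.cast_sub hn]
  rw [h1, h2, Matrix.adjugate_mul_distrib, Matrix.mul_assoc, ← Matrix.mul_assoc P.adjugate,
    Matrix.adjugate_mul, Matrix.smul_mul, Matrix.one_mul, Matrix.mul_smul, Matrix.trace_smul,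
    Matrix.trace_mul_comm, Matrix.mul_assoc, Matrix.mul_adjugate, Matrix.mul_smul, Matrix.mul_one,
    Matrix.trace_smul, htr, Matrix.det_mul P R]
  simp only [smul_eq_mul]
  ring

end Determinant

/-! ### Integration over the fibres and over the base. -/

section Integrals

open MeasureTheory

variable {f : ℝ → ℝ} {α β : ℝ} {F : ℝ → ℝ} {s : Side} {p P : ℝ → ℝ}

/-- The limit of `f'` along the divisor opposite to a side. -/
def Side.otherVal (α β : ℝ) : Side → ℝ
  | Side.zero => β
  | Side.infinity => α

/-- As t → ∞ a point of the fibre runs to the opposite divisor. -/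
theorem tendsto_endMomentum_atTop (hf : IsProfile f α β) (hF : IsEnd f s (s.endVal α β) F) :
    Tendsto (endMomentum s (s.endVal α β) F) atTop (𝓝 (s.otherVal α β)) := by
  have hev : (fun t => deriv f (s.eps * Real.log t)) =ᶠ[atTop] endMomentum s (s.endVal α β) F := by
    filter_upwards [eventually_gt_atTop 0] with t ht
    exact (hF.endMomentum_eq (hf.smooth.differentiable (by simp)) ht).symm
  refine Tendsto.congr' hev ?_
  cases s
  · simpa [Side.eps, Side.otherVal] using! hf.tendsto_deriv_atTop.comp Real.tendsto_log_atTop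
  · simpa [Side.eps, Side.otherVal] using! hf.tendsto_deriv_atBot.comp
      (tendsto_neg_atTop_atBot.comp Real.tendsto_log_atTop)

/-- The radial profile of the density `p(f') f'' / ‖w‖²` on a fibre, for the squared norm `M` of
the fibre coordinate `1`. -/
def fibreDensity (s : Side) (γ : ℝ) (F p : ℝ → ℝ) (M r : ℝ) : ℝ :=
  M * endDensity F (r ^ 2 * M) * p (endMomentum s γ F (r ^ 2 * M))

theorem hasDerivAt_fibre {γ M r : ℝ} (hF : IsEnd f s γ F) (hM : 0 < M) (hr : 0 < r)
    (hP : ∀ x, HasDerivAt P (p x) x) :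
    HasDerivAt (fun r => s.eps / 2 * P (endMomentum s γ F (r ^ 2 * M)))
      (r * fibreDensity s γ F p M r) r := by
  have h1 : HasDerivAt (fun r : ℝ => r ^ 2 * M) (2 * r * M) r := by
    simpa using (hasDerivAt_pow 2 r).mul_const M
  have ht : 0 < r ^ 2 * M := by positivity
  have h2 := (hasDerivWithinAt_endMomentum (s := s) γ hF.smooth ht.le).hasDerivAt (Ici_mem_nhds ht)
  have h3 := (((hP _).comp _ h2).comp r h1).const_mul (s.eps / 2)
  refine h3.congr_deriv ?_
  rw [fibreDensity]
  linear_combination (p (endMomentum s γ F (r ^ 2 * M)) * endDensity F (r ^ 2 * M) * r * M)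
    * s.eps_mul_eps

/-- In the radial variable the integrand is the derivative of (ε/2) P(f'), and f' runs between the
two end values; ε corrects the direction. Nonnegativity of p gives integrability. The value does not
depend on M, hence not on the point of the base. -/
theorem fibre_integral (hf : IsProfile f α β) (hα : 0 < α) (hβ : 0 < β)
    (hF : IsEnd f s (s.endVal α β) F) {M : ℝ} (hM : 0 < M)
    (hP : ∀ x, HasDerivAt P (p x) x) (hp : ∀ x, 0 < x → 0 ≤ p x) :
    IntegrableOn (fun r => r * fibreDensity s (s.endVal α β) F p M r) (Set.Ioi 0) ∧
      ∫ r in Set.Ioi 0, r * fibreDensity s (s.endVal α β) F p M r = (P β - P α) / 2 := by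
  set γ := s.endVal α β with hγ
  have hPc : Continuous P := continuous_iff_continuousAt.2 fun x => (hP x).continuousAt
  have hc : ContinuousWithinAt (fun r => s.eps / 2 * P (endMomentum s γ F (r ^ 2 * M)))
      (Set.Ici 0) 0 := by
    have h : Continuous fun r : ℝ => endMomentum s γ F (r ^ 2 * M) :=
      (contDiffOn_endMomentum γ hF.smooth).continuousOn.comp_continuous (by fun_prop)
        fun r => Set.mem_Ici.2 (by positivity)
    exact (continuous_const.mul (hPc.comp h)).continuousWithinAt
  have hd : ∀ r ∈ Set.Ioi (0 : ℝ), HasDerivAt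
      (fun r => s.eps / 2 * P (endMomentum s γ F (r ^ 2 * M)))
      (r * fibreDensity s γ F p M r) r := fun r hr => hasDerivAt_fibre hF hM hr hP
  have h0 : ∀ r ∈ Set.Ioi (0 : ℝ), 0 ≤ r * fibreDensity s γ F p M r := by
    intro r hr
    have hr' : (0 : ℝ) < r := hr
    have ht : 0 ≤ r ^ 2 * M := by positivity
    exact mul_nonneg hr'.le (mul_nonneg (mul_nonneg hM.le (hf.endDensity_pos hF ht).le)
      (hp _ (hf.endMomentum_pos hα hβ hF ht)))
  have hlim : Tendsto (fun r => s.eps / 2 * P (endMomentum s γ F (r ^ 2 * M))) atTop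
      (𝓝 (s.eps / 2 * P (s.otherVal α β))) := by
    have h1 : Tendsto (fun r : ℝ => r ^ 2 * M) atTop atTop :=
      (tendsto_pow_atTop (by norm_num)).atTop_mul_const hM
    exact ((hPc.tendsto _).comp ((tendsto_endMomentum_atTop hf hF).comp h1)).const_mul _
  refine ⟨integrableOn_Ioi_deriv_of_nonneg hc hd h0 hlim, ?_⟩
  rw [integral_Ioi_of_hasDerivAt_of_nonneg hc hd h0 hlim]
  simp only [zero_pow two_ne_zero, zero_mul, endMomentum_zero]
  rw [hγ]
  cases s <;> simp [Side.eps, Side.endVal, Side.otherVal] <;> ring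

/-- Integration over a fibre `ℂ` of the density. -/
theorem plane_integral (hf : IsProfile f α β) (hα : 0 < α) (hβ : 0 < β)
    (hF : IsEnd f s (s.endVal α β) F) {M : ℝ} (hM : 0 < M)
    (hP : ∀ x, HasDerivAt P (p x) x) (hp : ∀ x, 0 < x → 0 ≤ p x) :
    Integrable (fun w : ℂ => fibreDensity s (s.endVal α β) F p M ‖w‖) ∧
      ∫ w : ℂ, fibreDensity s (s.endVal α β) F p M ‖w‖
        = volume.real (Metric.ball (0 : ℂ) 1) * (P β - P α) := by
  obtain ⟨h1, h2⟩ := fibre_integral hf hα hβ hF hM hP hp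
  constructor
  · rw [integrable_fun_norm_addHaar]
    simpa [Complex.finrank_real_complex] using h1
  · rw [integral_fun_norm_addHaar]
    simp only [Complex.finrank_real_complex, Nat.add_one_sub_one, pow_one, smul_eq_mul, h2]
    simp
    ring

variable {m : ℕ}

theorem one_add_norm_sq_le (z : Fin m → ℂ) : 1 + ‖z‖ ^ 2 ≤ 1 + ∑ j, ‖z j‖ ^ 2 := by
  have h0 : 0 ≤ ∑ j, ‖z j‖ ^ 2 := Finset.sum_nonneg fun j _ => by positivity
  have h : ‖z‖ ≤ Real.sqrt (∑ j, ‖z j‖ ^ 2) := by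
    refine (pi_norm_le_iff_of_nonneg (Real.sqrt_nonneg _)).2 fun j => Real.le_sqrt_of_sq_le ?_
    exact Finset.single_le_sum (f := fun j => ‖z j‖ ^ 2) (fun j _ => by positivity)
      (Finset.mem_univ j)
  have := pow_le_pow_left₀ (norm_nonneg z) h 2
  rw [Real.sq_sqrt h0] at this
  linarith

theorem integrable_inv_one_add_sq_pow :
    Integrable fun z : Fin m → ℂ => ((1 + ∑ j, ‖z j‖ ^ 2) ^ (m + 1))⁻¹ := by
  have hr : (Module.finrank ℝ (Fin m → ℂ) : ℝ) < 2 * (m + 1) := by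
    rw [Module.finrank_pi_fintype]
    simp [Complex.finrank_real_complex]
    linarith
  -- The factor 2^(m+1) comes from (1 + ‖z‖)² ≤ 2 (1 + ‖z‖²). The exponent 2(m+1) exceeds the real
  -- dimension 2m.
  have h := (integrable_one_add_norm (μ := (volume : Measure (Fin m → ℂ))) hr).const_mul
    (2 ^ (m + 1) : ℝ)
  refine h.mono' (Continuous.aestronglyMeasurable ?_) (Eventually.of_forall fun z => ?_)
  · have hc : Continuous fun z : Fin m → ℂ => (1 + ∑ j, ‖z j‖ ^ 2) ^ (m + 1) := by fun_prop
    refine hc.inv₀ fun z => ?_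
    have : 0 ≤ ∑ j, ‖z j‖ ^ 2 := Finset.sum_nonneg fun j _ => by positivity
    positivity
  · have h1 := one_add_norm_sq_le z
    have h2 : 0 ≤ ‖z‖ := norm_nonneg z
    have h3 : (1 + ‖z‖) ^ 2 / 2 ≤ 1 + ∑ j, ‖z j‖ ^ 2 := by nlinarith [sq_nonneg (1 - ‖z‖)]
    have h4 : 0 < 1 + ∑ j, ‖z j‖ ^ 2 := by positivity
    rw [Real.norm_of_nonneg (by positivity), Real.rpow_neg (by positivity),
      show (2 * ((m : ℝ) + 1)) = ((2 * (m + 1) : ℕ) : ℝ) by push_cast; ring, Real.rpow_natCast,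
      pow_mul]
    have h5 := pow_le_pow_left₀ (by positivity) h3 (m + 1)
    rw [div_pow, div_le_iff₀ (by positivity)] at h5
    rw [← div_eq_mul_inv, inv_le_comm₀ (by positivity) (by positivity), inv_div,
      div_le_iff₀ (by positivity)]
    exact h5

theorem dirNormSq_insertNth (i : Fin (m + 1)) (w : ℂ) (z : Fin m → ℂ) :
    dirNormSq i (i.insertNth w z : Fin (m + 1) → ℂ) = 1 + ∑ j, ‖z j‖ ^ 2 := by
  rw [dirNormSq_eq_one_add, Fin.sum_univ_succAbove _ i]
  simp [transVec]

/-- The value common to all integrals over `X_n` of fibrewise densities. -/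
def baseIntegral (m : ℕ) : ℝ :=
  volume.real (Metric.ball (0 : ℂ) 1) * ∫ z : Fin m → ℂ, ((1 + ∑ j, ‖z j‖ ^ 2) ^ (m + 1))⁻¹

/-- The integral of `p(f') f'' ds` against the Fubini–Study volume, computed in a chart. -/
theorem chart_integral (hf : IsProfile f α β) (hα : 0 < α) (hβ : 0 < β) (c : Chart (m + 1))
    (hP : ∀ x, HasDerivAt P (p x) x) (hp : ∀ x, 0 < x → 0 ≤ p x) (hpc : Continuous p) :
    Integrable (fun y => p (hf.momentum c y) * hf.density c y / dirNormSq c.1 y ^ (m + 1)) ∧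
      ∫ y, p (hf.momentum c y) * hf.density c y / dirNormSq c.1 y ^ (m + 1)
        = baseIntegral m * (P β - P α) := by
  obtain ⟨i, s⟩ := c
  set g : (Fin (m + 1) → ℂ) → ℝ := fun y =>
    p (hf.momentum (i, s) y) * hf.density (i, s) y / dirNormSq i y ^ (m + 1) with hg
  have hgc : Continuous g :=
    ((hpc.comp (hf.contDiff_momentum (i, s)).continuous).mul (hf.continuous_density (i, s))).div
      ((contDiff_dirNormSq i).continuous.pow _) fun y => (pow_pos (dirNormSq_pos i y) _).ne'
  -- Splitting off y_i separates the fibre from the affine coordinates of the base; the power of N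
  -- enters the fibre density only as its parameter M.
  set e := MeasurableEquiv.piFinSuccAbove (fun _ : Fin (m + 1) => ℂ) i with he
  have hmp : MeasurePreserving e volume volume :=
    volume_preserving_piFinSuccAbove (fun _ : Fin (m + 1) => ℂ) i
  have hmp' : MeasurePreserving e.symm volume volume := hmp.symm e
  have hval : ∀ w z, (g ∘ e.symm) (w, z)
      = fibreDensity s (s.endVal α β) (hf.ext s) p ((1 + ∑ j, ‖z j‖ ^ 2) ^ s.eps) ‖w‖
        * ((1 + ∑ j, ‖z j‖ ^ 2) ^ (m + 1))⁻¹ := by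
    intro w z
    have h1 : e.symm (w, z) = i.insertNth w z := rfl
    simp only [Function.comp_apply, h1, hg, IsProfile.momentum, IsProfile.density, radius_eq,
      dirNormSq_insertNth, fibreDensity, Fin.insertNth_apply_same]
    ring
  have hN : ∀ z : Fin m → ℂ, 0 < 1 + ∑ j, ‖z j‖ ^ 2 := fun z => by
    have : 0 ≤ ∑ j, ‖z j‖ ^ 2 := Finset.sum_nonneg fun j _ => by positivity
    positivity
  have hpl := fun z : Fin m → ℂ => plane_integral (F := hf.ext s) hf hα hβ (hf.isEnd_ext s)
    (Real.rpow_pos_of_pos (hN z) s.eps) hP hp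
  have hinner : ∀ z : Fin m → ℂ, ∫ w, (g ∘ e.symm) (w, z)
      = volume.real (Metric.ball (0 : ℂ) 1) * (P β - P α)
        * ((1 + ∑ j, ‖z j‖ ^ 2) ^ (m + 1))⁻¹ := by
    intro z
    simp only [hval]
    rw [integral_mul_const, (hpl z).2]
  have hg0 : ∀ y, 0 ≤ g y := fun y =>
    div_nonneg (mul_nonneg (hp _ (hf.momentum_pos hα hβ _ y)) (hf.density_pos _ y).le)
      (pow_nonneg (dirNormSq_pos i y).le _)
  have hint : Integrable (g ∘ e.symm) (volume.prod volume) := by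
    -- The density is nonnegative, so the integral of its norm over a fibre is the fibre integral
    -- itself, a constant times the integrable base density.
    rw [integrable_prod_iff' ((hgc.measurable.comp e.symm.measurable).aestronglyMeasurable)]
    refine ⟨Eventually.of_forall fun z => ?_, ?_⟩
    · simp only [hval]
      exact (hpl z).1.mul_const _
    · have : (fun z => ∫ w, ‖(g ∘ e.symm) (w, z)‖) = fun z => ∫ w, (g ∘ e.symm) (w, z) := by
        funext z
        exact integral_congr_ae (Eventually.of_forall fun w => Real.norm_of_nonneg (hg0 _))
      rw [this]
      simp only [hinner]
      exact integrable_inv_one_add_sq_pow.const_mul _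
  constructor
  · exact (hmp'.integrable_comp_emb e.symm.measurableEmbedding).1 hint
  · rw [← hmp'.integral_comp e.symm.measurableEmbedding g]
    have h := integral_prod_symm (g ∘ e.symm) hint
    refine h.trans ?_
    simp only [hinner, integral_const_mul, baseIntegral]
    ring

end Integrals

/-! ### Two forms in the same class differ by ∂∂̄ of a smooth function. -/

section Perturbation

variable {n : ℕ} {α β : ℝ}

theorem Form.InClass.exists_local {η : Form n} (h : η.InClass β α) :
    ∃ u : X n → ℝ, η.HasPotential u ∧ ∃ v : Chart n → (Fin n → ℂ) → ℝ,
      (∀ c, ContDiff ℝ (⊤ : ℕ∞) (v c)) ∧ ∀ c y, y c.1 ≠ 0 →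
        u (param c y) = c.2.eps * c.2.endVal α β * Real.log (‖y c.1‖ ^ 2) + v c y := by
  obtain ⟨u, hu, hv⟩ := h
  have : ∀ c : Chart n, ∃ v : (Fin n → ℂ) → ℝ, ContDiff ℝ (⊤ : ℕ∞) v ∧ ∀ y, y c.1 ≠ 0 →
      u (param c y) = c.2.eps * c.2.endVal α β * Real.log (‖y c.1‖ ^ 2) + v y := by
    rintro ⟨i, s⟩
    cases s
    · simpa [Side.eps, Side.endVal] using (hv i).1
    · simpa [Side.eps, Side.endVal] using (hv i).2
  choose v h1 h2 using this
  exact ⟨u, hu, v, h1, h2⟩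

theorem apply_ne_zero_of_param_eq {c d : Chart n} {y y' : Fin n → ℂ} (h : param c y = param d y')
    (hy : y c.1 ≠ 0) : y' d.1 ≠ 0 := by
  rw [Ne, ← param_mem_divisors_iff, ← h, param_mem_divisors_iff]
  exact hy

/-- Continuous functions in the charts that come from a function off the divisors come from a
function on `X_n`. -/
theorem exists_descend {w : Chart n → (Fin n → ℂ) → ℝ} {u : X n → ℝ} (hw : ∀ c, Continuous (w c))
    (hu : ∀ c y, y c.1 ≠ 0 → u (param c y) = w c y) :
    ∃ φ : X n → ℝ, ∀ c y, φ (param c y) = w c y := by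
  have hwd : ∀ c d y y', param c y = param d y' → w c y = w d y' := by
    intro c d y y' h
    have hy := mem_overlap_of_param_eq h
    have hΦy : coord d (param c y) = y' := by rw [h, coord_param]
    rw [← hΦy]
    refine eq_at_of_eq_off_divisor c.1 (F := w c) (G := fun y => w d (coord d (param c y)))
      (hw c).continuousAt
      ((hw d).continuousAt.comp (contDiffAt_coord_param (m := 0) hy).continuousAt) ?_
    filter_upwards [(isOpen_overlap c d).mem_nhds hy] with z hz hz0
    have h1 := param_coord_param hz
    rw [← hu c z hz0, ← hu d _ (apply_ne_zero_of_param_eq h1.symm hz0), h1]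
  choose c y hcy using exists_param (n := n)
  exact ⟨fun p => w (c p) (y p), fun d z => hwd _ _ _ _ (hcy _)⟩

/-- The two potentials have identical logarithmic poles along E₀ and E_∞. These cancel in the
difference, which is therefore smooth in every chart and descends to X_n. -/
theorem exists_isPerturbation {η η₀ : Form n} (h : η.InClass β α) (h₀ : η₀.InClass β α) :
    ∃ φ : X n → ℝ, η.IsPerturbation η₀ φ := by
  obtain ⟨u, hu, v, hv, huv⟩ := h.exists_local
  obtain ⟨u₀, hu₀, v₀, hv₀, huv₀⟩ := h₀.exists_local
  obtain ⟨φ, hφ⟩ := exists_descend (u := fun p => u p - u₀ p) (w := fun c y => v c y - v₀ c y)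
    (fun c => (hv c).continuous.sub (hv₀ c).continuous) (fun c y hy => by
      simp only [huv c y hy, huv₀ c y hy]
      ring)
  have hs : ∀ c, ContDiff ℝ (⊤ : ℕ∞) fun y => φ (param c y) := fun c => by
    simp only [hφ]
    exact (hv c).sub (hv₀ c)
  refine ⟨φ, hs, fun c y => ?_⟩
  refine congrFun (eq_of_eq_off_divisor c.1 (G := fun y => η₀.coeff c y
    + complexHessian (fun y' => φ (param c y')) y) (η.continuous_coeff c)
    ((η₀.continuous_coeff c).add (continuous_matrix fun j l =>
      (contDiff_complexHessian (hs c) j l).continuous)) fun y hy => ?_) y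
  have hsm : ∀ {r : ℝ} {v : (Fin n → ℂ) → ℝ} {u : X n → ℝ}, ContDiff ℝ (⊤ : ℕ∞) v →
      (∀ y, y c.1 ≠ 0 → u (param c y) = r * Real.log (‖y c.1‖ ^ 2) + v y) →
      ContDiffAt ℝ 2 (fun y => u (param c y)) y := by
    intro r v u hv huv
    refine ((contDiffAt_const_mul_log_normSq_apply r hy).add
      (hv.contDiffAt.of_le two_le_infty)).congr_of_eventuallyEq ?_
    filter_upwards [(isOpen_apply_ne_zero c.1).mem_nhds hy] with z hz using huv z hz
  have hev : (fun y => φ (param c y)) =ᶠ[𝓝 y] fun y => u (param c y) - u₀ (param c y) := by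
    filter_upwards [(isOpen_apply_ne_zero c.1).mem_nhds hy] with z hz
    rw [hφ, huv c z hz, huv₀ c z hz]
    ring
  rw [Form.hasPotential_iff.1 hu c y hy, Form.hasPotential_iff.1 hu₀ c y hy,
    complexHessian_congr hev, complexHessian_sub (hsm (hv c) (huv c)) (hsm (hv₀ c) (huv₀ c)),
    add_sub_cancel]

end Perturbation

/-! ### The Hamiltonian of ξ and the moments of f'. -/

section Hamiltonian

open MeasureTheory

variable {n : ℕ} {f : ℝ → ℝ} {α β : ℝ}

theorem IsProfile.exists_hamiltonian (hf : IsProfile f α β) (n : ℕ) (k C : ℝ) :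
    ∃ θ : X n → ℝ, ∀ c y, θ (param c y) = k * hf.momentum c y + C :=
  exists_descend (u := fun p => k * deriv f (logNorm p) + C)
    (fun c => (continuous_const.mul (hf.contDiff_momentum c).continuous).add continuous_const)
    fun c y hy => by rw [hf.momentum_eq hy]

theorem fieldXi_eq (k : ℝ) (c : Chart n) (y : Fin n → ℂ) :
    fieldXi k c y = Pi.single c.1 ((c.2.eps : ℂ) * k * y c.1) := by
  obtain ⟨i, s⟩ := c
  cases s <;> simp [fieldXi, Side.eps]

/-- The field has only a fibre component, which annihilates the Fubini–Study part. The vertical part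
contributes k f'' ∂̄s = ∂̄(k f'), the two signs ε cancelling. -/
theorem IsProfile.contraction_eq (hf : IsProfile f α β) {θ : X n → ℝ} {k C : ℝ}
    (hθ : ∀ c y, θ (param c y) = k * hf.momentum c y + C) (c : Chart n) (y : Fin n → ℂ)
    (l : Fin n) : ∑ j, fieldXi k c y j * (hf.form n).coeff c y j l
      = dzbar l (fun y' => (θ (param c y') : ℂ)) y := by
  have hsum : ∀ y, ∑ j, fieldXi k c y j * (hf.form n).coeff c y j l
      = (c.2.eps : ℂ) * k * y c.1 * (hf.form n).coeff c y c.1 l := by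
    intro y
    rw [fieldXi_eq, Finset.sum_eq_single c.1 (fun j _ hj => by simp [hj]) (by simp)]
    simp
  have hsm : ContDiff ℝ (⊤ : ℕ∞) fun y => θ (param c y) := by
    simp only [hθ]
    exact (contDiff_const.mul (hf.contDiff_momentum c)).add contDiff_const
  simp only [hsum]
  refine congrFun (eq_of_eq_off_divisor c.1
    (F := fun y => (c.2.eps : ℂ) * k * y c.1 * (hf.form n).coeff c y c.1 l)
    (G := dzbar l fun y' => (θ (param c y') : ℂ)) ?_ ?_ fun y hy => ?_) y
  · exact (continuous_const.mul (continuous_apply _)).mul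
      ((hf.form n).smooth c c.1 l).continuous
  · exact continuous_iff_continuousAt.2 fun y => (ContDiffAt.dzbar (m := ⊤) l
      hsm.contDiffAt.ofReal_comp).continuousAt
  · have hev : (fun y => (θ (param c y) : ℂ)) =ᶠ[𝓝 y]
        fun y => (((fun x => k * deriv f x + C) (logNorm (param c y)) : ℝ) : ℂ) := by
      filter_upwards [(isOpen_apply_ne_zero c.1).mem_nhds hy] with z hz
      rw [hθ, hf.momentum_eq hz]
    have hdf : Differentiable ℝ (deriv f) :=
      ((contDiff_infty_iff_deriv.1 hf.smooth).2).differentiable (by simp)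
    rw [dzbar_congr l hev, dzbar_real_comp l
      (((hdf _).hasDerivAt.const_mul k).add_const C)
      ((contDiffAt_logNorm_param hy).differentiableAt (by simp)), dzbar_logNorm_param hy,
      hf.form_coeff, hf.density_eq hy]
    have e : ((‖y c.1‖ ^ 2 : ℝ) : ℂ) = y c.1 * starRingEnd ℂ (y c.1) := by
      simp [Complex.mul_conj']
    have hc : starRingEnd ℂ (y c.1) ≠ 0 := by simpa using hy
    have hv : vertical c y c.1 = c.2.eps := by simp [vertical]
    have he : (c.2.eps : ℂ) * c.2.eps = 1 := by exact_mod_cast c.2.eps_mul_eps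
    simp only [calabiMatrix, Matrix.add_apply, Matrix.smul_apply, fubiniStudy_left, smul_eq_mul,
      mul_zero, zero_add, Matrix.vecMulVec_apply, Complex.ofReal_div, e, hv, Complex.ofReal_mul]
    field_simp
    linear_combination (k : ℂ) * ((deriv (deriv f) (logNorm (param c y)) : ℝ) : ℂ)
      * starRingEnd ℂ (vertical c y l) * he

theorem IsProfile.volDensity_form (hf : IsProfile f α β) (c : Chart n) (y : Fin n → ℂ) :
    volDensity (hf.form n) c y
      = hf.momentum c y ^ (n - 1) * hf.density c y / dirNormSq c.1 y ^ n := by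
  rw [volDensity, hf.form_coeff, det_calabiMatrix, Complex.ofReal_re]

theorem IsProfile.volDensity_form_pos (hf : IsProfile f α β) (hα : 0 < α) (hβ : 0 < β)
    (c : Chart n) (y : Fin n → ℂ) : 0 < volDensity (hf.form n) c y := by
  rw [hf.volDensity_form]
  exact div_pos (mul_pos (pow_pos (hf.momentum_pos hα hβ c y) _) (hf.density_pos c y))
    (pow_pos (dirNormSq_pos c.1 y) _)

theorem hasDerivAt_pow_succ_div (m : ℕ) (x : ℝ) :
    HasDerivAt (fun x : ℝ => x ^ (m + 1) / (m + 1)) (x ^ m) x := by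
  have hm : (m : ℝ) + 1 ≠ 0 := by positivity
  have h := (hasDerivAt_pow (m + 1) x).div_const ((m : ℝ) + 1)
  refine h.congr_deriv ?_
  push_cast
  field_simp

variable {m : ℕ}

/-- The volume density is f'^m f'' against the Fubini–Study volume, so this is the case p(τ) = τ^m
of `chart_integral`; weighting by f' raises the exponent by one. -/
theorem IsProfile.integral_volDensity (hf : IsProfile f α β) (hα : 0 < α) (hβ : 0 < β)
    (c : Chart (m + 1)) : Integrable (volDensity (hf.form (m + 1)) c) ∧
      ∫ y, volDensity (hf.form (m + 1)) c y
        = baseIntegral m * (β ^ (m + 1) / (m + 1) - α ^ (m + 1) / (m + 1)) := by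
  have h := chart_integral hf hα hβ c (hasDerivAt_pow_succ_div m) (fun x hx => by positivity)
    (continuous_pow m)
  have e : volDensity (hf.form (m + 1)) c
      = fun y => hf.momentum c y ^ m * hf.density c y / dirNormSq c.1 y ^ (m + 1) := by
    funext y
    rw [hf.volDensity_form, Nat.add_sub_cancel]
  rw [e]
  exact h

theorem IsProfile.integral_momentum_mul_volDensity (hf : IsProfile f α β) (hα : 0 < α)
    (hβ : 0 < β) (c : Chart (m + 1)) :
    Integrable (fun y => hf.momentum c y * volDensity (hf.form (m + 1)) c y) ∧
      ∫ y, hf.momentum c y * volDensity (hf.form (m + 1)) c y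
        = baseIntegral m * (β ^ (m + 2) / (m + 2) - α ^ (m + 2) / (m + 2)) := by
  have h := chart_integral hf hα hβ c (hasDerivAt_pow_succ_div (m + 1)) (fun x hx => by positivity)
    (continuous_pow (m + 1))
  have e : (fun y => hf.momentum c y * volDensity (hf.form (m + 1)) c y)
      = fun y => hf.momentum c y ^ (m + 1) * hf.density c y / dirNormSq c.1 y ^ (m + 1) := by
    funext y
    rw [hf.volDensity_form, Nat.add_sub_cancel]
    ring
  rw [e]
  refine ⟨h.1, h.2.trans ?_⟩
  push_cast
  ring

/-- Being nonzero, this common factor cancels in `slope`. -/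
theorem baseIntegral_pos (m : ℕ) : 0 < baseIntegral m := by
  refine mul_pos (ENNReal.toReal_pos (Metric.measure_ball_pos _ _ one_pos).ne'
    measure_ball_lt_top.ne) ?_
  have hpos : ∀ z : Fin m → ℂ, 0 < ((1 + ∑ j, ‖z j‖ ^ 2) ^ (m + 1))⁻¹ := fun z => by
    have : 0 ≤ ∑ j, ‖z j‖ ^ 2 := Finset.sum_nonneg fun j _ => by positivity
    positivity
  rw [integral_pos_iff_support_of_nonneg (fun z => (hpos z).le) integrable_inv_one_add_sq_pow,
    Function.support_eq_univ fun z => (hpos z).ne']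
  exact isOpen_univ.measure_pos volume Set.univ_nonempty

/-- The integral of an affine function of `f'` over `X_n`. -/
theorem IsProfile.integral_affine (hf : IsProfile f α β) (hα : 0 < α) (hβ : 0 < β)
    (c : Chart (m + 1)) (k C : ℝ) :
    Integrable (fun y => (k * hf.momentum c y + C) * volDensity (hf.form (m + 1)) c y) ∧
      ∫ y, (k * hf.momentum c y + C) * volDensity (hf.form (m + 1)) c y
        = baseIntegral m * (k * ((β ^ (m + 2) - α ^ (m + 2)) / (m + 2))
          + C * ((β ^ (m + 1) - α ^ (m + 1)) / (m + 1))) := by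
  obtain ⟨h1, h2⟩ := hf.integral_volDensity hα hβ c
  obtain ⟨h3, h4⟩ := hf.integral_momentum_mul_volDensity hα hβ c
  have e : (fun y => (k * hf.momentum c y + C) * volDensity (hf.form (m + 1)) c y)
      = fun y => k * (hf.momentum c y * volDensity (hf.form (m + 1)) c y)
        + C * volDensity (hf.form (m + 1)) c y := by
    funext y
    ring
  rw [e]
  refine ⟨(h3.const_mul k).add (h1.const_mul C), ?_⟩
  rw [integral_add (h3.const_mul k) (h1.const_mul C), integral_const_mul, integral_const_mul, h2, h4]
  ring

end Hamiltonian

/-! ### Solution of the modified J-equation. -/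

section Equation

open MeasureTheory

variable {n : ℕ} {a b k : ℝ} {f g : ℝ → ℝ}

/-- Differentiating g' = ψ(f') gives g''/f'' = ψ'(f'), and the left side becomes that of `psi_ode`
at τ = f'. Positivity of the momentum and the density of f keeps the quotients continuous on the
divisors. -/
theorem trace_equation (hn : n ≠ 0) (hb : 1 < b) (hf : IsProfile f 1 b) (hg : IsProfile g 1 a)
    (hfg : ∀ x, psi n a b k (deriv f x) = deriv g x) (c : Chart n) (y : Fin n → ℂ) :
    hg.density c y / hf.density c y + (n - 1) * (hg.momentum c y / hf.momentum c y)
      = k * hf.momentum c y + ckConst n a b k := by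
  have hA := hf.momentum_pos one_pos (one_pos.trans hb) c (n := n)
  have hκ := hf.density_pos c (n := n)
  have c1 := (hf.contDiff_momentum c (n := n)).continuous
  have c2 := (hg.contDiff_momentum c (n := n)).continuous
  have c3 := hf.continuous_density c (n := n)
  have c4 := hg.continuous_density c (n := n)
  refine congrFun (eq_of_eq_off_divisor c.1
    (F := fun y => hg.density c y / hf.density c y
      + (n - 1) * (hg.momentum c y / hf.momentum c y))
    (G := fun y => k * hf.momentum c y + ckConst n a b k)
    ((c4.div c3 fun y => (hκ y).ne').add (continuous_const.mul (c2.div c1 fun y => (hA y).ne')))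
    ((continuous_const.mul c1).add continuous_const) fun y hy => ?_) y
  set x := logNorm (param c y) with hx
  have hτ : deriv f x ≠ 0 := (hf.deriv_pos x).ne'
  have hdf : Differentiable ℝ (deriv f) :=
    ((contDiff_infty_iff_deriv.1 hf.smooth).2).differentiable (by simp)
  have hdg : deriv (deriv g) x = psiDeriv n a b k (deriv f x) * deriv (deriv f) x := by
    have h := (hasDerivAt_psi (n := n) (a := a) (b := b) (k := k) hτ).comp x (hdf x).hasDerivAt
    rw [show deriv g = psi n a b k ∘ deriv f from funext fun x => (hfg x).symm]
    exact h.deriv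
  have hne : ‖y c.1‖ ≠ 0 := by simpa using hy
  have hf2 := (hf.deriv_deriv_pos x).ne'
  simp only [hf.momentum_eq hy, hg.momentum_eq hy, hf.density_eq hy, hg.density_eq hy, ← hx]
  rw [← psi_ode hτ hn, hdg, ← hfg x]
  field_simp
  ring

theorem mixedDensity_eq (hn : n ≠ 0) (hb : 1 < b) (hf : IsProfile f 1 b) (hg : IsProfile g 1 a)
    (hfg : ∀ x, psi n a b k (deriv f x) = deriv g x) {ω : Form n}
    (hω : ω.HasPotential fun p => g (logNorm p)) (c : Chart n) (y : Fin n → ℂ) :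
    mixedDensity ω (hf.form n) c y
      = (k * hf.momentum c y + ckConst n a b k) * volDensity (hf.form n) c y := by
  have h := trace_adjugate_mul_calabiMatrix c y (hg.momentum c y) (hg.density c y)
    (hf.momentum_pos one_pos (one_pos.trans hb) c y).ne' (hf.density_pos c y).ne'
  rw [trace_equation hn hb hf hg hfg] at h
  rw [mixedDensity, Form.coeff_eq_of_hasPotential hω hg.form_hasPotential c, hf.form_coeff,
    hg.form_coeff, h, volDensity, hf.form_coeff, Complex.re_mul_ofReal, mul_comm]

/-- The slope is the mean of k f' + c_k for χⁿ. The mean of f' is n/(n + 1) times (bⁿ⁺¹ - 1)/(bⁿ -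
1), exactly the correction by which c_k differs from c. -/
theorem slope_eq (hn : n ≠ 0) (hb : 1 < b) (hf : IsProfile f 1 b) (hg : IsProfile g 1 a)
    (hfg : ∀ x, psi n a b k (deriv f x) = deriv g x) {ω : Form n}
    (hω : ω.HasPotential fun p => g (logNorm p)) (c : Chart n) :
    slope ω (hf.form n) c = cConst n a b := by
  obtain ⟨m, rfl⟩ := Nat.exists_eq_succ_of_ne_zero hn
  have hK := (baseIntegral_pos m).ne'
  have hbn : b ^ (m + 1) - 1 ≠ 0 := (sub_pos.2 (one_lt_pow₀ hb (by simp))).ne'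
  have hfac : ((m + 1).factorial : ℝ) ≠ 0 := by positivity
  have hpi := Real.pi_ne_zero
  have hm1 : (m : ℝ) + 1 ≠ 0 := by positivity
  have hm2 : (m : ℝ) + 2 ≠ 0 := by positivity
  rw [slope, topIntegral, topIntegral,
    show mixedDensity ω (hf.form (m + 1)) c = _ from funext (mixedDensity_eq hn hb hf hg hfg hω c),
    (hf.integral_affine one_pos (one_pos.trans hb) c k _).2,
    (hf.integral_volDensity one_pos (one_pos.trans hb) c).2]
  simp only [ckConst, Nat.succ_eq_add_one, one_pow]
  push_cast
  rw [show (m : ℝ) + 1 + 1 = m + 2 by ring, ← sub_div]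
  field_simp
  ring

theorem solvesModifiedJ (hn : n ≠ 0) (hb : 1 < b) (hf : IsProfile f 1 b) (hg : IsProfile g 1 a)
    (hfg : ∀ x, psi n a b k (deriv f x) = deriv g x) {ω : Form n}
    (hω : ω.HasPotential fun p => g (logNorm p)) : SolvesModifiedJ k ω (hf.form n) := by
  -- The additive constant makes c + θ equal to k f' + c_k; the same mean value computation shows
  -- that it also normalizes θ.
  obtain ⟨θ, hθ⟩ := hf.exists_hamiltonian n k (ckConst n a b k - cConst n a b)
  refine ⟨θ, ⟨fun c => ?_, hf.contraction_eq hθ, fun c => ?_⟩, fun c y => ?_⟩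
  · simp only [hθ]
    exact (contDiff_const.mul (hf.contDiff_momentum c)).add contDiff_const
  · simp only [hθ]
    obtain ⟨m, rfl⟩ := Nat.exists_eq_succ_of_ne_zero hn
    have h := hf.integral_affine one_pos (one_pos.trans hb) c k
      (ckConst (m + 1) a b k - cConst (m + 1) a b)
    refine ⟨h.1, ?_⟩
    have hbn : b ^ (m + 1) - 1 ≠ 0 := (sub_pos.2 (one_lt_pow₀ hb (by simp))).ne'
    have hm1 : (m : ℝ) + 1 ≠ 0 := by positivity
    have hm2 : (m : ℝ) + 2 ≠ 0 := by positivity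
    rw [topIntegral, h.2]
    simp only [ckConst, one_pow]
    push_cast
    rw [show (m : ℝ) + 1 + 1 = m + 2 by ring]
    field_simp
    ring
  · rw [slope_eq hn hb hf hg hfg hω, hθ, mixedDensity_eq hn hb hf hg hfg hω,
      mul_div_cancel_right₀ _ (hf.volDensity_form_pos one_pos (one_pos.trans hb) c y).ne']
    ring

end Equation

end CalabiJ

end

/-! ### The main theorem. -/

theorem theorem2p2 (n : ℕ) (hn : 2 ≤ n) (a b k : ℝ) (ha : 1 < a) (hb : 1 < b) (hk : 0 ≤ k)
    (hck : (n : ℝ) - 1 < CalabiJ.ckConst n a b k + k) :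
    -- the explicit solution of the boundary value problem is strictly increasing
    (ContDiffOn ℝ (⊤ : ℕ∞) (CalabiJ.psi n a b k) (Set.Ioi 0) ∧
      (∀ τ ∈ Set.Icc 1 b,
        deriv (deriv (CalabiJ.psi n a b k)) τ
          + ((n : ℝ) - 1) * (deriv (CalabiJ.psi n a b k) τ / τ)
          - ((n : ℝ) - 1) * (CalabiJ.psi n a b k τ / τ ^ 2) - k = 0) ∧
      CalabiJ.psi n a b k 1 = 1 ∧ CalabiJ.psi n a b k b = a ∧
      (∀ τ ∈ Set.Icc 1 b, 0 < deriv (CalabiJ.psi n a b k) τ) ∧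
      StrictMonoOn (CalabiJ.psi n a b k) (Set.Icc 1 b)) ∧
    -- for every Calabi metric `ω = (√-1 / 2π) ∂∂̄ g(s)` in `a [E_∞] - [E₀]`, the profile `f` with
    -- `ψ(f') = g'` gives a Kähler metric `χ` in `b [E_∞] - [E₀]` that solves the equation
    ∀ (g : ℝ → ℝ) (ω : CalabiJ.Form n), CalabiJ.IsCalabiMetric ω g a 1 →
      ∃ (f : ℝ → ℝ) (χ : CalabiJ.Form n),
        CalabiJ.IsCalabiMetric χ f b 1 ∧
        (∀ s, deriv f s ∈ Set.Ioo 1 b ∧ CalabiJ.psi n a b k (deriv f s) = deriv g s) ∧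
        CalabiJ.SolvesModifiedJ k ω χ ∧
        (∀ c, CalabiJ.slope ω χ c = CalabiJ.cConst n a b) ∧
        -- it is `χ₀ + (√-1 / 2π) ∂∂̄ φ` for any given Kähler metric `χ₀` in that class
        ∀ χ₀ : CalabiJ.Form n, χ₀.IsKahler → χ₀.InClass b 1 →
          ∃ φ : CalabiJ.X n → ℝ, χ.IsPerturbation χ₀ φ := by
  have hn0 : n ≠ 0 := by omega
  have hsub : Set.Icc 1 b ⊆ Set.Ici 1 := Set.Icc_subset_Ici_self
  refine ⟨⟨CalabiJ.contDiffOn_psi, fun τ hτ => ?_, CalabiJ.psi_one hn0, CalabiJ.psi_right hn0 hb,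
    fun τ hτ => ?_, (CalabiJ.strictMonoOn_psi hn hk hck).mono hsub⟩, fun g ω hω => ?_⟩
  · exact CalabiJ.psi_second_order (one_pos.trans_le hτ.1) hn0
  · rw [CalabiJ.deriv_psi (one_pos.trans_le hτ.1).ne']
    exact CalabiJ.psiDeriv_pos hn hk hck hτ.1
  · obtain ⟨f, hf, hfg⟩ := CalabiJ.exists_profile_psi hn hb hk hck hω.profile
    exact ⟨f, hf.form n, hf.isCalabiMetric_form one_pos (one_pos.trans hb), hfg,
      CalabiJ.solvesModifiedJ hn0 hb hf hω.profile (fun x => (hfg x).2) hω.potential,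
      CalabiJ.slope_eq hn0 hb hf hω.profile (fun x => (hfg x).2) hω.potential,
      fun _ _ h => CalabiJ.exists_isPerturbation hf.form_inClass h⟩
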